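/- **Setting.** An End-of-Line instance $G$ on $\{0,1\}^n$ is given by functions $S,P:\{0,1\}^n\to\{0,1\}^n$; there is an edge $u\to v$ iff $u\ne v$, $S(u)=v$ and $P(v)=u$ (a fixed point $S(u)=P(u)=u$ encodes an isolated vertex). The special vertex is $\mathbf 0_n$. An *endpoint* of $G$ is a vertex $v$ such that either $v=\mathbf 0_n$ and $v$ has an incoming edge or no outgoing edge, or $v\neq\mathbf 0_n$ and $v$ has exactly one of an incoming and an outgoing edge. Vectors $\mathbf x\in\mathbb R^{4m}$ are written as four blocks of $m$ coordinates, and $\|\mathbf x\|_2=\big(\frac1{4m}\sum_i x_i^2\big)^{1/2}$ is the normalized norm; all distances are in this norm. Let $\mathrm{Enc}:\{0,1\}^n\to\{0,1\}^m$ be a code of relative distance at least $\kappa$ with $\mathrm{Enc}(\mathbf 0_n)=\mathbf 0_m$. The *Brouwer line segments* of $G$ are the oriented segment from $(\mathbf 0_m,\mathbf 0_m,\mathbf 0_m,\mathbf 2_m)$ to $\mathbf 0_{4m}$ and, for each edge $u\to v$, the four oriented segments joining consecutively $(\mathrm{Enc}(u),\mathrm{Enc}(u),\mathbf 0_m,\mathbf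 0_m)$, $(\mathrm{Enc}(u),\mathrm{Enc}(v),\mathbf 0_m,\mathbf 0_m)$, $(\mathrm{Enc}(u),\mathrm{Enc}(v),\mathbf 1_m,\mathbf 0_m)$, $(\mathrm{Enc}(v),\mathrm{Enc}(v),\mathbf 1_m,\mathbf 0_m)$, $(\mathrm{Enc}(v),\mathrm{Enc}(v),\mathbf 0_m,\mathbf 0_m)$. **Lemma.** For every $\kappa>0$ there are constants $C,c>0$ and $q\in\mathbb N$ such that for every sufficiently small $h>0$ (depending on $\kappa$), every sufficiently small $\delta>0$ (depending on $\kappa,h$) and every $m\ge1$ there is a function $\Phi$, whose arguments are sets of pairs of vectors and whose values are in $\mathbb R^{4m}$, with the following property. For every $n$ and every code $\mathrm{Enc}:\{0,1\}^n\to\{0,1\}^m$ as above one can assign to each End-of-Line instance $G$ on $\{0,1\}^n$ a displacement $g=g_G:[-1,2]^{4m}\to[-\delta,\delta]^{4m}$ such that, with $f(\mathbf x)=\mathbf x+g(\mathbf x)$: 1. $f(\mathbf x)\in[-1,2]^{4m}$ for all $\mathbf x\in[-1,2]^{4m}$. 2. $g$ and $f$ are $C$-Lipschitz with respect to $\|\cdot\|_2$.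 Furthermore, $|g_i(\mathbf x)-g_i(\mathbf y)|$ and $|f_i(\mathbf x)-f_i(\mathbf y)|$ are at most $C\max\{|x_i-y_i|,\|\mathbf x-\mathbf y\|_2\}$ for all $\mathbf x,\mathbf y\in[-1,2]^{4m}$ and every coordinate $i$. 3. $\|g(\mathbf x)\|_2\ge c\,h\,\delta$ for every $\mathbf x\in[-1,2]^{4m}$ at distance at least $2\sqrt h$ from $(\mathrm{Enc}(v),\mathrm{Enc}(v),\mathbf 0_m,\mathbf 0_m)$ for every endpoint $v$ of $G$. (So $\|g(\mathbf x)\|_2=\Omega(\delta)$ for fixed $h$.) 4. If $\mathbf x\in[-1,2]^{4m}$ is at distance at most $2\sqrt h$ from at least one Brouwer line segment, then $g(\mathbf x)$ depends only on the location of $\mathbf x$ relative to the endpoints of the Brouwer line segments near it: $g(\mathbf x)=\Phi(R)$, where $R$ is the set of all $(\mathbf x-\mathbf s,\mathbf x-\mathbf t)$ such that $(\mathbf s\to\mathbf t)$ is a Brouwer line segment of $G$ at distance at most $2\sqrt h$ from $\mathbf x$. 5. If $\mathbf x\in[-1,2]^{4m}$ is at distance at least $2\sqrt h$ from all Brouwer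 line segments of $G$ and from all those of another instance $G'$, then $g_G(\mathbf x)=g_{G'}(\mathbf x)$. 6. The embedding is query-efficient: for each $\mathbf x\in[-1,2]^{4m}$ there is an adaptive query algorithm that, for every $G$, computes $g_G(\mathbf x)$ with at most $q$ queries, where a query at $v$ returns $S(v)$ and $P(v)$. -/

import Mathlib

noncomputable section

namespace BrouwerEOL

/-- An End-of-Line instance on `{0,1}^n`, given by its successor and predecessor functions. -/
structure EOL (n : ℕ) where
  succ : (Fin n → Bool) → (Fin n → Bool)
  pred : (Fin n → Bool) → (Fin n → Bool)

/-- The special vertex `0_n`. -/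
def root (n : ℕ) : Fin n → Bool := fun _ => false

/-- `u → v` is an edge of the graph. A self-loop `u = S(u) = P(u)` is the usual way to encode that
a vertex is isolated, so it is not an edge. -/
def EOL.Edge {n : ℕ} (G : EOL n) (u v : Fin n → Bool) : Prop :=
  u ≠ v ∧ G.succ u = v ∧ G.pred v = u

/-- `v` is an endpoint of a path, other than the prescribed start of a path at the special vertex:
the special vertex counts when it has an incoming edge or no outgoing edge, another vertex counts
when it has exactly one of an incoming edge and an outgoing edge. -/
def EOL.IsEndpoint {n : ℕ} (G : EOL n) (v : Fin n → Bool) : Prop :=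
  (v = root n ∧ ((∃ u, G.Edge u v) ∨ ¬ ∃ w, G.Edge v w)) ∨
  (v ≠ root n ∧ (((∃ u, G.Edge u v) ∧ ¬ ∃ w, G.Edge v w) ∨
    ((∃ w, G.Edge v w) ∧ ¬ ∃ u, G.Edge u v)))

/-- Vectors indexed by `[4] × [m]`. -/
abbrev Vec (m : ℕ) : Type := Fin 4 × Fin m → ℝ

/-- The cube `[-1,2]^{4 × m}`. -/
def cube (m : ℕ) : Set (Vec m) := {x | ∀ i, x i ∈ Set.Icc (-1 : ℝ) 2}

/-- The normalized Euclidean norm: the square root of the average of the squared coordinates. -/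
def nrm {m : ℕ} (x : Vec m) : ℝ := Real.sqrt ((∑ i, x i ^ 2) / (4 * (m : ℝ)))

/-- The vector with the four given blocks of `m` coordinates. -/
def blocks {m : ℕ} (a b c d : Fin m → ℝ) : Vec m := fun i => ![a, b, c, d] i.1 i.2

/-- A binary word as a real vector. -/
def toReal {m : ℕ} (w : Fin m → Bool) : Fin m → ℝ := fun j => if w j then 1 else 0

/-- `Enc` is a binary code with relative distance at least `κ` that maps `0_n` to `0_m`. -/
def IsCode {n m : ℕ} (κ : ℝ) (Enc : (Fin n → Bool) → (Fin m → Bool)) : Prop :=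
  Enc (root n) = root m ∧ ∀ u v, u ≠ v → κ * (m : ℝ) ≤ (hammingDist (Enc u) (Enc v) : ℝ)

/-- The five Brouwer vertices of an edge `u → v`. -/
def brouwerVertex {n m : ℕ} (Enc : (Fin n → Bool) → (Fin m → Bool)) (u v : Fin n → Bool) :
    Fin 5 → Vec m :=
  ![blocks (toReal (Enc u)) (toReal (Enc u)) 0 0,
    blocks (toReal (Enc u)) (toReal (Enc v)) 0 0,
    blocks (toReal (Enc u)) (toReal (Enc v)) 1 0,
    blocks (toReal (Enc v)) (toReal (Enc v)) 1 0,
    blocks (toReal (Enc v)) (toReal (Enc v)) 0 0]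

/-- `(s,t)` is an oriented Brouwer line segment of `G`: either the first one, which goes from
`(0,0,0,2)` to `0`, or one of the four segments that belong to an edge. -/
def IsSegment {n m : ℕ} (Enc : (Fin n → Bool) → (Fin m → Bool)) (G : EOL n) (s t : Vec m) : Prop :=
  (s = blocks 0 0 0 2 ∧ t = 0) ∨
  ∃ u v, G.Edge u v ∧ ∃ k : Fin 4,
    s = brouwerVertex Enc u v k.castSucc ∧ t = brouwerVertex Enc u v k.succ

/-- `x` is `r`-close to the line segment from `s` to `t`. -/
def CloseTo {m : ℕ} (r : ℝ) (s t x : Vec m) : Prop := ∃ z ∈ segment ℝ s t, nrm (x - z) ≤ r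

/-- `x` is `r`-far from the line segment from `s` to `t`. -/
def FarFrom {m : ℕ} (r : ℝ) (s t x : Vec m) : Prop := ∀ z ∈ segment ℝ s t, r ≤ nrm (x - z)

/-- The location of `x` relative to the endpoints of the Brouwer line segments that are `r`-close
to `x`: the set of all pairs `(x - s, x - t)` for such segments `(s,t)`. -/
def relativeLocation {n m : ℕ} (Enc : (Fin n → Bool) → (Fin m → Bool)) (r : ℝ) (G : EOL n)
    (x : Vec m) : Set (Vec m × Vec m) :=
  {p | ∃ s t, IsSegment Enc G s t ∧ CloseTo r s t x ∧ p = (x - s, x - t)}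

/-- An adaptive query algorithm: a query at a vertex returns its successor and predecessor. -/
inductive QueryAlg (n : ℕ) (α : Type) : Type
  | output (a : α) : QueryAlg n α
  | query (v : Fin n → Bool) (next : (Fin n → Bool) → (Fin n → Bool) → QueryAlg n α) : QueryAlg n α

/-- The output of a query algorithm on the instance `G`. -/
def QueryAlg.run {n : ℕ} {α : Type} (G : EOL n) : QueryAlg n α → α
  | .output a => a
  | .query v next => (next (G.succ v) (G.pred v)).run G

/-- The number of queries that a query algorithm makes on the instance `G`. -/
def QueryAlg.cost {n : ℕ} {α : Type} (G : EOL n) : QueryAlg n α → ℕ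
  | .output _ => 0
  | .query v next => (next (G.succ v) (G.pred v)).cost G + 1

end BrouwerEOL

end

/-!
The displacement of an instance is built from a vector field that follows the path of Brouwer line
segments inside a thin tube and is a fixed default field outside. With `ρ = √h` and `r = ρ / 8`, let
`u` be the squared distance from the path in units of `r`. Then the field (`corr`, added to the
default field)

* points along the path for `u < 1`,
* points towards the path around `u = 1`, where the tangential part vanishes,
* points against the direction of the path around `u = 2`, and
* is the default field for `u ≥ 3`, which is `top = (0, 0, 0, 2)` except where the last block is large.

The transitions do not cancel: the tangential direction is orthogonal to the inward direction
(`ip_tang_inward`), and it is orthogonal to `top`, too, except where the path runs against `top`.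
There the direction against the path has a positive component along `top`, and along the first
segment it is replaced by the default field. The constant field `top` would point out of the cube
where the last block is near `2`. Therefore the default field is `top - theta x • x`, which points
towards `top` there, and vanishes only at the start `top` of the first segment, inside its tube.

Consecutive segments are orthogonal, and corners are rounded: the tangential direction is a convex
combination of the two directions whose parameter depends on the position along the corner. Each
segment and each corner contributes one term with cut-offs (`segTerm`, `cornerTerm`), and
`sum_at_corner` shows that the terms that meet at a corner add up to the field of one rounded
corner. By the distance of the code, two segments close to the same point are consecutive, or both
end at `0` and the special vertex has an incoming edge (`eq_or_linked`). So, away from the endpoints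
of paths, the field at each point is the default field or the field around one line or one rounded
corner, and is of order `ρ`. The displacement is this field, scaled by a multiple `ε` of `δ` and
truncated at the boundary of the cube. The truncation does little harm: the inward direction and the
default field at the upper end of the last block stay in the cube, and the rest is truncated only at
the few coordinates at which the point is far from the unit cube or from the first segment
(`nrm_sub_le_nrm_clampMove`). This yields the lower bound `le_nrm_clampMove_fieldOf`.

Only the at most nine segments close to a point contribute to the field there (`fieldOf_segs`).
Hence the field is bounded and Lipschitz with constants that do not depend on the dimension
(`abs_fieldOf_le`, `exists_fieldOf_lipschitz`); the Lipschitz constant depends on `h`, but becomes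
harmless after scaling, because `δ` is small in terms of `h`. Far from all segments the field is the
default field. Close to a segment it is a function of the relative location, and so is the truncated
displacement (`clampMove_eq_of_relativeLocation_eq`). Finally, a segment close to `x` belongs to an
edge that leaves the word near the first block of `x` or enters the word near its second block, so
that four queries determine the field (`fieldOf_eq_of_sameAnswers`).
-/

noncomputable section

namespace BrouwerEOL

/-! ### The normalized inner product -/

/-- The inner product that induces the normalized Euclidean norm `nrm`. -/
def ip {m : ℕ} (x y : Vec m) : ℝ := (∑ i, x i * y i) / (4 * (m : ℝ))

section InnerProduct

variable {m : ℕ}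

lemma ip_comm (x y : Vec m) : ip x y = ip y x := by
  simp only [ip, mul_comm]

lemma ip_add_left (x y z : Vec m) : ip (x + y) z = ip x z + ip y z := by
  simp only [ip, Pi.add_apply, add_mul, Finset.sum_add_distrib, add_div]

lemma ip_smul_left (a : ℝ) (x z : Vec m) : ip (a • x) z = a * ip x z := by
  simp only [ip, Pi.smul_apply, smul_eq_mul, mul_assoc, ← Finset.mul_sum, mul_div_assoc]

lemma ip_neg_left (x z : Vec m) : ip (-x) z = -ip x z := by
  rw [← neg_one_smul ℝ x, ip_smul_left, neg_one_mul]

lemma ip_sub_left (x y z : Vec m) : ip (x - y) z = ip x z - ip y z := by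
  rw [sub_eq_add_neg, ip_add_left, ip_neg_left, sub_eq_add_neg]

lemma ip_zero_left (z : Vec m) : ip 0 z = 0 := by
  simp [ip]

lemma ip_add_right (x y z : Vec m) : ip z (x + y) = ip z x + ip z y := by
  simp only [ip_comm z, ip_add_left]

lemma ip_smul_right (a : ℝ) (x z : Vec m) : ip z (a • x) = a * ip z x := by
  simp only [ip_comm z, ip_smul_left]

lemma ip_neg_right (x z : Vec m) : ip z (-x) = -ip z x := by
  simp only [ip_comm z, ip_neg_left]

lemma ip_sub_right (x y z : Vec m) : ip z (x - y) = ip z x - ip z y := by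
  simp only [ip_comm z, ip_sub_left]

lemma ip_self_nonneg (x : Vec m) : 0 ≤ ip x x := by
  unfold ip
  exact div_nonneg (Finset.sum_nonneg fun i _ => mul_self_nonneg _) (by positivity)

lemma nrm_eq_sqrt (x : Vec m) : nrm x = Real.sqrt (ip x x) := by
  simp only [nrm, ip, pow_two]

lemma nrm_nonneg (x : Vec m) : 0 ≤ nrm x := Real.sqrt_nonneg _

lemma nrm_sq (x : Vec m) : nrm x ^ 2 = ip x x := by
  rw [nrm_eq_sqrt, Real.sq_sqrt (ip_self_nonneg x)]

lemma nrm_le_of_ip_le {x : Vec m} {b : ℝ} (hb : 0 ≤ b) (h : ip x x ≤ b ^ 2) : nrm x ≤ b := by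
  rw [nrm_eq_sqrt]
  exact Real.sqrt_le_iff.mpr ⟨hb, h⟩

lemma le_nrm_of_le_ip {x : Vec m} {b : ℝ} (h : b ^ 2 ≤ ip x x) : b ≤ nrm x := by
  rw [nrm_eq_sqrt]
  exact Real.le_sqrt_of_sq_le h

lemma abs_ip_le (x y : Vec m) : |ip x y| ≤ nrm x * nrm y := by
  rw [← Real.sqrt_sq_eq_abs, nrm_eq_sqrt, nrm_eq_sqrt, ← Real.sqrt_mul (ip_self_nonneg x)]
  apply Real.sqrt_le_sqrt
  have h := Finset.sum_mul_sq_le_sq_mul_sq Finset.univ x y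
  simp only [ip, div_pow, div_mul_div_comm, ← pow_two]
  exact div_le_div_of_nonneg_right h (by positivity)

lemma ip_le (x y : Vec m) : ip x y ≤ nrm x * nrm y := (le_abs_self _).trans (abs_ip_le x y)

lemma nrm_smul (a : ℝ) (x : Vec m) : nrm (a • x) = |a| * nrm x := by
  rw [nrm_eq_sqrt, ip_smul_left, ip_smul_right, ← mul_assoc, nrm_eq_sqrt,
    Real.sqrt_mul (mul_self_nonneg a), Real.sqrt_mul_self_eq_abs]

lemma nrm_neg (x : Vec m) : nrm (-x) = nrm x := by
  rw [nrm_eq_sqrt, nrm_eq_sqrt, ip_neg_left, ip_neg_right, neg_neg]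

lemma nrm_zero : nrm (0 : Vec m) = 0 := by
  rw [nrm_eq_sqrt, ip_zero_left, Real.sqrt_zero]

lemma nrm_add_le (x y : Vec m) : nrm (x + y) ≤ nrm x + nrm y := by
  apply nrm_le_of_ip_le (add_nonneg (nrm_nonneg x) (nrm_nonneg y))
  rw [ip_add_left, ip_add_right, ip_add_right, ip_comm y x, ← nrm_sq, ← nrm_sq]
  nlinarith [ip_le x y]

lemma nrm_sub_le (x y : Vec m) : nrm (x - y) ≤ nrm x + nrm y := by
  rw [sub_eq_add_neg, ← nrm_neg y]
  exact nrm_add_le _ _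

lemma le_nrm_sub (x y : Vec m) : nrm x - nrm y ≤ nrm (x - y) := by
  have := nrm_add_le (x - y) y
  rw [sub_add_cancel] at this
  linarith

/-- A coordinatewise bound on the squares of the entries passes to the norm. -/
lemma nrm_le_of_abs_le {x y : Vec m} {c : ℝ} (hc : 0 ≤ c) (h : ∀ i, |x i| ≤ c * |y i|) :
    nrm x ≤ c * nrm y := by
  apply nrm_le_of_ip_le (mul_nonneg hc (nrm_nonneg y))
  rw [mul_pow, nrm_sq]
  unfold ip
  rw [← mul_div_assoc, Finset.mul_sum]
  apply div_le_div_of_nonneg_right _ (by positivity)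
  apply Finset.sum_le_sum
  intro i _
  have := h i
  calc x i * x i = |x i| ^ 2 := by rw [sq_abs, pow_two]
    _ ≤ (c * |y i|) ^ 2 := pow_le_pow_left₀ (abs_nonneg _) this 2
    _ = c ^ 2 * (y i * y i) := by rw [mul_pow, sq_abs, pow_two (y i)]

lemma ip_const (hm : 0 < m) (b : ℝ) : ip (fun _ : Fin 4 × Fin m => b) (fun _ => b) = b ^ 2 := by
  have : (m : ℝ) ≠ 0 := by positivity
  simp only [ip, Finset.sum_const, Finset.card_univ, Fintype.card_prod, Fintype.card_fin,
    nsmul_eq_mul, Nat.cast_mul, Nat.cast_ofNat]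
  field_simp

lemma nrm_le_of_forall_abs_le (hm : 0 < m) {x : Vec m} {b : ℝ} (hb : 0 ≤ b)
    (h : ∀ i, |x i| ≤ b) : nrm x ≤ b := by
  have h1 : nrm (fun _ : Fin 4 × Fin m => b) ≤ b :=
    nrm_le_of_ip_le hb (ip_const hm b).le
  have h2 := nrm_le_of_abs_le (x := x) (y := fun _ => b) zero_le_one
    (fun i => by rw [one_mul, abs_of_nonneg hb]; exact h i)
  linarith

lemma ip_sum_blocks (x y : Vec m) :
    ip x y = (∑ j, x (0, j) * y (0, j) + ∑ j, x (1, j) * y (1, j) + ∑ j, x (2, j) * y (2, j)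
      + ∑ j, x (3, j) * y (3, j)) / (4 * (m : ℝ)) := by
  rw [ip, Fintype.sum_prod_type, Fin.sum_univ_four]

lemma nrm_le_two_of_cube (hm : 0 < m) {x : Vec m} (hx : x ∈ cube m) : nrm x ≤ 2 :=
  nrm_le_of_forall_abs_le hm zero_le_two fun i => abs_le.mpr ⟨by linarith [(hx i).1], (hx i).2⟩

end InnerProduct

/-! ### Cut-off functions -/

/-- Truncation to the unit interval. -/
def cl01 (x : ℝ) : ℝ := max 0 (min 1 x)

lemma cl01_nonneg (x : ℝ) : 0 ≤ cl01 x := le_max_left _ _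

lemma cl01_le_one (x : ℝ) : cl01 x ≤ 1 := max_le zero_le_one (min_le_left _ _)

lemma cl01_of_nonpos {x : ℝ} (h : x ≤ 0) : cl01 x = 0 :=
  max_eq_left ((min_le_right _ _).trans h)

lemma cl01_of_one_le {x : ℝ} (h : 1 ≤ x) : cl01 x = 1 := by
  rw [cl01, min_eq_left h, max_eq_right zero_le_one]

lemma cl01_of_mem {x : ℝ} (h0 : 0 ≤ x) (h1 : x ≤ 1) : cl01 x = x := by
  rw [cl01, min_eq_right h1, max_eq_right h0]

lemma cl01_pos {x : ℝ} (h : cl01 x ≠ 0) : 0 < x := by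
  by_contra h'
  exact h (cl01_of_nonpos (not_lt.mp h'))

lemma cl01_one_sub (x : ℝ) : cl01 (1 - x) = 1 - cl01 x := by
  unfold cl01
  grind

lemma abs_max_min_sub_le (a b x y : ℝ) :
    |max a (min b x) - max a (min b y)| ≤ |x - y| := by
  grind

lemma abs_cl01_sub_le (x y : ℝ) : |cl01 x - cl01 y| ≤ |x - y| := abs_max_min_sub_le 0 1 x y

/-- The weight of the tangential direction at squared relative distance `u` from the path: it falls
from `1` on the path to `-1` at `u = 2` and vanishes from `u = 3` on. -/
def alpha (u : ℝ) : ℝ := max (1 - u) (min 0 (u - 3))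

lemma abs_alpha_sub_le (x y : ℝ) : |alpha x - alpha y| ≤ |x - y| := by
  unfold alpha
  grind

lemma alpha_of_le_two {u : ℝ} (h : u ≤ 2) : alpha u = 1 - u := by
  unfold alpha
  grind

lemma alpha_of_mem {u : ℝ} (h : 2 ≤ u) (h' : u ≤ 3) : alpha u = u - 3 := by
  unfold alpha
  grind

lemma alpha_of_three_le {u : ℝ} (h : 3 ≤ u) : alpha u = 0 := by
  unfold alpha
  grind

lemma abs_alpha_le {u : ℝ} (h : 0 ≤ u) : |alpha u| ≤ 1 := by
  unfold alpha
  grind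

/-! ### The displacement field -/

/-- The unit vector `(0, 0, 0, 2)`: the start of the first Brouwer line segment, and the direction
of the displacement far from all segments. -/
def top (m : ℕ) : Vec m := blocks 0 0 0 2

/-- The weight of the pull towards the segment from `0` to `top`: it vanishes where the last block
has mean at most `1/2`, and is `1` where that mean is at least `1`. -/
def theta {m : ℕ} (x : Vec m) : ℝ := cl01 (4 * ip x (top m) - 1)

/-- The unit vector in direction `d`. -/
def unit {m : ℕ} (d : Vec m) : Vec m := (nrm d)⁻¹ • d

section Field

variable {m : ℕ}

/-- The tangential direction at a rounded corner between the orthonormal directions `p₁` and `p₂`.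
The parameter `a` falls from `1` before the corner to `0` behind it. -/
def tang (a : ℝ) (p₁ p₂ : Vec m) : Vec m := a • p₁ + (1 - a) • p₂

/-- The direction orthogonal to `tang a p₁ p₂` in the plane of the corner. -/
def perp (a : ℝ) (p₁ p₂ : Vec m) : Vec m := a • p₂ - (1 - a) • p₁

/-- The direction towards the rounded corner, where `ξ` is the position relative to the corner
point. It is orthogonal to `tang a p₁ p₂`; for `a = 1` and `a = 0` it points to the projection of
`ξ` to the line through `p₁` and `p₂`, respectively. -/
def inward (a : ℝ) (p₁ p₂ ξ : Vec m) : Vec m :=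
  -(ξ - ip ξ p₁ • p₁ - ip ξ p₂ • p₂ + ip ξ (perp a p₁ p₂) • perp a p₁ p₂)

/-- The square of the distance from the rounded corner: the part of `ξ` orthogonal to the plane of
the corner, and its coordinate along `perp a p₁ p₂`. For `a = 1` and `a = 0` this is the squared
distance from a straight line. In between `perp a p₁ p₂` is not normalized, so that it is so only up
to a constant factor, see `half_rad2_le`. -/
def rad2 (a : ℝ) (p₁ p₂ ξ : Vec m) : ℝ :=
  ip ξ ξ - ip ξ p₁ ^ 2 - ip ξ p₂ ^ 2 + ip ξ (perp a p₁ p₂) ^ 2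

/-- What has to be added to the default field `top - y` to obtain the field around a rounded corner:
along the path in its centre, then towards the path, then against the direction of the path, and
then back to the default. Where the path runs against `top`, the default field takes the place of
the direction against the path. -/
def corr (r a : ℝ) (p₁ p₂ ξ y : Vec m) : Vec m :=
  alpha (rad2 a p₁ p₂ ξ / r ^ 2) • tang a p₁ p₂
    + cl01 (2 - rad2 a p₁ p₂ ξ / r ^ 2) • inward a p₁ p₂ ξ
    - (1 - cl01 (rad2 a p₁ p₂ ξ / r ^ 2 - 2)) • (top m - y)
    + (max 0 (-alpha (rad2 a p₁ p₂ ξ / r ^ 2)) * ip (tang a p₁ p₂) (top m)) • y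

/-- The contribution of a segment from `s` to `t` at `x`, where `A = x - s` and `B = x - t`. It is
cut off near both ends, except at the start of a segment that runs against `top`: that is the first
segment, which starts at the boundary of the cube. -/
def segTerm (ω r : ℝ) (y A B : Vec m) : Vec m :=
  (cl01 (ip A (unit (A - B)) / ω - 2 - 3 * ip (unit (A - B)) (top m))
    * cl01 (-2 - ip B (unit (A - B)) / ω)) • corr r 1 (unit (A - B)) 0 B y

/-- The contribution of a corner `s → w → t` at `x`, where `A = x - s`, `B = x - w`, `C = x - t`.
Its cut-offs are complementary to those at the end of `s → w` and at the start of `w → t`. -/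
def cornerTerm (ω r : ℝ) (y A B C : Vec m) : Vec m :=
  (cl01 (3 + ip B (unit (A - B)) / ω) * cl01 (3 - ip B (unit (B - C)) / ω)) •
    corr r (cl01 ((1 - (ip B (unit (A - B)) + ip B (unit (B - C))) / ω) / 2))
      (unit (A - B)) (unit (B - C)) B y

/-- The displacement by `v`, truncated so that it does not leave the cube. -/
def clampMove (x v : Vec m) : Vec m := fun i => max (-1) (min 2 (x i + v i)) - x i

lemma sum_top_mul (x : Vec m) : ip x (top m) = (∑ j, x (3, j)) / (2 * m) := by
  rw [ip_sum_blocks]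
  simp only [top, blocks, Matrix.cons_val]
  simp only [mul_zero, Finset.sum_const_zero, zero_add, Pi.ofNat_apply,
    ← Finset.sum_mul]
  rw [show (4 : ℝ) * m = 2 * m * 2 by ring, mul_div_mul_right _ _ two_ne_zero]

lemma ip_top_top (hm : 0 < m) : ip (top m) (top m) = 1 := by
  have : (m : ℝ) ≠ 0 := by positivity
  rw [sum_top_mul]
  simp [top, blocks]
  field_simp

lemma nrm_top (hm : 0 < m) : nrm (top m) = 1 := by
  rw [nrm_eq_sqrt, ip_top_top hm, Real.sqrt_one]

lemma top_mem_Icc (i : Fin 4 × Fin m) : top m i ∈ Set.Icc (0 : ℝ) 2 := by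
  obtain ⟨k, j⟩ := i
  fin_cases k <;> simp [top, blocks]

lemma ip_top_le_one (hm : 0 < m) {x : Vec m} (hx : x ∈ cube m) : ip x (top m) ≤ 1 := by
  have : (0 : ℝ) < m := by positivity
  rw [sum_top_mul, div_le_one (by positivity)]
  calc ∑ j, x (3, j) ≤ ∑ _j : Fin m, (2 : ℝ) := Finset.sum_le_sum fun j _ => (hx (3, j)).2
    _ = 2 * m := by simp [mul_comm]

lemma theta_mem (x : Vec m) : 0 ≤ theta x ∧ theta x ≤ 1 := ⟨cl01_nonneg _, cl01_le_one _⟩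

lemma corr_of_three_le {r a : ℝ} {p₁ p₂ ξ y : Vec m} (h : 3 ≤ rad2 a p₁ p₂ ξ / r ^ 2) :
    corr r a p₁ p₂ ξ y = 0 := by
  rw [corr, alpha_of_three_le h, cl01_of_nonpos (by linarith), cl01_of_one_le (by linarith)]
  simp

lemma rad2_lt_of_corr_ne_zero {r a : ℝ} {p₁ p₂ ξ y : Vec m} (hr : 0 < r)
    (h : corr r a p₁ p₂ ξ y ≠ 0) : rad2 a p₁ p₂ ξ < 3 * r ^ 2 := by
  by_contra h'
  exact h (corr_of_three_le ((le_div_iff₀ (by positivity)).mpr (not_lt.mp h')))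

lemma tang_one (p₁ p₂ : Vec m) : tang 1 p₁ p₂ = p₁ := by simp [tang]

lemma tang_zero (p₁ p₂ : Vec m) : tang 0 p₁ p₂ = p₂ := by simp [tang]

lemma perp_one (p₁ p₂ : Vec m) : perp 1 p₁ p₂ = p₂ := by simp [perp]

lemma perp_zero (p₁ p₂ : Vec m) : perp 0 p₁ p₂ = -p₁ := by simp [perp]

lemma rad2_one (p₁ p₂ ξ : Vec m) : rad2 1 p₁ p₂ ξ = ip ξ ξ - ip ξ p₁ ^ 2 := by
  rw [rad2, perp_one]
  ring

lemma rad2_zero (p₁ p₂ ξ : Vec m) : rad2 0 p₁ p₂ ξ = ip ξ ξ - ip ξ p₂ ^ 2 := by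
  rw [rad2, perp_zero, ip_neg_right]
  ring

lemma inward_one (p₁ p₂ ξ : Vec m) : inward 1 p₁ p₂ ξ = -(ξ - ip ξ p₁ • p₁) := by
  rw [inward, perp_one, sub_add_cancel]

lemma inward_zero (p₁ p₂ ξ : Vec m) : inward 0 p₁ p₂ ξ = -(ξ - ip ξ p₂ • p₂) := by
  rw [inward, perp_zero, ip_neg_right, smul_neg, neg_smul, neg_neg]
  congr 1
  abel

lemma corr_one_eq (r : ℝ) (p₁ p₂ p₂' ξ y : Vec m) :
    corr r 1 p₁ p₂ ξ y = corr r 1 p₁ p₂' ξ y := by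
  simp only [corr, rad2_one, inward_one, tang_one]

lemma corr_zero_eq (r : ℝ) (p₁ p₂ ξ y : Vec m) :
    corr r 0 p₁ p₂ ξ y = corr r 1 p₂ 0 ξ y := by
  simp only [corr, rad2_one, inward_one, tang_one, rad2_zero, inward_zero, tang_zero]

lemma corr_shift {p : Vec m} (hp : ip p p = 1) (r c : ℝ) (ξ y : Vec m) :
    corr r 1 p 0 (ξ + c • p) y = corr r 1 p 0 ξ y := by
  have h1 : ip (ξ + c • p) p = ip ξ p + c := by rw [ip_add_left, ip_smul_left, hp, mul_one]
  have h2 : rad2 1 p 0 (ξ + c • p) = rad2 1 p 0 ξ := by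
    rw [rad2_one, rad2_one, h1]
    simp only [ip_add_left, ip_smul_left, ip_add_right, ip_smul_right, hp, ip_comm p ξ]
    ring
  have h3 : inward 1 p 0 (ξ + c • p) = inward 1 p 0 ξ := by
    rw [inward_one, inward_one, h1, add_smul]
    congr 1
    abel
  simp only [corr, h2, h3]

/-! ### Geometry of a rounded corner -/

section Corner

variable {a : ℝ} {p₁ p₂ : Vec m}

lemma ip_tang_self (h₁ : ip p₁ p₁ = 1) (h₂ : ip p₂ p₂ = 1) (h : ip p₁ p₂ = 0) :
    ip (tang a p₁ p₂) (tang a p₁ p₂) = a ^ 2 + (1 - a) ^ 2 := by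
  simp only [tang, ip_add_left, ip_add_right, ip_smul_left, ip_smul_right, h₁, h₂, h, ip_comm p₂ p₁]
  ring

lemma ip_tang_inward (h₁ : ip p₁ p₁ = 1) (h₂ : ip p₂ p₂ = 1) (h : ip p₁ p₂ = 0) (ξ : Vec m) :
    ip (tang a p₁ p₂) (inward a p₁ p₂ ξ) = 0 := by
  simp only [inward, tang, perp, ip_add_left, ip_add_right, ip_smul_left, ip_smul_right,
    ip_sub_right, ip_neg_right, h₁, h₂, h, ip_comm p₂ p₁, ip_comm p₁ ξ, ip_comm p₂ ξ]
  ring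

lemma ip_inward_self (h₁ : ip p₁ p₁ = 1) (h₂ : ip p₂ p₂ = 1) (h : ip p₁ p₂ = 0) (ξ : Vec m) :
    ip (inward a p₁ p₂ ξ) (inward a p₁ p₂ ξ) =
      ip ξ ξ - ip ξ p₁ ^ 2 - ip ξ p₂ ^ 2 + ip ξ (perp a p₁ p₂) ^ 2 * (a ^ 2 + (1 - a) ^ 2) := by
  simp only [inward, perp, ip_add_left, ip_add_right, ip_smul_left, ip_smul_right,
    ip_sub_left, ip_sub_right, ip_neg_right, ip_neg_left, h₁, h₂, h, ip_comm p₂ p₁,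
    ip_comm p₁ ξ, ip_comm p₂ ξ]
  ring

/-- Bessel's inequality for two orthonormal vectors. -/
lemma sq_ip_add_sq_ip_le (h₁ : ip p₁ p₁ = 1) (h₂ : ip p₂ p₂ = 1) (h : ip p₁ p₂ = 0) (ξ : Vec m) :
    ip ξ p₁ ^ 2 + ip ξ p₂ ^ 2 ≤ ip ξ ξ := by
  have := ip_self_nonneg (ξ - ip ξ p₁ • p₁ - ip ξ p₂ • p₂)
  simp only [ip_smul_left, ip_smul_right, ip_sub_left, ip_sub_right, h₁, h₂, h, ip_comm p₂ p₁,
    ip_comm p₁ ξ, ip_comm p₂ ξ] at this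
  linarith

lemma half_le_sq_add_sq (a : ℝ) : 1 / 2 ≤ a ^ 2 + (1 - a) ^ 2 := by
  nlinarith [sq_nonneg (2 * a - 1)]

lemma half_rad2_le (h₁ : ip p₁ p₁ = 1) (h₂ : ip p₂ p₂ = 1) (h : ip p₁ p₂ = 0) (ξ : Vec m) :
    rad2 a p₁ p₂ ξ / 2 ≤ ip (inward a p₁ p₂ ξ) (inward a p₁ p₂ ξ) := by
  rw [ip_inward_self h₁ h₂ h, rad2]
  nlinarith [sq_ip_add_sq_ip_le h₁ h₂ h ξ, half_le_sq_add_sq a,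
    mul_le_mul_of_nonneg_left (half_le_sq_add_sq a) (sq_nonneg (ip ξ (perp a p₁ p₂)))]

lemma rad2_nonneg (h₁ : ip p₁ p₁ = 1) (h₂ : ip p₂ p₂ = 1) (h : ip p₁ p₂ = 0) (ξ : Vec m) :
    0 ≤ rad2 a p₁ p₂ ξ := by
  rw [rad2]
  nlinarith [sq_ip_add_sq_ip_le h₁ h₂ h ξ, sq_nonneg (ip ξ (perp a p₁ p₂))]

lemma rad2_one_nonneg {p : Vec m} (hp : ip p p = 1) (p₂ ξ : Vec m) : 0 ≤ rad2 1 p p₂ ξ := by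
  have := ip_self_nonneg (ξ - ip ξ p • p)
  simp only [ip_smul_left, ip_smul_right, ip_sub_left, ip_sub_right, hp, ip_comm p ξ] at this
  rw [rad2_one]
  linarith

/-- The two coordinates in the plane of the corner, in terms of the parameter along the corner and
the coordinate orthogonal to it. -/
lemma ip_eq_of_perp (a : ℝ) (p₁ p₂ ξ : Vec m) :
    ip ξ p₁ = a * (ip ξ p₁ + ip ξ p₂) - ip ξ (perp a p₁ p₂) ∧
    ip ξ p₂ = (1 - a) * (ip ξ p₁ + ip ξ p₂) + ip ξ (perp a p₁ p₂) := by
  simp only [perp, ip_sub_right, ip_smul_right]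
  constructor <;> ring

lemma abs_ip_perp_lt (h₁ : ip p₁ p₁ = 1) (h₂ : ip p₂ p₂ = 1) (h : ip p₁ p₂ = 0) {ξ : Vec m}
    {ω r : ℝ} (hr : 0 < r) (hω : ω = 2 * r) (hR : rad2 a p₁ p₂ ξ < 3 * r ^ 2) :
    |ip ξ (perp a p₁ p₂)| < ω := by
  rw [rad2] at hR
  apply abs_lt_of_sq_lt_sq _ (by linarith)
  nlinarith [sq_ip_add_sq_ip_le h₁ h₂ h ξ, sq_pos_of_pos hr]

end Corner

lemma unit_smul_nrm {d : Vec m} (hd : nrm d ≠ 0) : nrm d • unit d = d := by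
  rw [unit, smul_smul, mul_inv_cancel₀ hd, one_smul]

lemma ip_unit_self {d : Vec m} (hd : nrm d ≠ 0) : ip (unit d) (unit d) = 1 := by
  rw [unit, ip_smul_left, ip_smul_right, ← nrm_sq]
  field_simp

lemma nrm_unit_le (d : Vec m) : nrm (unit d) ≤ 1 := by
  rw [unit, nrm_smul, abs_of_nonneg (inv_nonneg.mpr (nrm_nonneg d))]
  exact inv_mul_le_one

lemma active_of_segTerm_ne_zero {ω r : ℝ} (hω : 0 < ω) (hr : 0 < r) {y A B : Vec m}
    (h : segTerm ω r y A B ≠ 0) :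
    rad2 1 (unit (A - B)) 0 B < 3 * r ^ 2 ∧ ip B (unit (A - B)) < -2 * ω ∧
      2 * ω + 3 * ω * ip (unit (A - B)) (top m) < ip A (unit (A - B)) := by
  obtain ⟨h1, h2⟩ := smul_ne_zero_iff.mp h
  obtain ⟨h3, h4⟩ := mul_ne_zero_iff.mp h1
  have h3 := cl01_pos h3
  have h4 := cl01_pos h4
  refine ⟨rad2_lt_of_corr_ne_zero hr h2, ?_, ?_⟩
  · have h5 : ip B (unit (A - B)) / ω < -2 := by linarith
    rwa [div_lt_iff₀ hω] at h5
  · have h5 : 2 + 3 * ip (unit (A - B)) (top m) < ip A (unit (A - B)) / ω := by linarith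
    rw [lt_div_iff₀ hω] at h5
    linarith

/-- A corner contributes only near the corner point. -/
lemma nrm_lt_of_cornerTerm_ne_zero {ω r : ℝ} (hr : 0 < r) (hω : ω = 2 * r) {y A B C : Vec m}
    (h₁ : nrm (A - B) ≠ 0) (h₂ : nrm (B - C) ≠ 0) (h₁₂ : ip (A - B) (B - C) = 0)
    (h : cornerTerm ω r y A B C ≠ 0) : nrm B < 8 * ω := by
  have hω0 : 0 < ω := by linarith
  obtain ⟨h3, h4⟩ := smul_ne_zero_iff.mp h
  obtain ⟨h5, h6⟩ := mul_ne_zero_iff.mp h3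
  have h5 := cl01_pos h5
  have h6 := cl01_pos h6
  have hR := rad2_lt_of_corr_ne_zero hr h4
  have i₁ := ip_unit_self h₁
  have i₂ := ip_unit_self h₂
  have i₁₂ : ip (unit (A - B)) (unit (B - C)) = 0 := by
    rw [unit, unit, ip_smul_left, ip_smul_right, h₁₂, mul_zero, mul_zero]
  generalize unit (A - B) = p₁ at *
  generalize unit (B - C) = p₂ at *
  have h5 : -3 * ω < ip B p₁ := by
    have : -3 < ip B p₁ / ω := by linarith
    rwa [lt_div_iff₀ hω0] at this
  have h6 : ip B p₂ < 3 * ω := by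
    have : ip B p₂ / ω < 3 := by linarith
    rwa [div_lt_iff₀ hω0] at this
  set τ := ip B p₁ + ip B p₂ with hτ
  have hψ := abs_lt.mp (abs_ip_perp_lt i₁ i₂ i₁₂ hr hω hR)
  have hR' := hR
  rw [rad2] at hR'
  obtain ⟨e1, e2⟩ := ip_eq_of_perp (cl01 ((1 - τ / ω) / 2)) p₁ p₂ B
  rw [← hτ] at e1 e2
  have key : |ip B p₁| ≤ 3 * ω ∧ |ip B p₂| ≤ 3 * ω := by
    rcases le_total τ (-ω) with h7 | h7
    · have : τ / ω ≤ -1 := by rw [div_le_iff₀ hω0]; linarith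
      rw [cl01_of_one_le (by linarith)] at e1 e2 hψ
      rw [abs_le, abs_le]
      constructor <;> constructor <;> linarith
    rcases le_total ω τ with h8 | h8
    · have : 1 ≤ τ / ω := by rw [le_div_iff₀ hω0]; linarith
      rw [cl01_of_nonpos (by linarith)] at e1 e2 hψ
      rw [abs_le, abs_le]
      constructor <;> constructor <;> linarith
    have h0 := cl01_nonneg ((1 - τ / ω) / 2)
    have h1 := cl01_le_one ((1 - τ / ω) / 2)
    generalize cl01 ((1 - τ / ω) / 2) = a at *
    rw [abs_le, abs_le]
    constructor <;> constructor <;> nlinarith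
  have k1 := sq_le_sq' (abs_le.mp key.1).1 (abs_le.mp key.1).2
  have k2 := sq_le_sq' (abs_le.mp key.2).1 (abs_le.mp key.2).2
  apply lt_of_pow_lt_pow_left₀ 2 (by positivity)
  rw [nrm_sq]
  nlinarith [sq_nonneg (ip B (perp (cl01 ((1 - τ / ω) / 2)) p₁ p₂)), sq_pos_of_pos hr]

end Field

/-! ### Superposition of the contributions at a corner -/

section LowerBound

variable {m : ℕ}

/-- The cut-off fields of two orthogonal lines and of the rounded corner between them add up to the
field of a rounded corner. -/
lemma cutoff_sum_eq_corr {ω r : ℝ} (hr : 0 < r) (hω : ω = 2 * r) {y B p₁ p₂ : Vec m}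
    (i₁ : ip p₁ p₁ = 1) (i₂ : ip p₂ p₂ = 1) (i₁₂ : ip p₁ p₂ = 0) :
    (cl01 (-2 - ip B p₁ / ω) • corr r 1 p₁ p₂ B y + cl01 (ip B p₂ / ω - 2) • corr r 0 p₁ p₂ B y
      + (cl01 (3 + ip B p₁ / ω) * cl01 (3 - ip B p₂ / ω)) •
        corr r (cl01 ((1 - (ip B p₁ + ip B p₂) / ω) / 2)) p₁ p₂ B y) = 0 ∨
      ∃ a : ℝ, 0 ≤ a ∧ a ≤ 1 ∧
    (cl01 (-2 - ip B p₁ / ω) • corr r 1 p₁ p₂ B y + cl01 (ip B p₂ / ω - 2) • corr r 0 p₁ p₂ B y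
      + (cl01 (3 + ip B p₁ / ω) * cl01 (3 - ip B p₂ / ω)) •
        corr r (cl01 ((1 - (ip B p₁ + ip B p₂) / ω) / 2)) p₁ p₂ B y) = corr r a p₁ p₂ B y := by
  have hω0 : 0 < ω := by linarith
  set τ := ip B p₁ + ip B p₂ with hτ
  have hψ := fun a => @abs_ip_perp_lt _ a p₁ p₂ i₁ i₂ i₁₂ B ω r hr hω
  have perp_eq := fun a => ip_eq_of_perp a p₁ p₂ B
  rw [← hτ] at perp_eq
  have vanish : ∀ a, corr r a p₁ p₂ B y ≠ 0 → |ip B (perp a p₁ p₂)| < ω := fun a h =>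
    hψ a (rad2_lt_of_corr_ne_zero hr h)
  have v₁ := vanish 1
  have v₀ := vanish 0
  rw [perp_one] at v₁
  rw [perp_zero, ip_neg_right, abs_neg] at v₀
  -- Before the corner the rounded corner coincides with the line in direction `p₁`, behind it with
  -- the line in direction `p₂`, and the cut-offs add up to `1`. In between only the corner
  -- contributes.
  rcases le_total τ (-ω) with h7 | h7
  · have : τ / ω ≤ -1 := by rw [div_le_iff₀ hω0]; linarith
    rw [cl01_of_one_le (x := (1 - τ / ω) / 2) (by linarith)]
    have z₀ : cl01 (ip B p₂ / ω - 2) • corr r 0 p₁ p₂ B y = 0 := by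
      by_contra hne
      obtain ⟨h1, h2⟩ := smul_ne_zero_iff.mp hne
      have h1 := cl01_pos h1
      have h2 := abs_lt.mp (v₀ h2)
      have : 2 < ip B p₂ / ω := by linarith
      rw [lt_div_iff₀ hω0] at this
      linarith
    rw [z₀]
    by_cases hk : corr r 1 p₁ p₂ B y = 0
    · left
      rw [hk]
      simp
    · right
      refine ⟨1, zero_le_one, le_rfl, ?_⟩
      have h2 := abs_lt.mp (v₁ hk)
      have h3 : ip B p₂ / ω ≤ 1 := by rw [div_le_iff₀ hω0]; linarith
      rw [cl01_of_one_le (x := 3 - ip B p₂ / ω) (by linarith),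
        show 3 + ip B p₁ / ω = 1 - (-2 - ip B p₁ / ω) by ring, cl01_one_sub, add_zero, mul_one,
        ← add_smul, add_sub_cancel, one_smul]
  rcases le_total ω τ with h8 | h8
  · have : 1 ≤ τ / ω := by rw [le_div_iff₀ hω0]; linarith
    rw [cl01_of_nonpos (x := (1 - τ / ω) / 2) (by linarith)]
    have z₀ : cl01 (-2 - ip B p₁ / ω) • corr r 1 p₁ p₂ B y = 0 := by
      by_contra hne
      obtain ⟨h1, h2⟩ := smul_ne_zero_iff.mp hne
      have h1 := cl01_pos h1
      have h2 := abs_lt.mp (v₁ h2)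
      have : ip B p₁ / ω < -2 := by linarith
      rw [div_lt_iff₀ hω0] at this
      linarith
    rw [z₀]
    by_cases hk : corr r 0 p₁ p₂ B y = 0
    · left
      rw [hk]
      simp
    · right
      refine ⟨0, le_rfl, zero_le_one, ?_⟩
      have h2 := abs_lt.mp (v₀ hk)
      have h3 : -1 ≤ ip B p₁ / ω := by rw [le_div_iff₀ hω0]; linarith
      rw [cl01_of_one_le (x := 3 + ip B p₁ / ω) (by linarith),
        show 3 - ip B p₂ / ω = 1 - (ip B p₂ / ω - 2) by ring, cl01_one_sub, zero_add, one_mul,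
        ← add_smul, add_sub_cancel, one_smul]
  have z₁ : cl01 (-2 - ip B p₁ / ω) • corr r 1 p₁ p₂ B y = 0 := by
    by_contra hne
    obtain ⟨h1, h2⟩ := smul_ne_zero_iff.mp hne
    have h1 := cl01_pos h1
    have h2 := abs_lt.mp (v₁ h2)
    have : ip B p₁ / ω < -2 := by linarith
    rw [div_lt_iff₀ hω0] at this
    linarith
  have z₀ : cl01 (ip B p₂ / ω - 2) • corr r 0 p₁ p₂ B y = 0 := by
    by_contra hne
    obtain ⟨h1, h2⟩ := smul_ne_zero_iff.mp hne
    have h1 := cl01_pos h1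
    have h2 := abs_lt.mp (v₀ h2)
    have : 2 < ip B p₂ / ω := by linarith
    rw [lt_div_iff₀ hω0] at this
    linarith
  rw [z₁, z₀]
  have g0 := cl01_nonneg ((1 - τ / ω) / 2)
  have g1 := cl01_le_one ((1 - τ / ω) / 2)
  generalize cl01 ((1 - τ / ω) / 2) = a at *
  by_cases hk : corr r a p₁ p₂ B y = 0
  · left
    rw [hk]
    simp
  · right
    refine ⟨a, g0, g1, ?_⟩
    have h2 := abs_lt.mp (vanish a hk)
    obtain ⟨e1, e2⟩ := perp_eq a
    have l1 : -2 * ω ≤ ip B p₁ := by nlinarith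
    have l2 : ip B p₂ ≤ 2 * ω := by nlinarith
    have h3 : -2 ≤ ip B p₁ / ω := by rw [le_div_iff₀ hω0]; linarith
    have h4 : ip B p₂ / ω ≤ 2 := by rw [div_le_iff₀ hω0]; linarith
    rw [cl01_of_one_le (x := 3 + ip B p₁ / ω) (by linarith),
      cl01_of_one_le (x := 3 - ip B p₂ / ω) (by linarith), one_mul, one_smul, add_zero, zero_add]

/-- Around the common point of two consecutive segments, the contributions of both segments and of
the corner add up to the field of a rounded corner. -/
lemma sum_at_corner {ω r : ℝ} (hr : 0 < r) (hω : ω = 2 * r) {y A B C : Vec m}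
    (hA : 11 * ω ≤ nrm (A - B)) (hC : 11 * ω ≤ nrm (B - C)) (h₁₂ : ip (A - B) (B - C) = 0)
    (hB : nrm B ≤ 8 * ω) (ht₁ : ip (unit (A - B)) (top m) ≤ 0)
    (ht₂ : ip (unit (B - C)) (top m) = 0) :
    segTerm ω r y A B + segTerm ω r y B C + cornerTerm ω r y A B C = 0 ∨
      ∃ a : ℝ, 0 ≤ a ∧ a ≤ 1 ∧
        segTerm ω r y A B + segTerm ω r y B C + cornerTerm ω r y A B C =
          corr r a (unit (A - B)) (unit (B - C)) B y := by
  have hω0 : 0 < ω := by linarith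
  have h₁ : nrm (A - B) ≠ 0 := by linarith
  have h₂ : nrm (B - C) ≠ 0 := by linarith
  have i₁ := ip_unit_self h₁
  have i₂ := ip_unit_self h₂
  have i₁₂ : ip (unit (A - B)) (unit (B - C)) = 0 := by
    rw [unit, unit, ip_smul_left, ip_smul_right, h₁₂, mul_zero, mul_zero]
  have eA : A = B + nrm (A - B) • unit (A - B) := by rw [unit_smul_nrm h₁]; abel
  have eC : C = B + (-nrm (B - C)) • unit (B - C) := by rw [neg_smul, unit_smul_nrm h₂]; abel
  have n₁ := (abs_le.mp (abs_ip_le B (unit (A - B)))).1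
  have n₂ := (abs_le.mp (abs_ip_le B (unit (B - C)))).2
  have b₁ := mul_le_mul hB (nrm_unit_le (A - B)) (nrm_nonneg _) (by positivity)
  have b₂ := mul_le_mul hB (nrm_unit_le (B - C)) (nrm_nonneg _) (by positivity)
  have jA : ip A (unit (A - B)) = ip B (unit (A - B)) + nrm (A - B) := by
    have := congrArg (fun v => ip v (unit (A - B))) eA
    rwa [ip_add_left, ip_smul_left, i₁, mul_one] at this
  have jC : ip C (unit (B - C)) = ip B (unit (B - C)) - nrm (B - C) := by
    have := congrArg (fun v => ip v (unit (B - C))) eC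
    rwa [ip_add_left, ip_smul_left, i₂, mul_one, ← sub_eq_add_neg] at this
  -- The cut-offs at the far ends of both segments are `1`.
  have cA : cl01 (ip A (unit (A - B)) / ω - 2 - 3 * ip (unit (A - B)) (top m)) = 1 := by
    apply cl01_of_one_le
    have : 3 ≤ ip A (unit (A - B)) / ω := by rw [le_div_iff₀ hω0]; linarith
    linarith
  have cC : cl01 (-2 - ip C (unit (B - C)) / ω) = 1 := by
    apply cl01_of_one_le
    have : ip C (unit (B - C)) / ω ≤ -3 := by rw [div_le_iff₀ hω0]; linarith
    linarith
  have kC : corr r 1 (unit (B - C)) 0 C y = corr r 1 (unit (B - C)) 0 B y := by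
    have := corr_shift i₂ r (-nrm (B - C)) B y
    rwa [← eC] at this
  have sA : segTerm ω r y A B = cl01 (-2 - ip B (unit (A - B)) / ω) •
      corr r 1 (unit (A - B)) (unit (B - C)) B y := by
    rw [segTerm, cA, one_mul, corr_one_eq r _ 0]
  have sC : segTerm ω r y B C = cl01 (ip B (unit (B - C)) / ω - 2) •
      corr r 0 (unit (A - B)) (unit (B - C)) B y := by
    rw [segTerm, cC, mul_one, ht₂, mul_zero, sub_zero, kC, corr_zero_eq]
  rw [sA, sC, cornerTerm]
  exact cutoff_sum_eq_corr hr hω i₁ i₂ i₁₂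

/-! ### Lower bounds for the displacement -/

lemma clampMove_of_mem {x v : Vec m} {i : Fin 4 × Fin m} (h : x i + v i ∈ Set.Icc (-1 : ℝ) 2) :
    clampMove x v i = v i := by
  rw [clampMove, min_eq_right h.2, max_eq_right h.1, add_sub_cancel_left]

/-- If the part `X` of a displacement does not leave the cube, then the truncation changes little:
it can be active only at coordinates where `x` is far from a reference point `z`. -/
lemma nrm_sub_le_nrm_clampMove {x X Y z : Vec m} {M : ℝ} (hM : M ≤ 1 / 4)
    (hX : ∀ i, x i + X i ∈ Set.Icc (-1 : ℝ) 2) (hX' : ∀ i, |X i| ≤ 1 / 4) (hY : ∀ i, |Y i| ≤ M)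
    (hz : ∀ i, (0 < Y i → z i ≤ 5 / 4) ∧ (Y i < 0 → -1 / 4 ≤ z i)) (hM0 : 0 ≤ M) :
    nrm (X + Y) - 4 * M * nrm (x - z) ≤ nrm (clampMove x (X + Y)) := by
  have key : nrm (X + Y - clampMove x (X + Y)) ≤ 4 * M * nrm (x - z) := by
    apply nrm_le_of_abs_le (by positivity)
    intro i
    have h1 := abs_le.mp (hX' i)
    have h2 := abs_le.mp (hY i)
    have h3 := hX i
    have h4 := hz i
    by_cases hi : x i + (X + Y) i ∈ Set.Icc (-1 : ℝ) 2
    · rw [Pi.sub_apply, clampMove_of_mem hi, sub_self, abs_zero]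
      positivity
    · have hle : |(X + Y - clampMove x (X + Y)) i| ≤ M ∧ 1 / 4 ≤ |x i - z i| := by
        simp only [Pi.add_apply, Pi.sub_apply, clampMove, Set.mem_Icc, not_and_or, not_le] at hi h3 ⊢
        rcases hi with hi | hi
        · have := h4.2 (by linarith)
          rw [min_eq_right (by linarith), max_eq_left (by linarith), abs_le, le_abs]
          refine ⟨⟨by linarith, by linarith⟩, Or.inr (by linarith)⟩
        · have := h4.1 (by linarith)
          rw [min_eq_left (by linarith), max_eq_right (by norm_num), abs_le, le_abs]
          refine ⟨⟨by linarith, by linarith⟩, Or.inl (by linarith)⟩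
      have : M * 1 ≤ M * (4 * |x i - z i|) := mul_le_mul_of_nonneg_left (by linarith [hle.2]) hM0
      calc _ ≤ M := hle.1
        _ ≤ 4 * M * |x i - z i| := by linarith
        _ = _ := by rw [Pi.sub_apply]
  have h5 := le_nrm_sub (X + Y) (X + Y - clampMove x (X + Y))
  rw [sub_sub_cancel] at h5
  linarith

/-- The numerical core of the lower bound around a path: at every squared relative distance `u`, the
tangential part, the inward part or the default part is large. -/
lemma quarter_le_of_weights {α β γ P I c T r : ℝ} (hγ : 0 ≤ γ) (hα : γ = 0 ∨ (α ≤ 0 ∧ β = 0))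
    (hP : 1 / 2 ≤ P)
    (hc : c ≤ 0) (hT : T ^ 2 = α ^ 2 * P + β ^ 2 * I ^ 2 + γ ^ 2 + 2 * α * γ * c) (hT0 : 0 ≤ T)
    (hlow : r ≤ |α| / 4 + γ / 4 + β * I / 2) : r + (|α| + γ) / 4 ≤ T := by
  have ha := abs_nonneg α
  have : |α| / 2 + γ / 2 + β * I / 2 ≤ T := by
    apply le_of_sq_le_sq _ hT0
    rw [hT]
    have hs : α ^ 2 / 2 ≤ α ^ 2 * P := by nlinarith [sq_nonneg α]
    have h2 := sq_abs α
    rcases hα with h | ⟨h, h'⟩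
    · rw [h]
      nlinarith [sq_nonneg (|α| - β * I)]
    · rw [h']
      have : 0 ≤ 2 * α * γ * c := by
        have := mul_nonneg (mul_nonneg (neg_nonneg.mpr h) hγ) (neg_nonneg.mpr hc)
        linarith
      nlinarith [sq_nonneg (|α| - γ)]
  linarith

end LowerBound

section LowerBoundField

variable {m : ℕ}

/-- A small step towards points of the cube does not leave the cube. -/
lemma add_smul_sub_mem_Icc {x z w c d : ℝ} (hx : x ∈ Set.Icc (-1 : ℝ) 2)
    (hz : z ∈ Set.Icc (-1 : ℝ) 2) (hw : w ∈ Set.Icc (-1 : ℝ) 2) (hc : 0 ≤ c) (hd : 0 ≤ d)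
    (hcd : c + d ≤ 1) : x + (c * (z - x) + d * (w - x)) ∈ Set.Icc (-1 : ℝ) 2 := by
  obtain ⟨hx1, hx2⟩ := hx
  obtain ⟨hz1, hz2⟩ := hz
  obtain ⟨hw1, hw2⟩ := hw
  constructor <;> nlinarith

lemma abs_smul_sub_le {x z w c d : ℝ} (hx : x ∈ Set.Icc (-1 : ℝ) 2)
    (hz : z ∈ Set.Icc (-1 : ℝ) 2) (hw : w ∈ Set.Icc (-1 : ℝ) 2) (hc : 0 ≤ c) (hd : 0 ≤ d)
    (hcd : c + d ≤ 1 / 16) : |c * (z - x) + d * (w - x)| ≤ 1 / 4 := by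
  obtain ⟨hx1, hx2⟩ := hx
  obtain ⟨hz1, hz2⟩ := hz
  obtain ⟨hw1, hw2⟩ := hw
  rw [abs_le]
  constructor <;> nlinarith

/-- The weights of the field around a path are not all small: the tangential weight vanishes only at
distance `r`, where the inward vector has length at least `r / √2`, and beyond `√3 * r`, where the
default field has weight `1`. -/
lemma le_weights {ρ r R I : ℝ} (hρ : 0 < ρ) (hρ' : ρ ≤ 1) (hr : r = ρ / 8) (hR : 0 ≤ R)
    (hI0 : 0 ≤ I) (hI : R / 2 ≤ I ^ 2) :
    ρ / 64 ≤ |alpha (R / r ^ 2)| / 4 + cl01 (R / r ^ 2 - 2) / 4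
      + cl01 (2 - R / r ^ 2) * I / 2 := by
  have hr0 : 0 < r := by linarith
  have hR' : R = R / r ^ 2 * r ^ 2 := by field_simp
  have hu : 0 ≤ R / r ^ 2 := by positivity
  set u := R / r ^ 2 with hu_def
  have h1 := mul_nonneg (cl01_nonneg (2 - u)) hI0
  have h2 := cl01_nonneg (u - 2)
  have h3 := abs_nonneg (alpha u)
  rcases le_total u (1 / 2) with h | h
  · have : 1 / 2 ≤ |alpha u| := by
      rw [alpha_of_le_two (by linarith)]
      exact le_abs.mpr (Or.inl (by linarith))
    linarith
  rcases le_total u (3 / 2) with h' | h'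
  · have hI' : r / 2 ≤ I := by
      apply le_of_sq_le_sq _ hI0
      nlinarith [sq_pos_of_pos hr0]
    have : 1 / 2 ≤ cl01 (2 - u) := by
      rw [cl01]
      exact le_max_of_le_right (le_min (by norm_num) (by linarith))
    nlinarith
  rcases le_total u 2 with h4 | h4
  · have : 1 / 2 ≤ |alpha u| := by
      rw [alpha_of_le_two (by linarith)]
      exact le_abs.mpr (Or.inr (by linarith))
    linarith
  rcases le_total u 3 with h5 | h5
  · rw [cl01_of_mem (x := u - 2) (by linarith) (by linarith)]
    have : 3 - u ≤ |alpha u| := by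
      rw [alpha_of_mem (by linarith) h5]
      exact le_abs.mpr (Or.inr (by linarith))
    linarith
  · rw [cl01_of_one_le (x := u - 2) (by linarith)]
    linarith

/-- The displacement is large around a path, where the default field is `top`. -/
lemma le_nrm_clampMove_corr (hm : 0 < m) {x z p₁ p₂ ξ y : Vec m} {ρ r K ε a : ℝ}
    (hx : x ∈ cube m)
    (hT : 1 / 2 ≤ ip (tang a p₁ p₂) (tang a p₁ p₂))
    (hTI : ip (tang a p₁ p₂) (inward a p₁ p₂ ξ) = 0)
    (hI : rad2 a p₁ p₂ ξ / 2 ≤ ip (inward a p₁ p₂ ξ) (inward a p₁ p₂ ξ))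
    (hR : 0 ≤ rad2 a p₁ p₂ ξ) (hTt : ip (tang a p₁ p₂) (top m) ≤ 0)
    (hTK : ∀ i, |tang a p₁ p₂ i| ≤ K) (hK : 2 ≤ K) (hρ : 0 < ρ) (hρK : ρ * K ≤ 1 / 100)
    (hr : r = ρ / 8) (hε : 0 ≤ ε) (hεK : ε * K ≤ 1 / 16)
    (hin : ∀ i, x i + inward a p₁ p₂ ξ i ∈ Set.Icc (-1 : ℝ) 2)
    (hz : ∀ i, z i ∈ Set.Icc (0 : ℝ) 1) (hxz : nrm (x - z) ≤ 2 * ρ) (hy : y = 0) :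
    ε * (ρ / 64) ≤ nrm (clampMove x (ε • (top m - y + corr r a p₁ p₂ ξ y))) := by
  have hρ1 : ρ ≤ 1 := by nlinarith
  have hlow := le_weights hρ hρ1 hr hR (nrm_nonneg (inward a p₁ p₂ ξ)) (by rwa [nrm_sq])
  have hα1 := abs_alpha_le (show 0 ≤ rad2 a p₁ p₂ ξ / r ^ 2 by positivity)
  have hcase : cl01 (rad2 a p₁ p₂ ξ / r ^ 2 - 2) = 0 ∨
      (alpha (rad2 a p₁ p₂ ξ / r ^ 2) ≤ 0 ∧ cl01 (2 - rad2 a p₁ p₂ ξ / r ^ 2) = 0) := by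
    rcases le_total (rad2 a p₁ p₂ ξ / r ^ 2) 2 with h | h
    · left
      exact cl01_of_nonpos (by linarith)
    · right
      refine ⟨?_, cl01_of_nonpos (by linarith)⟩
      unfold alpha
      exact max_le (by linarith) (min_le_left _ _)
  rw [corr]
  subst hy
  set α := alpha (rad2 a p₁ p₂ ξ / r ^ 2)
  have hβ0 := cl01_nonneg (2 - rad2 a p₁ p₂ ξ / r ^ 2)
  have hβ1 := cl01_le_one (2 - rad2 a p₁ p₂ ξ / r ^ 2)
  have hγ0 := cl01_nonneg (rad2 a p₁ p₂ ξ / r ^ 2 - 2)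
  have hγ1 := cl01_le_one (rad2 a p₁ p₂ ξ / r ^ 2 - 2)
  set β := cl01 (2 - rad2 a p₁ p₂ ξ / r ^ 2)
  set γ := cl01 (rad2 a p₁ p₂ ξ / r ^ 2 - 2)
  set P := tang a p₁ p₂
  set I := inward a p₁ p₂ ξ
  have hF : ε • (top m - 0 + (α • P + β • I - (1 - γ) • (top m - 0)
      + (max 0 (-α) * ip P (top m)) • (0 : Vec m))) =
      (ε * β) • I + ε • (α • P + γ • top m) := by
    simp only [smul_zero, sub_zero, add_zero, sub_smul, one_smul, smul_add, smul_sub, smul_smul]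
    abel
  rw [hF]
  have hε1 : ε ≤ 1 / 32 := by nlinarith
  have hεβ : 0 ≤ ε * β := mul_nonneg hε hβ0
  have hεβ1 : ε * β ≤ 1 / 32 := by nlinarith
  have ha := abs_nonneg α
  have hIeq : ∀ i, ((ε * β) • I) i = ε * β * (x i + I i - x i) + 0 * (0 - x i) := fun i => by
    simp
  have key := nrm_sub_le_nrm_clampMove (x := x) (X := (ε * β) • I)
    (Y := ε • (α • P + γ • top m)) (z := z) (M := ε * (|α| * K + γ * 2)) (by nlinarith)
    (fun i => by
      rw [hIeq]
      exact add_smul_sub_mem_Icc (hx i) (hin i) (by norm_num) hεβ le_rfl (by linarith))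
    (fun i => by
      rw [hIeq]
      exact abs_smul_sub_le (hx i) (hin i) (by norm_num) hεβ le_rfl (by linarith))
    (fun i => by
      simp only [Pi.smul_apply, Pi.add_apply, smul_eq_mul, abs_mul, abs_of_nonneg hε]
      apply mul_le_mul_of_nonneg_left _ hε
      apply (abs_add_le _ _).trans
      rw [abs_mul, abs_mul, abs_of_nonneg hγ0, abs_of_nonneg (top_mem_Icc i).1]
      exact add_le_add (mul_le_mul_of_nonneg_left (hTK i) ha)
        (mul_le_mul_of_nonneg_left (top_mem_Icc i).2 hγ0))
    (fun i => ⟨fun _ => by linarith [(hz i).2], fun _ => by linarith [(hz i).1]⟩)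
    (by positivity)
  have hN : nrm ((ε * β) • I + ε • (α • P + γ • top m)) =
      ε * nrm (α • P + β • I + γ • top m) := by
    rw [show (ε * β) • I + ε • (α • P + γ • top m) = ε • (α • P + β • I + γ • top m) by
      simp only [smul_add, smul_smul]; abel, nrm_smul, abs_of_nonneg hε]
  have hT2 : nrm (α • P + β • I + γ • top m) ^ 2 =
      α ^ 2 * ip P P + β ^ 2 * nrm I ^ 2 + γ ^ 2 + 2 * α * γ * ip P (top m) := by
    rw [nrm_sq, nrm_sq]
    simp only [ip_add_left, ip_add_right, ip_smul_left, ip_smul_right, ip_top_top hm, hTI,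
      ip_comm I P, ip_comm (top m)]
    rcases hcase with h | ⟨-, h⟩
    · rw [h]; ring
    · rw [h]; ring
  have hq := quarter_le_of_weights hγ0 hcase hT hTt hT2 (nrm_nonneg _) hlow
  rw [hN] at key
  refine le_trans ?_ key
  have hd : 4 * (ε * (|α| * K + γ * 2)) * nrm (x - z) ≤ ε * ((|α| + γ) / 4) := by
    have h0 : 0 ≤ |α| * K + γ * 2 := by positivity
    calc 4 * (ε * (|α| * K + γ * 2)) * nrm (x - z)
        ≤ 4 * (ε * (|α| * K + γ * 2)) * (2 * ρ) :=
          mul_le_mul_of_nonneg_left hxz (by positivity)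
      _ = ε * (8 * ((|α| * K + γ * 2) * ρ)) := by ring
      _ ≤ ε * ((|α| + γ) / 4) := by
        apply mul_le_mul_of_nonneg_left _ hε
        have : γ * 2 * ρ ≤ γ * (ρ * K) := by nlinarith [mul_nonneg hγ0 hρ.le]
        nlinarith
  nlinarith

/-- The field around the first segment, away from its core, is a combination of the direction
towards the segment and of the default field. -/
lemma top_sub_add_corr_neg_top (hm : 0 < m) {x y : Vec m} {r : ℝ}
    (hu : 1 ≤ rad2 1 (-top m) 0 x / r ^ 2) :
    top m - y + corr r 1 (-top m) 0 x y =
      cl01 (2 - rad2 1 (-top m) 0 x / r ^ 2) • (ip x (top m) • top m - x)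
        + cl01 (rad2 1 (-top m) 0 x / r ^ 2 - 1) • (top m - y) := by
  have h : max 0 (-alpha (rad2 1 (-top m) 0 x / r ^ 2)) = -alpha (rad2 1 (-top m) 0 x / r ^ 2) ∧
      -alpha (rad2 1 (-top m) 0 x / r ^ 2) + cl01 (rad2 1 (-top m) 0 x / r ^ 2 - 2) =
        cl01 (rad2 1 (-top m) 0 x / r ^ 2 - 1) := by
    generalize rad2 1 (-top m) 0 x / r ^ 2 = u at *
    unfold alpha cl01
    constructor <;> grind
  rw [corr, ← h.2, h.1, tang_one, inward_one, ip_neg_left, ip_top_top hm, ip_neg_right]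
  generalize alpha (rad2 1 (-top m) 0 x / r ^ 2) = α
  generalize cl01 (rad2 1 (-top m) 0 x / r ^ 2 - 2) = γ
  generalize cl01 (2 - rad2 1 (-top m) 0 x / r ^ 2) = β
  ext i
  simp only [Pi.add_apply, Pi.sub_apply, Pi.smul_apply, Pi.neg_apply, smul_eq_mul]
  ring

lemma theta_lt_one {x : Vec m} (h : theta x < 1) : ip x (top m) < 1 / 2 := by
  by_contra h'
  rw [theta, cl01_of_one_le (by linarith)] at h
  exact lt_irrefl _ h

lemma ip_top_sub_self (hm : 0 < m) (t : ℝ) (x : Vec m) :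
    ip (top m - t • x) (top m - t • x) = (1 - t * ip x (top m)) ^ 2
      + t ^ 2 * rad2 1 (-top m) 0 x := by
  rw [rad2_one]
  simp only [ip_sub_left, ip_sub_right, ip_smul_left, ip_smul_right, ip_top_top hm, ip_neg_right,
    ip_comm (top m) x]
  ring

/-- The projection of a point of the cube to the first segment lies in the cube. -/
lemma smul_top_mem_Icc (hm : 0 < m) {x : Vec m} (hx : x ∈ cube m) (hs : 0 ≤ ip x (top m))
    (i : Fin 4 × Fin m) : (ip x (top m) • top m) i ∈ Set.Icc (-1 : ℝ) 2 := by
  have hs1 := ip_top_le_one hm hx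
  have h1 := (top_mem_Icc i).1
  have h2 := (top_mem_Icc i).2
  rw [Pi.smul_apply, smul_eq_mul]
  constructor <;> nlinarith

lemma ip_proj_top_sub_self (hm : 0 < m) (x : Vec m) :
    ip (ip x (top m) • top m - x) (ip x (top m) • top m - x) = rad2 1 (-top m) 0 x := by
  rw [rad2_one]
  simp only [ip_sub_left, ip_sub_right, ip_smul_left, ip_smul_right, ip_top_top hm, ip_neg_right,
    ip_comm (top m) x]
  ring

lemma rad2_neg_top_nonneg (hm : 0 < m) (x : Vec m) : 0 ≤ rad2 1 (-top m) 0 x := by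
  rw [← ip_proj_top_sub_self hm]
  exact ip_self_nonneg _

/-- In its core, the field around the first segment points downwards and towards the segment, and
the displacement is large. -/
lemma le_nrm_clampMove_first_core (hm : 0 < m) {x y : Vec m} {ρ r ε : ℝ} (hx : x ∈ cube m)
    (hρ : 0 < ρ) (hρ' : ρ ≤ 1 / 200) (hr : r = ρ / 8) (hε : 0 ≤ ε) (hε1 : ε ≤ 1 / 32)
    (hs : 0 ≤ ip x (top m)) (hxz : nrm (x - ip x (top m) • top m) ≤ 2 * ρ)
    (hu : rad2 1 (-top m) 0 x / r ^ 2 ≤ 1) :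
    ε * (ρ / 64) ≤ nrm (clampMove x (ε • (top m - y + corr r 1 (-top m) 0 x y))) := by
  have ht := ip_top_top hm
  have hR := rad2_neg_top_nonneg hm x
  have hz := smul_top_mem_Icc hm hx hs
  have hlow := le_weights hρ (by linarith) hr hR (nrm_nonneg (ip x (top m) • top m - x))
    (by rw [nrm_sq, ip_proj_top_sub_self hm]; linarith)
  have hγ : cl01 (rad2 1 (-top m) 0 x / r ^ 2 - 2) = 0 := cl01_of_nonpos (by linarith)
  have hβ : cl01 (2 - rad2 1 (-top m) 0 x / r ^ 2) = 1 := cl01_of_one_le (by linarith)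
  have hα : alpha (rad2 1 (-top m) 0 x / r ^ 2) = 1 - rad2 1 (-top m) 0 x / r ^ 2 :=
    alpha_of_le_two (by linarith)
  rw [corr, tang_one, inward_one, hγ, hβ]
  rw [hγ, hβ] at hlow
  have hu0 : 0 ≤ rad2 1 (-top m) 0 x / r ^ 2 := by positivity
  have hα0 : 0 ≤ alpha (rad2 1 (-top m) 0 x / r ^ 2) := by rw [hα]; linarith
  have hα1 := (abs_le.mp (abs_alpha_le hu0)).2
  set α := alpha (rad2 1 (-top m) 0 x / r ^ 2)
  have hF : ε • (top m - y + (α • -top m + (1 : ℝ) • -(x - ip x (-top m) • -top m)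
      - (1 - 0 : ℝ) • (top m - y) + (max 0 (-α) * ip (-top m) (top m)) • y)) =
      ε • (ip x (top m) • top m - x) + (ε * α) • -top m := by
    rw [max_eq_left (by linarith), ip_neg_right, zero_mul, zero_smul]
    ext i
    simp only [Pi.add_apply, Pi.sub_apply, Pi.smul_apply, Pi.neg_apply, smul_eq_mul,
      Pi.zero_apply]
    ring
  rw [hF]
  have hIeq : ∀ i, (ε • (ip x (top m) • top m - x)) i =
      ε * ((ip x (top m) • top m) i - x i) + 0 * (0 - x i) := fun i => by simp
  have key := nrm_sub_le_nrm_clampMove (x := x) (X := ε • (ip x (top m) • top m - x))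
    (Y := (ε * α) • -top m) (z := ip x (top m) • top m) (M := ε * α * 2) (by nlinarith)
    (fun i => by
      rw [hIeq]
      exact add_smul_sub_mem_Icc (hx i) (hz i) (by norm_num) hε le_rfl (by linarith))
    (fun i => by
      rw [hIeq]
      exact abs_smul_sub_le (hx i) (hz i) (by norm_num) hε le_rfl (by linarith))
    (fun i => by
      rw [Pi.smul_apply, smul_eq_mul, abs_mul, abs_of_nonneg (by positivity : 0 ≤ ε * α),
        Pi.neg_apply, abs_neg, abs_of_nonneg (top_mem_Icc i).1]
      exact mul_le_mul_of_nonneg_left (top_mem_Icc i).2 (by positivity))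
    (fun i => by
      constructor
      · intro h
        have : 0 ≤ ε * α * top m i := mul_nonneg (by positivity) (top_mem_Icc i).1
        simp only [Pi.smul_apply, Pi.neg_apply, smul_eq_mul] at h
        linarith
      · intro _
        have := mul_nonneg hs (top_mem_Icc i).1
        simp only [Pi.smul_apply, smul_eq_mul]
        linarith)
    (by positivity)
  have hN : nrm (ε • (ip x (top m) • top m - x) + (ε * α) • -top m) =
      ε * nrm (α • -top m + (ip x (top m) • top m - x)) := by
    rw [show ε • (ip x (top m) • top m - x) + (ε * α) • -top m =
      ε • (α • -top m + (ip x (top m) • top m - x)) by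
        rw [smul_add, smul_smul]; abel, nrm_smul, abs_of_nonneg hε]
  have hT2 : nrm (α • -top m + (ip x (top m) • top m - x)) ^ 2 =
      α ^ 2 * 1 + 1 ^ 2 * nrm (ip x (top m) • top m - x) ^ 2 + 0 ^ 2 + 2 * α * 0 * 0 := by
    rw [nrm_sq, nrm_sq]
    simp only [ip_add_left, ip_add_right, ip_smul_left, ip_smul_right, ht, ip_sub_left,
      ip_sub_right, ip_neg_left, ip_neg_right, ip_comm (top m) x]
    ring
  have hq := quarter_le_of_weights le_rfl (Or.inl rfl) (by norm_num) le_rfl hT2 (nrm_nonneg _)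
    hlow
  rw [hN] at key
  refine le_trans ?_ key
  rw [abs_of_nonneg hα0] at hq
  have hd : 4 * (ε * α * 2) * nrm (x - ip x (top m) • top m) ≤ ε * (α / 4) := by
    calc 4 * (ε * α * 2) * nrm (x - ip x (top m) • top m)
        ≤ 4 * (ε * α * 2) * (2 * ρ) := mul_le_mul_of_nonneg_left hxz (by positivity)
      _ = ε * (16 * ρ * α) := by ring
      _ ≤ ε * (α / 4) := by
        apply mul_le_mul_of_nonneg_left _ hε
        nlinarith
  nlinarith
lemma outer_weights_of_lt {β l θ s R r T : ℝ}
    (hT2 : T ^ 2 = β ^ 2 * R + 2 * (β * l * θ * R) + l ^ 2 * ((1 - θ * s) ^ 2 + θ ^ 2 * R))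
    (hT : 0 ≤ T) (hβ : 0 ≤ β) (hl : 0 ≤ l) (hθ : 0 ≤ θ) (hθ1 : θ ≤ 1) (hR : r ^ 2 ≤ R)
    (hs : s < 1 / 2) : (β * r + l / 2) / 2 ≤ T := by
  have hR0 : 0 ≤ R := (sq_nonneg r).trans hR
  have hst : θ * s ≤ 1 / 2 := by nlinarith
  have hD : 1 / 4 ≤ (1 - θ * s) ^ 2 := by nlinarith
  apply le_of_sq_le_sq _ hT
  rw [hT2]
  have h1 : β ^ 2 * r ^ 2 ≤ β ^ 2 * R := mul_le_mul_of_nonneg_left hR (sq_nonneg _)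
  have h2 : l ^ 2 * (1 / 4) ≤ l ^ 2 * ((1 - θ * s) ^ 2 + θ ^ 2 * R) := by
    apply mul_le_mul_of_nonneg_left _ (sq_nonneg _)
    have : 0 ≤ θ ^ 2 * R := by positivity
    linarith
  have h3 : 0 ≤ β * l * θ * R := by positivity
  have h4 := sq_nonneg (β * r - l / 2)
  have h5 := sq_nonneg (β * r)
  have h6 := sq_nonneg l
  linarith [mul_pow β r 2]

lemma outer_weights_of_eq {β l s R r T : ℝ}
    (hT2 : T ^ 2 = β ^ 2 * R + 2 * (β * l * 1 * R) + l ^ 2 * ((1 - 1 * s) ^ 2 + 1 ^ 2 * R))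
    (hT : 0 ≤ T) (hβ : 0 ≤ β) (hl : 0 ≤ l) (hR : r ^ 2 ≤ R) (hsum : 1 ≤ β + l) : r / 2 ≤ T := by
  have hR0 : 0 ≤ R := (sq_nonneg r).trans hR
  apply le_of_sq_le_sq _ hT
  rw [hT2]
  have h1 : 0 ≤ l ^ 2 * (1 - 1 * s) ^ 2 := by positivity
  have h2 : 1 * R ≤ (β + l) ^ 2 * R := by
    apply mul_le_mul_of_nonneg_right _ hR0
    nlinarith
  linarith [sq_nonneg r]

/-- The displacement is large where the field combines the direction towards the first segment with
the default field. -/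
lemma le_nrm_clampMove_first_outer (hm : 0 < m) {x y : Vec m} {ρ r ε β l : ℝ} (hx : x ∈ cube m)
    (hρ : 0 < ρ) (hρ' : ρ ≤ 1 / 200) (hr : r = ρ / 8) (hε : 0 ≤ ε) (hε1 : ε ≤ 1 / 32)
    (hs : 0 ≤ ip x (top m)) (hxz : nrm (x - ip x (top m) • top m) ≤ 2 * ρ)
    (hy : y = theta x • x) (hβ0 : 0 ≤ β) (hβ1 : β ≤ 1) (hl0 : 0 ≤ l) (hl1 : l ≤ 1)
    (hsum : 1 ≤ β + l) (hRge : r ^ 2 ≤ rad2 1 (-top m) 0 x) :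
    ε * (ρ / 64) ≤
      nrm (clampMove x (ε • (β • (ip x (top m) • top m - x) + l • (top m - y)))) := by
  have hr0 : 0 < r := by linarith
  have ht := ip_top_top hm
  have hR := rad2_neg_top_nonneg hm x
  have hz := smul_top_mem_Icc hm hx hs
  obtain ⟨hθ0, hθ1⟩ := theta_mem x
  have hF : ε • (β • (ip x (top m) • top m - x) + l • (top m - y)) =
      (ε * β) • (ip x (top m) • top m - x) + (ε * l * theta x) • (top m - x)
        + (ε * l * (1 - theta x)) • top m := by
    rw [hy]
    ext i
    simp only [Pi.add_apply, Pi.sub_apply, Pi.smul_apply, smul_eq_mul]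
    ring
  have hN : nrm (ε • (β • (ip x (top m) • top m - x) + l • (top m - y))) =
      ε * nrm (β • (ip x (top m) • top m - x) + l • (top m - y)) := by
    rw [nrm_smul, abs_of_nonneg hε]
  have hεβ : 0 ≤ ε * β := by positivity
  have hel : 0 ≤ ε * l * theta x := by positivity
  have hlt : l * theta x ≤ 1 := mul_le_one₀ hl1 hθ0 hθ1
  have hεs : ε * β + ε * l * theta x ≤ 1 / 16 := by nlinarith
  have hYM : 0 ≤ ε * l * (1 - theta x) :=
    mul_nonneg (mul_nonneg hε hl0) (by linarith)
  have hYM' : ε * l * (1 - theta x) ≤ ε * l := by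
    have : 0 ≤ ε * l * theta x := hel
    nlinarith
  have hIeq : ∀ i, ((ε * β) • (ip x (top m) • top m - x)
      + (ε * l * theta x) • (top m - x)) i =
      ε * β * ((ip x (top m) • top m) i - x i) + ε * l * theta x * (top m i - x i) :=
    fun i => by simp
  have htop : ∀ i, top m i ∈ Set.Icc (-1 : ℝ) 2 := fun i =>
    ⟨by linarith [(top_mem_Icc i).1], (top_mem_Icc i).2⟩
  have key := nrm_sub_le_nrm_clampMove (x := x)
    (X := (ε * β) • (ip x (top m) • top m - x) + (ε * l * theta x) • (top m - x))
    (Y := (ε * l * (1 - theta x)) • top m) (z := ip x (top m) • top m)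
    (M := ε * l * (1 - theta x) * 2) (by nlinarith)
    (fun i => by
      rw [hIeq]
      exact add_smul_sub_mem_Icc (hx i) (hz i) (htop i) hεβ hel (by linarith))
    (fun i => by
      rw [hIeq]
      exact abs_smul_sub_le (hx i) (hz i) (htop i) hεβ hel (by linarith))
    (fun i => by
      rw [Pi.smul_apply, smul_eq_mul, abs_mul, abs_of_nonneg hYM,
        abs_of_nonneg (top_mem_Icc i).1]
      exact mul_le_mul_of_nonneg_left (top_mem_Icc i).2 hYM)
    (fun i => by
      have h1 := (top_mem_Icc i).1
      have h2 := (top_mem_Icc i).2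
      constructor
      · intro h
        have hθ : theta x < 1 := by
          by_contra hθ
          have : theta x = 1 := le_antisymm hθ1 (not_lt.mp hθ)
          simp [this] at h
        have := mul_le_mul (theta_lt_one hθ).le h2 h1 (by norm_num)
        simp only [Pi.smul_apply, smul_eq_mul]
        linarith
      · intro _
        have := mul_nonneg hs h1
        simp only [Pi.smul_apply, smul_eq_mul]
        linarith)
    (by positivity)
  rw [hF]
  rw [← hF, hN, hF] at key
  refine le_trans ?_ key
  have hT2 : nrm (β • (ip x (top m) • top m - x) + l • (top m - y)) ^ 2 =
      β ^ 2 * rad2 1 (-top m) 0 x + 2 * (β * l * theta x * rad2 1 (-top m) 0 x)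
        + l ^ 2 * ((1 - theta x * ip x (top m)) ^ 2
          + theta x ^ 2 * rad2 1 (-top m) 0 x) := by
    rw [nrm_sq, hy, ← ip_top_sub_self hm, rad2_one]
    simp only [ip_add_left, ip_add_right, ip_smul_left, ip_smul_right, ht, ip_sub_left,
      ip_sub_right, ip_neg_right, ip_comm (top m) x]
    ring
  rcases hθ1.lt_or_eq with hθ | hθ
  · have hT := outer_weights_of_lt hT2 (nrm_nonneg _) hβ0 hl0 hθ0 hθ1 hRge (theta_lt_one hθ)
    have hd : 4 * (ε * l * (1 - theta x) * 2) * nrm (x - ip x (top m) • top m)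
        ≤ ε * (l / 8) := by
      calc 4 * (ε * l * (1 - theta x) * 2) * nrm (x - ip x (top m) • top m)
          ≤ 4 * (ε * l * 2) * (2 * ρ) := by
            apply mul_le_mul _ hxz (nrm_nonneg _) (by positivity)
            linarith
        _ = ε * (16 * ρ * l) := by ring
        _ ≤ ε * (l / 8) := by
          apply mul_le_mul_of_nonneg_left _ hε
          have : ρ * l ≤ 1 / 200 * l := mul_le_mul_of_nonneg_right hρ' hl0
          linarith
    have hβl : ρ * 1 ≤ ρ * (β + l) := mul_le_mul_of_nonneg_left hsum hρ.le
    have hρl : ρ * l ≤ 1 / 200 * l := mul_le_mul_of_nonneg_right hρ' hl0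
    rw [hr] at hT
    have := mul_le_mul_of_nonneg_left
      (show ρ / 64 + l / 8 ≤ nrm (β • (ip x (top m) • top m - x) + l • (top m - y)) by linarith) hε
    linarith
  · rw [hθ, sub_self, mul_zero, zero_mul, mul_zero, zero_mul, sub_zero]
    apply mul_le_mul_of_nonneg_left _ hε
    rw [hθ] at hT2
    have := outer_weights_of_eq hT2 (nrm_nonneg _) hβ0 hl0 hRge hsum
    linarith

/-- The displacement is large around the first segment. -/
lemma le_nrm_clampMove_first (hm : 0 < m) {x y : Vec m} {ρ r ε : ℝ} (hx : x ∈ cube m)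
    (hρ : 0 < ρ) (hρ' : ρ ≤ 1 / 200) (hr : r = ρ / 8) (hε : 0 ≤ ε) (hε1 : ε ≤ 1 / 32)
    (hs : 0 ≤ ip x (top m)) (hxz : nrm (x - ip x (top m) • top m) ≤ 2 * ρ)
    (hy : y = theta x • x) :
    ε * (ρ / 64) ≤ nrm (clampMove x (ε • (top m - y + corr r 1 (-top m) 0 x y))) := by
  have hr0 : 0 < r := by linarith
  rcases le_total (rad2 1 (-top m) 0 x / r ^ 2) 1 with hu | hu
  · exact le_nrm_clampMove_first_core hm hx hρ hρ' hr hε hε1 hs hxz hu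
  · rw [top_sub_add_corr_neg_top hm hu]
    refine le_nrm_clampMove_first_outer hm hx hρ hρ' hr hε hε1 hs hxz hy (cl01_nonneg _)
      (cl01_le_one _) (cl01_nonneg _) (cl01_le_one _) ?_ ?_
    · rw [show 2 - rad2 1 (-top m) 0 x / r ^ 2 = 1 - (rad2 1 (-top m) 0 x / r ^ 2 - 1) by ring,
        cl01_one_sub]
      linarith
    · rwa [le_div_iff₀ (by positivity), one_mul] at hu

/-- The displacement is large where the field has its default value. -/
lemma le_nrm_clampMove_default (hm : 0 < m) {x y : Vec m} {ρ r ε : ℝ} (hx : x ∈ cube m)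
    (hρ : 0 < ρ) (hρ' : ρ ≤ 1 / 200) (hr : r = ρ / 8) (hε : 0 ≤ ε) (hε1 : ε ≤ 1 / 32)
    (hfar : theta x < 1 ∨ r ^ 2 ≤ rad2 1 (-top m) 0 x) (hy : y = theta x • x) :
    ε * (ρ / 64) ≤ nrm (clampMove x (ε • (top m - y))) := by
  have hr0 : 0 < r := by linarith
  obtain ⟨hθ0, hθ1⟩ := theta_mem x
  rcases hθ1.lt_or_eq with hθ | hθ
  · have hs := theta_lt_one hθ
    have hm' : (0 : ℝ) < m := by positivity
    have key : ε * (1 / 3) ≤ ip (clampMove x (ε • (top m - y))) (top m) := by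
      rw [sum_top_mul, le_div_iff₀ (by positivity)]
      have h1 : ∀ j, ε * (2 / 3) * (2 - x (3, j)) ≤ clampMove x (ε • (top m - y)) (3, j) := by
        intro j
        obtain ⟨hx1, hx2⟩ := hx (3, j)
        have hv : (ε • (top m - y)) (3, j) = ε * (2 - theta x * x (3, j)) := by
          simp [hy, top, blocks]
        have hv1 : 2 / 3 * (2 - x (3, j)) ≤ 2 - theta x * x (3, j) := by nlinarith
        have hv2 := mul_le_mul_of_nonneg_left hv1 hε
        have hv3 : 0 ≤ ε * (2 / 3 * (2 - x (3, j))) := by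
          apply mul_nonneg hε
          linarith
        have hv4 : ε * (2 / 3 * (2 - x (3, j))) ≤ 2 - x (3, j) := by nlinarith
        rw [clampMove, hv, max_eq_right (le_min (by norm_num) (by linarith)), le_sub_iff_add_le,
          le_min_iff]
        constructor <;> linarith
      have h2 : ∑ j, ε * (2 / 3) * (2 - x (3, j)) =
          ε * (2 / 3) * (2 * m * (1 - ip x (top m))) := by
        rw [← Finset.mul_sum, Finset.sum_sub_distrib, sum_top_mul, Finset.sum_const,
          Finset.card_univ, Fintype.card_fin, nsmul_eq_mul, mul_one_sub,
          mul_div_cancel₀ _ (by positivity)]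
        ring
      calc ε * (1 / 3) * (2 * m) ≤ ε * (2 / 3) * (2 * m * (1 - ip x (top m))) := by
            have : 0 ≤ ε * m := by positivity
            nlinarith
        _ ≤ _ := by
            rw [← h2]
            exact Finset.sum_le_sum fun j _ => h1 j
    have h3 := ip_le (clampMove x (ε • (top m - y))) (top m)
    rw [nrm_top hm, mul_one] at h3
    nlinarith
  · rw [hθ] at hfar
    have hR : r ^ 2 ≤ rad2 1 (-top m) 0 x := hfar.resolve_left (lt_irrefl _)
    rw [hy, hθ, one_smul]
    have h1 : clampMove x (ε • (top m - x)) = ε • (top m - x) := by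
      ext i
      apply clampMove_of_mem
      have := add_smul_sub_mem_Icc (hx i) (z := top m i) (w := 0)
        ⟨by linarith [(top_mem_Icc i).1], (top_mem_Icc i).2⟩ (by norm_num) hε le_rfl
        (by linarith)
      simpa using this
    rw [h1, nrm_smul, abs_of_nonneg hε]
    apply mul_le_mul_of_nonneg_left _ hε
    have h2 : r ≤ nrm (top m - x) := by
      apply le_nrm_of_le_ip
      have := ip_top_sub_self hm 1 x
      rw [one_smul] at this
      rw [this]
      nlinarith [sq_nonneg (1 - 1 * ip x (top m))]
    linarith

end LowerBoundField

/-! ### Segments close to a point -/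

section Segments

variable {n m : ℕ}

/-- The block `k` of `x` is `b`-close to `c`. -/
def NearBlock (b : ℝ) (k : Fin 4) (c : Fin m → ℝ) (x : Vec m) : Prop :=
  ∑ j, (x (k, j) - c j) ^ 2 ≤ 4 * m * b ^ 2

lemma nearBlock_of_nrm_le {b : ℝ} {k : Fin 4} {c : Fin m → ℝ} {x z : Vec m} (hm : 0 < m)
    (h : nrm (x - z) ≤ b) (hz : ∀ j, z (k, j) = c j) : NearBlock b k c x := by
  have hm' : (0 : ℝ) < m := by positivity
  have h1 : ip (x - z) (x - z) ≤ b ^ 2 := by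
    rw [← nrm_sq]
    exact pow_le_pow_left₀ (nrm_nonneg _) h 2
  rw [ip, div_le_iff₀ (by positivity)] at h1
  have h2 : ∑ j, (x (k, j) - c j) ^ 2 ≤ ∑ i, (x - z) i * (x - z) i := by
    rw [Fintype.sum_prod_type]
    refine le_trans (le_of_eq ?_) (Finset.single_le_sum
      (f := fun k => ∑ j, (x - z) (k, j) * (x - z) (k, j))
      (fun k _ => Finset.sum_nonneg fun j _ => mul_self_nonneg _) (Finset.mem_univ k))
    exact Finset.sum_congr rfl fun j _ => by rw [Pi.sub_apply, hz j, pow_two]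
  rw [NearBlock]
  linarith

lemma nearBlock_of_closeTo {b : ℝ} {k : Fin 4} {c : Fin m → ℝ} {s t x : Vec m} (hm : 0 < m)
    (h : CloseTo b s t x) (hs : ∀ j, s (k, j) = c j) (ht : ∀ j, t (k, j) = c j) :
    NearBlock b k c x := by
  obtain ⟨z, ⟨p, q, -, -, hpq, rfl⟩, h⟩ := h
  refine nearBlock_of_nrm_le hm h fun j => ?_
  rw [Pi.add_apply, Pi.smul_apply, Pi.smul_apply, hs, ht, ← add_smul, hpq, one_smul]

lemma NearBlock.sum_sq_sub_le {b : ℝ} {k : Fin 4} {c c' : Fin m → ℝ} {x : Vec m}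
    (h : NearBlock b k c x) (h' : NearBlock b k c' x) :
    ∑ j, (c j - c' j) ^ 2 ≤ 16 * m * b ^ 2 := by
  have : ∑ j, (c j - c' j) ^ 2 ≤ ∑ j, (2 * (x (k, j) - c j) ^ 2 + 2 * (x (k, j) - c' j) ^ 2) :=
    Finset.sum_le_sum fun j _ => by nlinarith [sq_nonneg (x (k, j) - c j + (x (k, j) - c' j))]
  rw [Finset.sum_add_distrib, ← Finset.mul_sum, ← Finset.mul_sum] at this
  unfold NearBlock at h h'
  linarith

lemma sum_sq_toReal_sub (w w' : Fin m → Bool) :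
    ∑ j, (toReal w j - toReal w' j) ^ 2 = hammingDist w w' := by
  rw [hammingDist, Finset.card_filter, Nat.cast_sum]
  refine Finset.sum_congr rfl fun j _ => ?_
  rcases hw : w j <;> rcases hw' : w' j <;> simp [toReal, hw, hw']

variable {κ : ℝ} {Enc : (Fin n → Bool) → (Fin m → Bool)}

lemma NearBlock.code_unique (hm : 0 < m) (hEnc : IsCode κ Enc) {ρ : ℝ} (hρ : 64 * ρ ^ 2 < κ)
    {k : Fin 4} {x : Vec m} {u v : Fin n → Bool} (hu : NearBlock (2 * ρ) k (toReal (Enc u)) x)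
    (hv : NearBlock (2 * ρ) k (toReal (Enc v)) x) : u = v := by
  by_contra huv
  have h1 := hu.sum_sq_sub_le hv
  have h2 := hEnc.2 u v huv
  rw [sum_sq_toReal_sub] at h1
  have hm' : (0 : ℝ) < m := by positivity
  nlinarith

lemma NearBlock.not_zero_one (hm : 0 < m) {ρ : ℝ} (hρ : 64 * ρ ^ 2 < 1) {k : Fin 4} {x : Vec m}
    (h0 : NearBlock (2 * ρ) k 0 x) (h1 : NearBlock (2 * ρ) k 1 x) : False := by
  have h := h0.sum_sq_sub_le h1
  have hm' : (0 : ℝ) < m := by positivity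
  simp at h
  nlinarith

lemma toReal_code_root (hEnc : IsCode κ Enc) : toReal (Enc (root n)) = 0 := by
  rw [hEnc.1]
  ext j
  simp [toReal, root]

lemma toReal_mem (w : Fin m → Bool) (j : Fin m) : toReal w j ∈ Set.Icc (0 : ℝ) 1 := by
  rw [toReal]
  split_ifs <;> simp

/-- The kind of a segment close to `x`, with the blocks of `x` that it determines: each segment
moves in one block only, and is constant in the three others. -/
inductive CloseKind (Enc : (Fin n → Bool) → (Fin m → Bool)) (G : EOL n) (b : ℝ) (x : Vec m) :
    Vec m → Vec m → Prop
  | first (h0 : NearBlock b 0 (toReal (Enc (root n))) x)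
      (h1 : NearBlock b 1 (toReal (Enc (root n))) x) (h2 : NearBlock b 2 0 x) :
      CloseKind Enc G b x (top m) 0
  | second (u v : Fin n → Bool) (h : G.Edge u v) (h0 : NearBlock b 0 (toReal (Enc u)) x)
      (h2 : NearBlock b 2 0 x) (h3 : NearBlock b 3 0 x) :
      CloseKind Enc G b x (blocks (toReal (Enc u)) (toReal (Enc u)) 0 0)
        (blocks (toReal (Enc u)) (toReal (Enc v)) 0 0)
  | third (u v : Fin n → Bool) (h : G.Edge u v) (h0 : NearBlock b 0 (toReal (Enc u)) x)
      (h1 : NearBlock b 1 (toReal (Enc v)) x) (h3 : NearBlock b 3 0 x) :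
      CloseKind Enc G b x (blocks (toReal (Enc u)) (toReal (Enc v)) 0 0)
        (blocks (toReal (Enc u)) (toReal (Enc v)) 1 0)
  | fourth (u v : Fin n → Bool) (h : G.Edge u v) (h1 : NearBlock b 1 (toReal (Enc v)) x)
      (h2 : NearBlock b 2 1 x) (h3 : NearBlock b 3 0 x) :
      CloseKind Enc G b x (blocks (toReal (Enc u)) (toReal (Enc v)) 1 0)
        (blocks (toReal (Enc v)) (toReal (Enc v)) 1 0)
  | fifth (u v : Fin n → Bool) (h : G.Edge u v) (h0 : NearBlock b 0 (toReal (Enc v)) x)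
      (h1 : NearBlock b 1 (toReal (Enc v)) x) (h3 : NearBlock b 3 0 x) :
      CloseKind Enc G b x (blocks (toReal (Enc v)) (toReal (Enc v)) 1 0)
        (blocks (toReal (Enc v)) (toReal (Enc v)) 0 0)

variable {G : EOL n}

lemma closeKind_of_closeTo (hm : 0 < m) (hEnc : IsCode κ Enc) {b : ℝ} {x s t : Vec m}
    (hst : IsSegment Enc G s t) (h : CloseTo b s t x) : CloseKind Enc G b x s t := by
  rcases hst with ⟨rfl, rfl⟩ | ⟨u, v, huv, k, rfl, rfl⟩
  · have h0 := toReal_code_root hEnc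
    apply CloseKind.first
    · exact nearBlock_of_closeTo hm h (fun j => by simp [blocks, h0]) (fun j => by simp [h0])
    · exact nearBlock_of_closeTo hm h (fun j => by simp [blocks, h0]) (fun j => by simp [h0])
    · exact nearBlock_of_closeTo hm h (fun j => by simp [blocks]) (fun j => by simp)
  · fin_cases k
    · exact .second u v huv (nearBlock_of_closeTo hm h (fun j => rfl) (fun j => rfl))
        (nearBlock_of_closeTo hm h (fun j => rfl) (fun j => rfl))
        (nearBlock_of_closeTo hm h (fun j => rfl) (fun j => rfl))
    · exact .third u v huv (nearBlock_of_closeTo hm h (fun j => rfl) (fun j => rfl))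
        (nearBlock_of_closeTo hm h (fun j => rfl) (fun j => rfl))
        (nearBlock_of_closeTo hm h (fun j => rfl) (fun j => rfl))
    · exact .fourth u v huv (nearBlock_of_closeTo hm h (fun j => rfl) (fun j => rfl))
        (nearBlock_of_closeTo hm h (fun j => rfl) (fun j => rfl))
        (nearBlock_of_closeTo hm h (fun j => rfl) (fun j => rfl))
    · exact .fifth u v huv (nearBlock_of_closeTo hm h (fun j => rfl) (fun j => rfl))
        (nearBlock_of_closeTo hm h (fun j => rfl) (fun j => rfl))
        (nearBlock_of_closeTo hm h (fun j => rfl) (fun j => rfl))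

lemma ip_blocks (a b c d a' b' c' d' : Fin m → ℝ) :
    ip (blocks a b c d) (blocks a' b' c' d') =
      (∑ j, a j * a' j + ∑ j, b j * b' j + ∑ j, c j * c' j + ∑ j, d j * d' j) / (4 * (m : ℝ)) := by
  rw [ip_sum_blocks]
  rfl

lemma blocks_sub (a b c d a' b' c' d' : Fin m → ℝ) :
    blocks a b c d - blocks a' b' c' d' = blocks (a - a') (b - b') (c - c') (d - d') := by
  ext ⟨k, j⟩
  fin_cases k <;> rfl

lemma blocks_zero : blocks (0 : Fin m → ℝ) 0 0 0 = 0 := by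
  ext ⟨k, j⟩
  fin_cases k <;> rfl

/-- The relation between two distinct segments close to a common point: they are orthogonal, and
they are consecutive or both end at `0`. In the last case the special vertex is an endpoint. -/
def Linked (G : EOL n) (s t s' t' : Vec m) : Prop :=
  ip (t - s) (t' - s') = 0 ∧
    (t = s' ∨ t' = s ∨ (t = 0 ∧ t' = 0 ∧ ∃ u, G.Edge u (root n)))

lemma Linked.symm {s t s' t' : Vec m} (h : Linked G s t s' t') : Linked G s' t' s t := by
  refine ⟨by rw [ip_comm]; exact h.1, ?_⟩
  rcases h.2 with h | h | ⟨h, h', h''⟩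
  · exact Or.inr (Or.inl h)
  · exact Or.inl h
  · exact Or.inr (Or.inr ⟨h', h, h''⟩)

/-- Two segments close to `x` agree on enough blocks to share the words that determine them: the
code has no two codewords close to the same block. -/
lemma eq_or_linked_of_closeKind (hm : 0 < m) (hEnc : IsCode κ Enc) {ρ : ℝ} (hρ : 64 * ρ ^ 2 < κ)
    (hρ1 : 64 * ρ ^ 2 < 1) {x s t s' t' : Vec m} (h : CloseKind Enc G (2 * ρ) x s t)
    (h' : CloseKind Enc G (2 * ρ) x s' t') : (s = s' ∧ t = t') ∨ Linked G s t s' t' := by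
  have uq : ∀ {k : Fin 4} {u v : Fin n → Bool}, NearBlock (2 * ρ) k (toReal (Enc u)) x →
      NearBlock (2 * ρ) k (toReal (Enc v)) x → u = v := fun hu hv => hu.code_unique hm hEnc hρ hv
  have no : ∀ {k : Fin 4}, NearBlock (2 * ρ) k 0 x → NearBlock (2 * ρ) k 1 x → False :=
    fun a b => a.not_zero_one hm hρ1 b
  have hroot := toReal_code_root hEnc
  have first_second : ∀ u v, G.Edge u v → u = root n → Linked G (top m) 0
      (blocks (toReal (Enc u)) (toReal (Enc u)) 0 0)
      (blocks (toReal (Enc u)) (toReal (Enc v)) 0 0) := by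
    rintro u v - rfl
    refine ⟨?_, Or.inl ?_⟩
    · rw [← blocks_zero, top, blocks_sub, blocks_sub, ip_blocks]
      simp
    · rw [hroot, blocks_zero]
  have first_fifth : ∀ u v, G.Edge u v → v = root n → Linked G (top m) 0
      (blocks (toReal (Enc v)) (toReal (Enc v)) 1 0)
      (blocks (toReal (Enc v)) (toReal (Enc v)) 0 0) := by
    rintro u v huv rfl
    refine ⟨?_, Or.inr (Or.inr ⟨rfl, ?_, u, huv⟩)⟩
    · rw [← blocks_zero, top, blocks_sub, blocks_sub, ip_blocks]
      simp
    · rw [hroot, blocks_zero]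
  have second_third : ∀ u v, Linked G (blocks (toReal (Enc u)) (toReal (Enc u)) 0 0)
      (blocks (toReal (Enc u)) (toReal (Enc v)) 0 0)
      (blocks (toReal (Enc u)) (toReal (Enc v)) 0 0)
      (blocks (toReal (Enc u)) (toReal (Enc v)) 1 0) := by
    intro u v
    refine ⟨?_, Or.inl rfl⟩
    rw [blocks_sub, blocks_sub, ip_blocks]
    simp
  have third_fourth : ∀ u v, Linked G (blocks (toReal (Enc u)) (toReal (Enc v)) 0 0)
      (blocks (toReal (Enc u)) (toReal (Enc v)) 1 0)
      (blocks (toReal (Enc u)) (toReal (Enc v)) 1 0)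
      (blocks (toReal (Enc v)) (toReal (Enc v)) 1 0) := by
    intro u v
    refine ⟨?_, Or.inl rfl⟩
    rw [blocks_sub, blocks_sub, ip_blocks]
    simp
  have fourth_fifth : ∀ u v, Linked G (blocks (toReal (Enc u)) (toReal (Enc v)) 1 0)
      (blocks (toReal (Enc v)) (toReal (Enc v)) 1 0)
      (blocks (toReal (Enc v)) (toReal (Enc v)) 1 0)
      (blocks (toReal (Enc v)) (toReal (Enc v)) 0 0) := by
    intro u v
    refine ⟨?_, Or.inl rfl⟩
    rw [blocks_sub, blocks_sub, ip_blocks]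
    simp
  have fifth_second : ∀ v w, Linked G (blocks (toReal (Enc v)) (toReal (Enc v)) 1 0)
      (blocks (toReal (Enc v)) (toReal (Enc v)) 0 0)
      (blocks (toReal (Enc v)) (toReal (Enc v)) 0 0)
      (blocks (toReal (Enc v)) (toReal (Enc w)) 0 0) := by
    intro v w
    refine ⟨?_, Or.inl rfl⟩
    rw [blocks_sub, blocks_sub, ip_blocks]
    simp
  have succ_eq : ∀ {u v v'}, G.Edge u v → G.Edge u v' → v = v' := fun h h' => h.2.1.symm.trans h'.2.1
  have pred_eq : ∀ {u u' v}, G.Edge u v → G.Edge u' v → u = u' := fun h h' => h.2.2.symm.trans h'.2.2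
  cases h with
  | first a0 a1 a2 =>
    cases h' with
    | first b0 b1 b2 => exact Or.inl ⟨rfl, rfl⟩
    | second u v e b0 b2 b3 => exact Or.inr (first_second u v e (uq b0 a0))
    | third u v e b0 b1 b3 => exact absurd ((uq b0 a0).trans (uq a1 b1)) e.1
    | fourth u v e b1 b2 b3 => exact (no a2 b2).elim
    | fifth u v e b0 b1 b3 => exact Or.inr (first_fifth u v e (uq b0 a0))
  | second u v e a0 a2 a3 =>
    cases h' with
    | first b0 b1 b2 => exact Or.inr (first_second u v e (uq a0 b0)).symm
    | second u' v' e' b0 b2 b3 =>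
      obtain rfl := uq a0 b0
      obtain rfl := succ_eq e e'
      exact Or.inl ⟨rfl, rfl⟩
    | third u' v' e' b0 b1 b3 =>
      obtain rfl := uq a0 b0
      obtain rfl := succ_eq e e'
      exact Or.inr (second_third _ _)
    | fourth u' v' e' b1 b2 b3 => exact (no a2 b2).elim
    | fifth u' v' e' b0 b1 b3 =>
      obtain rfl := uq a0 b0
      exact Or.inr (fifth_second _ _).symm
  | third u v e a0 a1 a3 =>
    cases h' with
    | first b0 b1 b2 => exact absurd ((uq a0 b0).trans (uq b1 a1)) e.1
    | second u' v' e' b0 b2 b3 =>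
      obtain rfl := uq a0 b0
      obtain rfl := succ_eq e e'
      exact Or.inr (second_third _ _).symm
    | third u' v' e' b0 b1 b3 =>
      obtain rfl := uq a0 b0
      obtain rfl := succ_eq e e'
      exact Or.inl ⟨rfl, rfl⟩
    | fourth u' v' e' b1 b2 b3 =>
      obtain rfl := uq a1 b1
      obtain rfl := pred_eq e e'
      exact Or.inr (third_fourth _ _)
    | fifth u' v' e' b0 b1 b3 => exact absurd ((uq a0 b0).trans (uq b1 a1)) e.1
  | fourth u v e a1 a2 a3 =>
    cases h' with
    | first b0 b1 b2 => exact (no b2 a2).elim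
    | second u' v' e' b0 b2 b3 => exact (no b2 a2).elim
    | third u' v' e' b0 b1 b3 =>
      obtain rfl := uq a1 b1
      obtain rfl := pred_eq e e'
      exact Or.inr (third_fourth _ _).symm
    | fourth u' v' e' b1 b2 b3 =>
      obtain rfl := uq a1 b1
      obtain rfl := pred_eq e e'
      exact Or.inl ⟨rfl, rfl⟩
    | fifth u' v' e' b0 b1 b3 =>
      obtain rfl := uq a1 b1
      exact Or.inr (fourth_fifth _ _)
  | fifth u v e a0 a1 a3 =>
    cases h' with
    | first b0 b1 b2 => exact Or.inr (first_fifth u v e (uq a0 b0)).symm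
    | second u' v' e' b0 b2 b3 =>
      obtain rfl := uq a0 b0
      exact Or.inr (fifth_second _ _)
    | third u' v' e' b0 b1 b3 => exact absurd ((uq b0 a0).trans (uq a1 b1)) e'.1
    | fourth u' v' e' b1 b2 b3 =>
      obtain rfl := uq a1 b1
      exact Or.inr (fourth_fifth _ _).symm
    | fifth u' v' e' b0 b1 b3 =>
      obtain rfl := uq a0 b0
      exact Or.inl ⟨rfl, rfl⟩

/-! ### Single segments -/

lemma nrm_sq_toReal_sub_ge (hm : 0 < m) (hEnc : IsCode κ Enc) {u v : Fin n → Bool} (huv : u ≠ v) :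
    κ / 4 ≤ (∑ j, (toReal (Enc u) j - toReal (Enc v) j) ^ 2) / (4 * (m : ℝ)) := by
  have hm' : (0 : ℝ) < m := by positivity
  rw [sum_sq_toReal_sub, le_div_iff₀ (by positivity)]
  have := hEnc.2 u v huv
  linarith

/-- The facts about a single segment other than the first one: its ends lie in the unit cube, it
is orthogonal to `top`, its last block vanishes and it is not short. -/
lemma isSegment_cases (hm : 0 < m) (hEnc : IsCode κ Enc) {s t : Vec m}
    (h : IsSegment Enc G s t) :
    (s = top m ∧ t = 0) ∨ ((∀ i, s i ∈ Set.Icc (0 : ℝ) 1) ∧ (∀ i, t i ∈ Set.Icc (0 : ℝ) 1) ∧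
      ip s (top m) = 0 ∧ ip t (top m) = 0 ∧ (∀ j, s (3, j) = 0) ∧ (∀ j, t (3, j) = 0) ∧
      min κ 1 / 4 ≤ ip (t - s) (t - s)) := by
  rcases h with h | ⟨u, v, huv, k, rfl, rfl⟩
  · exact Or.inl h
  right
  have hm' : (m : ℝ) ≠ 0 := by positivity
  have mem : ∀ (a b : Fin n → Bool) (c : Fin m → ℝ), (∀ j, c j ∈ Set.Icc (0 : ℝ) 1) →
      ∀ i, blocks (toReal (Enc a)) (toReal (Enc b)) c 0 i ∈ Set.Icc (0 : ℝ) 1 := by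
    rintro a b c hc ⟨k, j⟩
    fin_cases k
    · exact toReal_mem _ j
    · exact toReal_mem _ j
    · exact hc j
    · simp [blocks]
  have orth : ∀ a b c : Fin m → ℝ, ip (blocks a b c 0) (top m) = 0 := by
    intro a b c
    rw [top, ip_blocks]
    simp
  have m0 : ∀ j : Fin m, (0 : Fin m → ℝ) j ∈ Set.Icc (0 : ℝ) 1 := fun j => by simp
  have m1 : ∀ j : Fin m, (1 : Fin m → ℝ) j ∈ Set.Icc (0 : ℝ) 1 := fun j => by simp
  have hd := nrm_sq_toReal_sub_ge hm hEnc huv.1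
  have hk1 : min κ 1 / 4 ≤ κ / 4 := by linarith [min_le_left κ 1]
  have hk2 : min κ 1 / 4 ≤ 1 / 4 := by linarith [min_le_right κ 1]
  have sq : ∀ j, (toReal (Enc v) j - toReal (Enc u) j) * (toReal (Enc v) j - toReal (Enc u) j) =
      (toReal (Enc u) j - toReal (Enc v) j) ^ 2 := fun j => by ring
  fin_cases k
  · refine ⟨mem _ _ _ m0, mem _ _ _ m0, orth _ _ _, orth _ _ _, fun j => rfl, fun j => rfl, ?_⟩
    refine hk1.trans (hd.trans (le_of_eq ?_))
    simp only [brouwerVertex, Fin.mk_zero, Fin.castSucc_zero, Matrix.cons_val, Fin.succ_zero_eq_one]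
    rw [blocks_sub, ip_blocks]
    simp [sq]
  · refine ⟨mem _ _ _ m0, mem _ _ _ m1, orth _ _ _, orth _ _ _, fun j => rfl, fun j => rfl, ?_⟩
    refine hk2.trans (le_of_eq ?_)
    change _ = ip (blocks _ _ _ _ - blocks _ _ _ _) (blocks _ _ _ _ - blocks _ _ _ _)
    rw [blocks_sub, ip_blocks]
    simp
    field_simp
  · refine ⟨mem _ _ _ m1, mem _ _ _ m1, orth _ _ _, orth _ _ _, fun j => rfl, fun j => rfl, ?_⟩
    refine hk1.trans (hd.trans (le_of_eq ?_))
    change _ = ip (blocks _ _ _ _ - blocks _ _ _ _) (blocks _ _ _ _ - blocks _ _ _ _)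
    rw [blocks_sub, ip_blocks]
    simp [sq]
  · refine ⟨mem _ _ _ m1, mem _ _ _ m0, orth _ _ _, orth _ _ _, fun j => rfl, fun j => rfl, ?_⟩
    refine hk2.trans (le_of_eq ?_)
    change _ = ip (blocks _ _ _ _ - blocks _ _ _ _) (blocks _ _ _ _ - blocks _ _ _ _)
    rw [blocks_sub, ip_blocks]
    simp
    field_simp

/-- A segment that does not end at an endpoint is followed by a segment. -/
lemma exists_next (hEnc : IsCode κ Enc) {s t : Vec m} (h : IsSegment Enc G s t) :
    (∃ t', IsSegment Enc G t t') ∨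
      ∃ v, G.IsEndpoint v ∧ t = blocks (toReal (Enc v)) (toReal (Enc v)) 0 0 := by
  rcases h with ⟨rfl, rfl⟩ | ⟨u, v, huv, k, rfl, rfl⟩
  · have h0 : (0 : Vec m) = blocks (toReal (Enc (root n))) (toReal (Enc (root n))) 0 0 := by
      rw [toReal_code_root hEnc, blocks_zero]
    by_cases hw : ∃ w, G.Edge (root n) w
    · obtain ⟨w, hw⟩ := hw
      exact Or.inl ⟨_, Or.inr ⟨root n, w, hw, 0, h0, rfl⟩⟩
    · exact Or.inr ⟨root n, Or.inl ⟨rfl, Or.inr hw⟩, h0⟩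
  · fin_cases k
    · exact Or.inl ⟨_, Or.inr ⟨u, v, huv, 1, rfl, rfl⟩⟩
    · exact Or.inl ⟨_, Or.inr ⟨u, v, huv, 2, rfl, rfl⟩⟩
    · exact Or.inl ⟨_, Or.inr ⟨u, v, huv, 3, rfl, rfl⟩⟩
    · by_cases hw : ∃ w, G.Edge v w
      · obtain ⟨w, hw⟩ := hw
        exact Or.inl ⟨_, Or.inr ⟨v, w, hw, 0, rfl, rfl⟩⟩
      · refine Or.inr ⟨v, ?_, rfl⟩
        by_cases hv : v = root n
        · exact Or.inl ⟨hv, Or.inl ⟨u, huv⟩⟩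
        · exact Or.inr ⟨hv, Or.inl ⟨⟨u, huv⟩, hw⟩⟩

/-- A segment other than the first one that does not start at an endpoint is preceded by a
segment. -/
lemma exists_prev (hEnc : IsCode κ Enc) {s t : Vec m} (h : IsSegment Enc G s t) :
    (s = top m ∧ t = 0) ∨ (∃ s', IsSegment Enc G s' s) ∨
      ∃ v, G.IsEndpoint v ∧ s = blocks (toReal (Enc v)) (toReal (Enc v)) 0 0 := by
  rcases h with h | ⟨u, v, huv, k, rfl, rfl⟩
  · exact Or.inl h
  right
  fin_cases k
  · by_cases hw : ∃ w, G.Edge w u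
    · obtain ⟨w, hw⟩ := hw
      exact Or.inl ⟨_, Or.inr ⟨w, u, hw, 3, rfl, rfl⟩⟩
    · by_cases hu : u = root n
      · left
        refine ⟨top m, Or.inl ⟨rfl, ?_⟩⟩
        subst hu
        change blocks _ _ _ _ = _
        rw [toReal_code_root hEnc, blocks_zero]
      · exact Or.inr ⟨u, Or.inr ⟨hu, Or.inr ⟨⟨v, huv⟩, hw⟩⟩, rfl⟩
  · exact Or.inl ⟨_, Or.inr ⟨u, v, huv, 0, rfl, rfl⟩⟩
  · exact Or.inl ⟨_, Or.inr ⟨u, v, huv, 1, rfl, rfl⟩⟩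
  · exact Or.inl ⟨_, Or.inr ⟨u, v, huv, 2, rfl, rfl⟩⟩

end Segments

/-! ### The displacement field of an instance -/

/-- The scales of the construction: `l` bounds the lengths of the segments from below, and `ρ` is
the width of the tubes around them. -/
structure Scale (κ l ρ : ℝ) : Prop where
  l_pos : 0 < l
  l_le : l ≤ 1 / 2
  l_sq : 4 * l ^ 2 ≤ min κ 1
  ρ_pos : 0 < ρ
  ρ_le : ρ ≤ l / 100

section ScaleLemmas

variable {κ l ρ : ℝ} (hS : Scale κ l ρ)
include hS

lemma Scale.sq_lt : 64 * ρ ^ 2 < κ ∧ 64 * ρ ^ 2 < 1 := by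
  have h1 := hS.l_sq
  have h2 := hS.ρ_le
  have h3 := hS.ρ_pos
  have h4 := hS.l_pos
  have h5 : 64 * ρ ^ 2 < 4 * l ^ 2 := by nlinarith
  exact ⟨(h5.trans_le h1).trans_le (min_le_left _ _), (h5.trans_le h1).trans_le (min_le_right _ _)⟩

lemma Scale.two_le : 2 ≤ 1 / l := by
  rw [le_div_iff₀ hS.l_pos]
  linarith [hS.l_le]

lemma Scale.mul_le : ρ * (1 / l) ≤ 1 / 100 := by
  have h1 := hS.ρ_le
  have h2 := hS.l_pos
  rw [mul_one_div, div_le_iff₀ h2]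
  linarith

lemma Scale.ρ_le' : ρ ≤ 1 / 200 := by
  have h1 := hS.ρ_le
  have h2 := hS.l_le
  linarith

end ScaleLemmas

section Instance

variable {n m : ℕ}

lemma finite_segments (Enc : (Fin n → Bool) → (Fin m → Bool)) (G : EOL n) :
    {σ : Vec m × Vec m | IsSegment Enc G σ.1 σ.2}.Finite := by
  refine ((Set.finite_singleton (top m, (0 : Vec m))).union (Set.finite_range
    (fun p : (Fin n → Bool) × (Fin n → Bool) × Fin 4 =>
      (brouwerVertex Enc p.1 p.2.1 p.2.2.castSucc, brouwerVertex Enc p.1 p.2.1 p.2.2.succ)))).subset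
        ?_
  rintro ⟨s, t⟩ (⟨h1, h2⟩ | ⟨u, v, -, k, h1, h2⟩)
  · exact Or.inl (Prod.ext h1 h2)
  · exact Or.inr ⟨(u, v, k), Prod.ext h1.symm h2.symm⟩

/-- The finite set of all Brouwer line segments of `G`. -/
def segs (Enc : (Fin n → Bool) → (Fin m → Bool)) (G : EOL n) : Finset (Vec m × Vec m) :=
  (finite_segments Enc G).toFinset

lemma mem_segs {Enc : (Fin n → Bool) → (Fin m → Bool)} {G : EOL n} {σ : Vec m × Vec m} :
    σ ∈ segs Enc G ↔ IsSegment Enc G σ.1 σ.2 := by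
  rw [segs, Set.Finite.mem_toFinset, Set.mem_ofPred_eq]

open Classical in
/-- The segments that are `b`-close to `x`. -/
def closeSegs (Enc : (Fin n → Bool) → (Fin m → Bool)) (G : EOL n) (b : ℝ) (x : Vec m) :
    Finset (Vec m × Vec m) :=
  (segs Enc G).filter fun σ => CloseTo b σ.1 σ.2 x

lemma mem_closeSegs {Enc : (Fin n → Bool) → (Fin m → Bool)} {G : EOL n} {b : ℝ} {x : Vec m}
    {σ : Vec m × Vec m} :
    σ ∈ closeSegs Enc G b x ↔ IsSegment Enc G σ.1 σ.2 ∧ CloseTo b σ.1 σ.2 x := by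
  classical
  rw [closeSegs, Finset.mem_filter, mem_segs]

open Classical in
/-- The displacement field, before scaling and truncation, in terms of a finite set `T` of pairs
`(x - s, x - t)`, and of the vector `y` that is subtracted from `top` in the default field. -/
def relField (ρ : ℝ) (T : Finset (Vec m × Vec m)) (y : Vec m) : Vec m :=
  top m - y + ∑ p ∈ T, segTerm (ρ / 4) (ρ / 8) y p.1 p.2
    + ∑ p ∈ T, ∑ q ∈ T,
      if p.2 = q.1 then cornerTerm (ρ / 4) (ρ / 8) y p.1 p.2 q.2 else 0

open Classical in
/-- The displacement field at `x`, before scaling and truncation, of a finite set of segments. -/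
def fieldOf (ρ : ℝ) (T : Finset (Vec m × Vec m)) (x : Vec m) : Vec m :=
  top m - theta x • x + ∑ σ ∈ T, segTerm (ρ / 4) (ρ / 8) (theta x • x) (x - σ.1) (x - σ.2)
    + ∑ σ ∈ T, ∑ τ ∈ T, if σ.2 = τ.1 then
      cornerTerm (ρ / 4) (ρ / 8) (theta x • x) (x - σ.1) (x - σ.2) (x - τ.2) else 0

open Classical in
lemma fieldOf_eq_relField (ρ : ℝ) (T : Finset (Vec m × Vec m)) (x : Vec m) :
    fieldOf ρ T x = relField ρ (T.image fun σ => (x - σ.1, x - σ.2)) (theta x • x) := by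
  have inj : Function.Injective fun σ : Vec m × Vec m => (x - σ.1, x - σ.2) := by
    rintro ⟨a, b⟩ ⟨c, d⟩ h
    simpa using h
  simp only [fieldOf, relField, Finset.sum_image inj.injOn, sub_right_inj]

lemma fieldOf_eq_of_subset {ρ : ℝ} {T T' : Finset (Vec m × Vec m)} {x : Vec m} (hT : T' ⊆ T)
    (h1 : ∀ σ ∈ T, segTerm (ρ / 4) (ρ / 8) (theta x • x) (x - σ.1) (x - σ.2) ≠ 0 → σ ∈ T')
    (h2 : ∀ σ ∈ T, ∀ τ ∈ T, σ.2 = τ.1 →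
      cornerTerm (ρ / 4) (ρ / 8) (theta x • x) (x - σ.1) (x - σ.2) (x - τ.2) ≠ 0 →
        σ ∈ T' ∧ τ ∈ T') :
    fieldOf ρ T x = fieldOf ρ T' x := by
  classical
  rw [fieldOf, fieldOf]
  congr 1
  · congr 1
    refine (Finset.sum_subset hT fun σ hσ hσ' => ?_).symm
    by_contra h
    exact hσ' (h1 σ hσ h)
  · have h3 : ∀ σ ∈ T, ∀ τ ∈ T, (if σ.2 = τ.1 then
        cornerTerm (ρ / 4) (ρ / 8) (theta x • x) (x - σ.1) (x - σ.2) (x - τ.2) else 0) ≠ 0 →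
          σ ∈ T' ∧ τ ∈ T' := by
      intro σ hσ τ hτ h
      split_ifs at h with h'
      · exact h2 σ hσ τ hτ h' h
      · exact absurd rfl h
    rw [← Finset.sum_subset hT fun σ hσ hσ' => ?_]
    · refine Finset.sum_congr rfl fun σ hσ => ?_
      refine (Finset.sum_subset hT fun τ hτ hτ' => ?_).symm
      by_contra h
      exact hτ' (h3 σ (hT hσ) τ hτ h).2
    · refine Finset.sum_eq_zero fun τ hτ => ?_
      by_contra h
      exact hσ' (h3 σ hσ τ hτ h).1

variable {κ l ρ : ℝ} {Enc : (Fin n → Bool) → (Fin m → Bool)} {G : EOL n}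

lemma le_nrm_segment (hm : 0 < m) (hS : Scale κ l ρ) (hEnc : IsCode κ Enc) {s t : Vec m}
    (h : IsSegment Enc G s t) : l ≤ nrm (t - s) := by
  rcases isSegment_cases hm hEnc h with ⟨rfl, rfl⟩ | ⟨-, -, -, -, -, -, h⟩
  · rw [zero_sub, nrm_neg, nrm_top hm]
    linarith [hS.l_le]
  · apply le_nrm_of_le_ip
    linarith [hS.l_sq]

lemma unit_neg_top (hm : 0 < m) : unit (0 - top m) = -top m := by
  rw [unit, zero_sub, nrm_neg, nrm_top hm, inv_one, one_smul]

/-- The direction of a segment is `-top` for the first one, and orthogonal to `top` otherwise. -/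
lemma unit_segment_cases (hm : 0 < m) (hEnc : IsCode κ Enc) {s t : Vec m}
    (h : IsSegment Enc G s t) :
    (s = top m ∧ t = 0 ∧ unit (t - s) = -top m ∧ ip (unit (t - s)) (top m) = -1) ∨
      (ip s (top m) = 0 ∧ ip (unit (t - s)) (top m) = 0) := by
  rcases isSegment_cases hm hEnc h with ⟨rfl, rfl⟩ | ⟨-, -, h1, h2, -⟩
  · refine Or.inl ⟨rfl, rfl, unit_neg_top hm, ?_⟩
    rw [unit_neg_top hm, ip_neg_left, ip_top_top hm]
  · refine Or.inr ⟨h1, ?_⟩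
    rw [unit, ip_smul_left, ip_sub_left, h1, h2, sub_zero, mul_zero]

lemma ip_end_top (hm : 0 < m) (hEnc : IsCode κ Enc) {s t : Vec m}
    (h : IsSegment Enc G s t) : ip t (top m) = 0 := by
  rcases isSegment_cases hm hEnc h with ⟨rfl, rfl⟩ | ⟨-, -, h1, h2, -⟩
  · rw [ip_zero_left]
  · exact h2

lemma end_mem_Icc (hm : 0 < m) (hEnc : IsCode κ Enc) {s t : Vec m}
    (h : IsSegment Enc G s t) (i : Fin 4 × Fin m) : t i ∈ Set.Icc (0 : ℝ) 1 := by
  rcases isSegment_cases hm hEnc h with ⟨rfl, rfl⟩ | ⟨-, h, -⟩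
  · simp
  · exact h i

lemma abs_unit_segment_le (hm : 0 < m) (hS : Scale κ l ρ) (hEnc : IsCode κ Enc) {s t : Vec m}
    (h : IsSegment Enc G s t) (i : Fin 4 × Fin m) : |unit (t - s) i| ≤ 1 / l := by
  have hl := hS.l_pos
  have hn := le_nrm_segment hm hS hEnc h
  rcases isSegment_cases hm hEnc h with ⟨rfl, rfl⟩ | ⟨h1, h2, -⟩
  · rw [unit_neg_top hm, Pi.neg_apply, abs_neg, abs_of_nonneg (top_mem_Icc i).1]
    exact (top_mem_Icc i).2.trans hS.two_le
  · have h3 : |t i - s i| ≤ 1 := by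
      rw [abs_le]
      constructor <;> linarith [(h1 i).1, (h1 i).2, (h2 i).1, (h2 i).2]
    have h4 : 0 < nrm (t - s) := hl.trans_le hn
    rw [unit, Pi.smul_apply, smul_eq_mul, abs_mul, abs_of_pos (inv_pos.mpr h4), Pi.sub_apply,
      inv_mul_eq_div]
    exact div_le_div₀ zero_le_one h3 hl hn

/-- Where the contribution of a segment is active, `x` is close to its projection to the segment. -/
lemma exists_proj_of_active (hm : 0 < m) (hS : Scale κ l ρ) (hEnc : IsCode κ Enc) {x s t : Vec m}
    (hx : x ∈ cube m) (h : IsSegment Enc G s t)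
    (hR : rad2 1 (unit (t - s)) 0 (x - t) < 3 * (ρ / 8) ^ 2)
    (hB : ip (x - t) (unit (t - s)) < -2 * (ρ / 4))
    (hA : 2 * (ρ / 4) + 3 * (ρ / 4) * ip (unit (t - s)) (top m) < ip (x - s) (unit (t - s))) :
    t + ip (x - t) (unit (t - s)) • unit (t - s) ∈ segment ℝ s t ∧
      nrm (x - (t + ip (x - t) (unit (t - s)) • unit (t - s))) < ρ := by
  have hρ := hS.ρ_pos
  have hn : 0 < nrm (t - s) := hS.l_pos.trans_le (le_nrm_segment hm hS hEnc h)
  have hu := ip_unit_self hn.ne'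
  have hst : ip (x - s) (unit (t - s)) = ip (x - t) (unit (t - s)) + nrm (t - s) := by
    rw [show x - s = x - t + nrm (t - s) • unit (t - s) by rw [unit_smul_nrm hn.ne']; abel,
      ip_add_left, ip_smul_left, hu, mul_one]
  have hA0 : 0 ≤ ip (x - s) (unit (t - s)) := by
    rcases unit_segment_cases hm hEnc h with ⟨rfl, rfl, h1, h2⟩ | ⟨-, h2⟩
    · rw [h1, ip_neg_right, ip_sub_left, ip_top_top hm]
      linarith [ip_top_le_one hm hx]
    · rw [h2] at hA
      linarith
  constructor
  · refine ⟨-ip (x - t) (unit (t - s)) / nrm (t - s),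
      1 + ip (x - t) (unit (t - s)) / nrm (t - s), ?_, ?_, by ring, ?_⟩
    · exact div_nonneg (by linarith) hn.le
    · have : -1 ≤ ip (x - t) (unit (t - s)) / nrm (t - s) := by
        rw [le_div_iff₀ hn]
        linarith
      linarith
    · have h1 : ip (x - t) (unit (t - s)) • unit (t - s) =
          (ip (x - t) (unit (t - s)) / nrm (t - s)) • (t - s) := by
        conv_rhs => rw [← unit_smul_nrm hn.ne', smul_smul]
        congr 1
        conv_rhs => rw [unit_smul_nrm hn.ne']
        field_simp
      rw [h1]
      module
  · apply lt_of_pow_lt_pow_left₀ 2 hρ.le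
    rw [nrm_sq, ← sub_sub]
    simp only [ip_smul_left, ip_smul_right, ip_sub_left, ip_sub_right, hu]
    simp only [rad2_one, ip_sub_left, ip_sub_right] at hR
    simp only [ip_comm (unit (t - s))] at *
    nlinarith

lemma closeTo_of_nrm_end {b : ℝ} {s t x : Vec m} (h : nrm (x - t) ≤ b) : CloseTo b s t x :=
  ⟨t, right_mem_segment ℝ s t, h⟩

lemma closeTo_of_nrm_start {b : ℝ} {s t x : Vec m} (h : nrm (x - s) ≤ b) : CloseTo b s t x :=
  ⟨s, left_mem_segment ℝ s t, h⟩

lemma eq_or_linked (hm : 0 < m) (hS : Scale κ l ρ) (hEnc : IsCode κ Enc) {x s t s' t' : Vec m}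
    (h : IsSegment Enc G s t) (hc : CloseTo (2 * ρ) s t x)
    (h' : IsSegment Enc G s' t') (hc' : CloseTo (2 * ρ) s' t' x) :
    (s = s' ∧ t = t') ∨ Linked G s t s' t' :=
  eq_or_linked_of_closeKind hm hEnc hS.sq_lt.1 hS.sq_lt.2 (closeKind_of_closeTo hm hEnc h hc)
    (closeKind_of_closeTo hm hEnc h' hc')

lemma segment_ne (hm : 0 < m) (hS : Scale κ l ρ) (hEnc : IsCode κ Enc) {s t : Vec m}
    (h : IsSegment Enc G s t) : s ≠ t := by
  rintro rfl
  have := le_nrm_segment hm hS hEnc h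
  rw [sub_self, nrm_zero] at this
  linarith [hS.l_pos]

/-- Consecutive segments are orthogonal. -/
lemma ip_consecutive (hm : 0 < m) (hS : Scale κ l ρ) (hEnc : IsCode κ Enc) {s w t : Vec m}
    (h : IsSegment Enc G s w) (h' : IsSegment Enc G w t) : ip (w - s) (t - w) = 0 := by
  have h0 : nrm (w - w) ≤ 2 * ρ := by
    rw [sub_self, nrm_zero]
    linarith [hS.ρ_pos]
  rcases eq_or_linked hm hS hEnc h (closeTo_of_nrm_end h0) h' (closeTo_of_nrm_start h0) with h1 | h1
  · exact absurd h1.1 (segment_ne hm hS hEnc h)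
  · exact h1.1

/-- At most one segment starts at each point. -/
lemma segment_end_unique (hm : 0 < m) (hS : Scale κ l ρ) (hEnc : IsCode κ Enc) {s t t' : Vec m}
    (h : IsSegment Enc G s t) (h' : IsSegment Enc G s t') : t = t' := by
  have h0 : nrm (s - s) ≤ 2 * ρ := by
    rw [sub_self, nrm_zero]
    linarith [hS.ρ_pos]
  rcases eq_or_linked hm hS hEnc h (closeTo_of_nrm_start h0) h' (closeTo_of_nrm_start h0) with
    h1 | ⟨-, h1 | h1 | h1⟩
  · exact h1.2
  · exact absurd h1.symm (segment_ne hm hS hEnc h)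
  · exact absurd h1.symm (segment_ne hm hS hEnc h')
  · exact h1.1.trans h1.2.1.symm

lemma start_ne_end_of_consecutive (hm : 0 < m) (hS : Scale κ l ρ) (hEnc : IsCode κ Enc)
    {s w t : Vec m} (h : IsSegment Enc G s w) (h' : IsSegment Enc G w t) : s ≠ t := by
  rintro rfl
  have h1 := ip_consecutive hm hS hEnc h h'
  have h2 := le_nrm_segment hm hS hEnc h
  rw [← neg_sub w s, ip_neg_right, ← nrm_sq] at h1
  have := hS.l_pos
  nlinarith

/-- No three segments form a closed polygon. -/
lemma not_triangle (hm : 0 < m) (hS : Scale κ l ρ) (hEnc : IsCode κ Enc)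
    {s w t : Vec m} (h : IsSegment Enc G s w) (h' : IsSegment Enc G w t)
    (h'' : IsSegment Enc G t s) : False := by
  have h1 := ip_consecutive hm hS hEnc h h'
  have h2 := ip_consecutive hm hS hEnc h'' h
  have h3 := le_nrm_segment hm hS hEnc h
  have h4 : ip (w - s) (w - s) = 0 := by
    rw [ip_comm] at h2
    have : ip (w - s) (w - s) = -(ip (w - s) (t - w) + ip (w - s) (s - t)) := by
      rw [← ip_add_right, sub_add_sub_comm, add_comm t s, add_sub_add_right_eq_sub,
        ← ip_neg_right, neg_sub]
    rw [this, h1, h2, add_zero, neg_zero]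
  rw [← nrm_sq] at h4
  have := hS.l_pos
  nlinarith

/-- Two consecutive segments close to `x` are the only close ones, unless they meet at `0` and the
special vertex has an incoming edge. -/
lemma close_of_consecutive (hm : 0 < m) (hS : Scale κ l ρ) (hEnc : IsCode κ Enc)
    {x s w t a b : Vec m} (h : IsSegment Enc G s w) (hc : CloseTo (2 * ρ) s w x)
    (h' : IsSegment Enc G w t) (hc' : CloseTo (2 * ρ) w t x)
    (h'' : IsSegment Enc G a b) (hc'' : CloseTo (2 * ρ) a b x) :
    (a = s ∧ b = w) ∨ (a = w ∧ b = t) ∨ (w = 0 ∧ ∃ u, G.Edge u (root n)) := by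
  rcases eq_or_linked hm hS hEnc h'' hc'' h hc with h1 | ⟨-, rfl | rfl | ⟨-, h1, h2⟩⟩
  · exact Or.inl h1
  · rcases eq_or_linked hm hS hEnc h'' hc'' h' hc' with h1 | ⟨-, rfl | rfl | ⟨rfl, rfl, h2⟩⟩
    · exact Or.inr (Or.inl h1)
    · exact absurd rfl (segment_ne hm hS hEnc h)
    · exact (not_triangle hm hS hEnc h h' h'').elim
    · exact absurd rfl (start_ne_end_of_consecutive hm hS hEnc h h')
  · exact Or.inr (Or.inl ⟨rfl, segment_end_unique hm hS hEnc h'' h'⟩)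
  · exact Or.inr (Or.inr ⟨h1, h2⟩)

/-- A segment that contributes at `x` is close to `x`. -/
lemma exists_near_of_segTerm_ne_zero (hm : 0 < m) (hS : Scale κ l ρ) (hEnc : IsCode κ Enc)
    {x y s t : Vec m} (hx : x ∈ cube m) (h : IsSegment Enc G s t)
    (hne : segTerm (ρ / 4) (ρ / 8) y (x - s) (x - t) ≠ 0) :
    ∃ z ∈ segment ℝ s t, nrm (x - z) < 2 * ρ := by
  have hρ := hS.ρ_pos
  obtain ⟨h1, h2, h3⟩ := active_of_segTerm_ne_zero (by linarith) (by linarith) hne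
  rw [sub_sub_sub_cancel_left] at h1 h2 h3
  obtain ⟨h4, h5⟩ := exists_proj_of_active hm hS hEnc hx h h1 h2 h3
  exact ⟨_, h4, by linarith⟩

/-- A corner that contributes at `x` is close to `x`. -/
lemma nrm_lt_of_corner (hm : 0 < m) (hS : Scale κ l ρ) (hEnc : IsCode κ Enc)
    {x y s w t : Vec m} (h : IsSegment Enc G s w) (h' : IsSegment Enc G w t)
    (hne : cornerTerm (ρ / 4) (ρ / 8) y (x - s) (x - w) (x - t) ≠ 0) : nrm (x - w) < 2 * ρ := by
  have hρ := hS.ρ_pos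
  have hl := hS.l_pos
  have := nrm_lt_of_cornerTerm_ne_zero (by linarith) (by ring)
    (by rw [sub_sub_sub_cancel_left]; linarith [le_nrm_segment hm hS hEnc h])
    (by rw [sub_sub_sub_cancel_left]; linarith [le_nrm_segment hm hS hEnc h'])
    (by rw [sub_sub_sub_cancel_left, sub_sub_sub_cancel_left]; exact ip_consecutive hm hS hEnc h h')
    hne
  linarith

/-- Only the segments close to `x` contribute to the field at `x`. -/
lemma fieldOf_segs_eq (hm : 0 < m) (hS : Scale κ l ρ) (hEnc : IsCode κ Enc) {x : Vec m}
    (hx : x ∈ cube m) {T : Finset (Vec m × Vec m)} (hT : T ⊆ segs Enc G)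
    (hT' : closeSegs Enc G (2 * ρ) x ⊆ T) : fieldOf ρ (segs Enc G) x = fieldOf ρ T x := by
  classical
  apply fieldOf_eq_of_subset hT
  · intro σ hσ hne
    rw [mem_segs] at hσ
    obtain ⟨z, hz, hz'⟩ := exists_near_of_segTerm_ne_zero hm hS hEnc hx hσ hne
    exact hT' (mem_closeSegs.mpr ⟨hσ, z, hz, hz'.le⟩)
  · rintro ⟨s, w⟩ hσ ⟨w', t⟩ hτ (rfl : w = w') hne
    rw [mem_segs] at hσ hτ
    have hw := (nrm_lt_of_corner hm hS hEnc hσ hτ hne).le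
    exact ⟨hT' (mem_closeSegs.mpr ⟨hσ, closeTo_of_nrm_end hw⟩),
      hT' (mem_closeSegs.mpr ⟨hτ, closeTo_of_nrm_start hw⟩)⟩

lemma fieldOf_segs (hm : 0 < m) (hS : Scale κ l ρ) (hEnc : IsCode κ Enc) {x : Vec m}
    (hx : x ∈ cube m) :
    fieldOf ρ (segs Enc G) x = fieldOf ρ (closeSegs Enc G (2 * ρ) x) x := by
  classical
  exact fieldOf_segs_eq hm hS hEnc hx (Finset.filter_subset _ _) subset_rfl

end Instance

/-! ### The displacement is large far from the endpoints of paths -/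

section FarFromEndpoints

variable {n m : ℕ} {κ l ρ : ℝ} {Enc : (Fin n → Bool) → (Fin m → Bool)} {G : EOL n}

lemma theta_eq_zero {x : Vec m} (h : ip x (top m) ≤ 1 / 4) : theta x = 0 :=
  cl01_of_nonpos (by linarith)

lemma theta_eq_zero_of_near (hm : 0 < m) {x z : Vec m} (hz : ip z (top m) = 0)
    (h : nrm (x - z) ≤ 1 / 4) : theta x = 0 := by
  apply theta_eq_zero
  have h1 := ip_le (x - z) (top m)
  rw [ip_sub_left, hz, nrm_top hm] at h1
  linarith

/-- The field around a corner `s → w → t` is large. -/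
lemma le_nrm_clampMove_at_corner (hm : 0 < m) (hS : Scale κ l ρ) (hEnc : IsCode κ Enc) {ε : ℝ}
    (hε : 0 ≤ ε) (hεl : ε * (1 / l) ≤ 1 / 16) {x : Vec m} (hx : x ∈ cube m)
    {s w t : Vec m} (h : IsSegment Enc G s w) (h' : IsSegment Enc G w t)
    (hw : nrm (x - w) < 2 * ρ) {a : ℝ} (ha0 : 0 ≤ a) (ha1 : a ≤ 1) :
    ε * (ρ / 64) ≤ nrm (clampMove x (ε • (top m - theta x • x
      + corr (ρ / 8) a (unit (w - s)) (unit (t - w)) (x - w) (theta x • x)))) := by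
  have hρ := hS.ρ_pos
  have hl := hS.l_pos
  have hl2 := hS.two_le
  have hρl := hS.mul_le
  have hρ' := hS.ρ_le'
  have n₁ := le_nrm_segment hm hS hEnc h
  have n₂ := le_nrm_segment hm hS hEnc h'
  have i₁ := ip_unit_self (d := w - s) (by linarith)
  have i₂ := ip_unit_self (d := t - w) (by linarith)
  have i₁₂ : ip (unit (w - s)) (unit (t - w)) = 0 := by
    rw [unit, unit, ip_smul_left, ip_smul_right, ip_consecutive hm hS hEnc h h', mul_zero, mul_zero]
  have hw0 := ip_end_top hm hEnc h
  have hwI := end_mem_Icc hm hEnc h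
  have e₁ : ip (unit (w - s)) (top m) ≤ 0 := by
    rcases unit_segment_cases hm hEnc h with ⟨-, -, -, h1⟩ | ⟨-, h1⟩ <;> linarith
  have e₂ : ip (unit (t - w)) (top m) ≤ 0 := by
    rcases unit_segment_cases hm hEnc h' with ⟨-, -, -, h1⟩ | ⟨-, h1⟩ <;> linarith
  have b₁ := abs_unit_segment_le hm hS hEnc h
  have b₂ := abs_unit_segment_le hm hS hEnc h'
  have u₁ := nrm_unit_le (w - s)
  have u₂ := nrm_unit_le (t - w)
  generalize unit (w - s) = p₁ at *
  generalize unit (t - w) = p₂ at *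
  have hθ : theta x = 0 := theta_eq_zero_of_near hm hw0 (by linarith)
  have hn0 := nrm_nonneg (x - w)
  have c₁ : |ip (x - w) p₁| ≤ 2 * ρ :=
    (abs_ip_le _ _).trans (by nlinarith [nrm_nonneg p₁])
  have c₂ : |ip (x - w) p₂| ≤ 2 * ρ :=
    (abs_ip_le _ _).trans (by nlinarith [nrm_nonneg p₂])
  have c₃ : |ip (x - w) (perp a p₁ p₂)| ≤ 2 * ρ := by
    rw [perp, ip_sub_right, ip_smul_right, ip_smul_right]
    have h1 := abs_le.mp c₁
    have h2 := abs_le.mp c₂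
    rw [abs_le]
    constructor <;> nlinarith
  have bP : ∀ i, |perp a p₁ p₂ i| ≤ 1 / l := fun i => by
    have h1 := abs_le.mp (b₁ i)
    have h2 := abs_le.mp (b₂ i)
    simp only [perp, Pi.sub_apply, Pi.smul_apply, smul_eq_mul]
    rw [abs_le]
    constructor <;> nlinarith
  refine le_nrm_clampMove_corr hm (z := w) (K := 1 / l) hx ?_ (ip_tang_inward i₁ i₂ i₁₂ _)
    (half_rad2_le i₁ i₂ i₁₂ _) (rad2_nonneg i₁ i₂ i₁₂ _) ?_ ?_ hl2 hρ hρl rfl hε hεl ?_ hwI hw.le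
    (by rw [hθ, zero_smul])
  · rw [ip_tang_self i₁ i₂ i₁₂]
    exact half_le_sq_add_sq a
  · rw [tang, ip_add_left, ip_smul_left, ip_smul_left]
    nlinarith
  · intro i
    have h1 := abs_le.mp (b₁ i)
    have h2 := abs_le.mp (b₂ i)
    simp only [tang, Pi.add_apply, Pi.smul_apply, smul_eq_mul]
    rw [abs_le]
    constructor <;> nlinarith
  · intro i
    have key : ∀ c q : ℝ, |c| ≤ 2 * ρ → |q| ≤ 1 / l → |c * q| ≤ 1 / 50 := fun c q hc hq => by
      rw [abs_mul]
      calc |c| * |q| ≤ 2 * ρ * (1 / l) := mul_le_mul hc hq (abs_nonneg _) (by linarith)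
        _ ≤ 1 / 50 := by linarith
    have k₁ := abs_le.mp (key _ _ c₁ (b₁ i))
    have k₂ := abs_le.mp (key _ _ c₂ (b₂ i))
    have k₃ := abs_le.mp (key _ _ c₃ (bP i))
    simp only [inward, Pi.neg_apply, Pi.add_apply, Pi.sub_apply, Pi.smul_apply, smul_eq_mul]
      at k₁ k₂ k₃ ⊢
    have h1 := (hwI i).1
    have h2 := (hwI i).2
    constructor <;> linarith

/-- The field around an active segment is large, away from the ends of the segment. -/
lemma le_nrm_clampMove_at_segment (hm : 0 < m) (hS : Scale κ l ρ) (hEnc : IsCode κ Enc) {ε : ℝ}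
    (hε : 0 ≤ ε) (hεl : ε * (1 / l) ≤ 1 / 16) {x : Vec m} (hx : x ∈ cube m)
    {s t : Vec m} (h : IsSegment Enc G s t)
    (hR : rad2 1 (unit (t - s)) 0 (x - t) < 3 * (ρ / 8) ^ 2)
    (hB : ip (x - t) (unit (t - s)) < -2 * (ρ / 4))
    (hA : 2 * (ρ / 4) + 3 * (ρ / 4) * ip (unit (t - s)) (top m) < ip (x - s) (unit (t - s))) :
    ε * (ρ / 64) ≤ nrm (clampMove x (ε • (top m - theta x • x
      + corr (ρ / 8) 1 (unit (t - s)) 0 (x - t) (theta x • x)))) := by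
  have hρ := hS.ρ_pos
  have hl := hS.l_pos
  have hl2 := hS.two_le
  have hρl := hS.mul_le
  have hρ' := hS.ρ_le'
  obtain ⟨hz, hxz⟩ := exists_proj_of_active hm hS hEnc hx h hR hB hA
  have i₁ := ip_unit_self (d := t - s) (by linarith [le_nrm_segment hm hS hEnc h])
  rcases isSegment_cases hm hEnc h with ⟨rfl, rfl⟩ | ⟨hs, ht, hs0, ht0, -⟩
  · rw [unit_neg_top hm, sub_zero] at *
    have hs : 0 ≤ ip x (top m) := by
      rw [ip_neg_right] at hB
      linarith
    have hε1 : ε ≤ 1 / 32 := by nlinarith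
    refine le_nrm_clampMove_first hm hx hρ hρ' rfl hε hε1 hs ?_ rfl
    rw [zero_add, ip_neg_right, neg_smul_neg] at hxz
    linarith
  · have hp : ip (unit (t - s)) (top m) = 0 := by
      rw [unit, ip_smul_left, ip_sub_left, hs0, ht0, sub_zero, mul_zero]
    have hz0 : ip (t + ip (x - t) (unit (t - s)) • unit (t - s)) (top m) = 0 := by
      rw [ip_add_left, ip_smul_left, hp, ht0, mul_zero, add_zero]
    have hzI : ∀ i, (t + ip (x - t) (unit (t - s)) • unit (t - s)) i ∈ Set.Icc (0 : ℝ) 1 := by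
      obtain ⟨c, d, hc, hd, hcd, hz⟩ := hz
      intro i
      rw [← hz]
      exact convex_Icc (0 : ℝ) 1 (hs i) (ht i) hc hd hcd
    have hθ : theta x = 0 := theta_eq_zero_of_near hm hz0 (by linarith)
    refine le_nrm_clampMove_corr hm (K := 1 / l)
      (z := t + ip (x - t) (unit (t - s)) • unit (t - s)) hx ?_ ?_ ?_
      (rad2_one_nonneg i₁ _ _) ?_ ?_ hl2 hρ hρl rfl hε hεl ?_ hzI (by linarith)
      (by rw [hθ, zero_smul])
    · rw [tang_one, i₁]
      norm_num
    · rw [tang_one, inward_one, ip_neg_right, ip_sub_right, ip_smul_right, i₁,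
        ip_comm (unit (t - s))]
      ring
    · have h1 : ip (inward 1 (unit (t - s)) 0 (x - t)) (inward 1 (unit (t - s)) 0 (x - t)) =
          rad2 1 (unit (t - s)) 0 (x - t) := by
        rw [inward_one, rad2_one, ip_neg_left, ip_neg_right]
        generalize x - t = ξ
        simp only [ip_sub_left, ip_sub_right, ip_smul_left, ip_smul_right, i₁,
          ip_comm (unit (t - s)) ξ]
        ring
      rw [h1]
      linarith [rad2_one_nonneg i₁ 0 (x - t)]
    · rw [tang_one, hp]
    · rw [tang_one]
      exact abs_unit_segment_le hm hS hEnc h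
    · intro i
      have h1 : x i + inward 1 (unit (t - s)) 0 (x - t) i =
          (t + ip (x - t) (unit (t - s)) • unit (t - s)) i := by
        rw [inward_one]
        simp only [Pi.neg_apply, Pi.add_apply, Pi.sub_apply, Pi.smul_apply, smul_eq_mul]
        ring
      rw [h1]
      exact ⟨by linarith [(hzI i).1], by linarith [(hzI i).2]⟩

lemma fieldOf_empty (ρ : ℝ) (x : Vec m) : fieldOf ρ ∅ x = top m - theta x • x := by
  simp [fieldOf]

lemma fieldOf_singleton (ρ : ℝ) {s t x : Vec m} (h : s ≠ t) :
    fieldOf ρ {(s, t)} x = top m - theta x • x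
      + segTerm (ρ / 4) (ρ / 8) (theta x • x) (x - s) (x - t) := by
  classical
  simp [fieldOf, h.symm]

lemma fieldOf_pair (ρ : ℝ) {s w t x : Vec m} (h₁ : s ≠ w) (h₂ : w ≠ t) (h₃ : s ≠ t) :
    fieldOf ρ {(s, w), (w, t)} x = top m - theta x • x
      + (segTerm (ρ / 4) (ρ / 8) (theta x • x) (x - s) (x - w)
        + segTerm (ρ / 4) (ρ / 8) (theta x • x) (x - w) (x - t)
        + cornerTerm (ρ / 4) (ρ / 8) (theta x • x) (x - s) (x - w) (x - t)) := by
  classical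
  have hne : (s, w) ≠ (w, t) := fun h => h₁ (Prod.ext_iff.mp h).1
  simp only [fieldOf, Finset.sum_pair hne, h₁.symm, h₂.symm, h₃.symm, if_true, if_false, add_zero,
    zero_add]
  abel

/-- The displacement is large at points that are not close to the endpoints of paths. -/
theorem le_nrm_clampMove_fieldOf (hm : 0 < m) (hS : Scale κ l ρ) (hEnc : IsCode κ Enc) {ε : ℝ}
    (hε : 0 ≤ ε) (hεl : ε * (1 / l) ≤ 1 / 16) {x : Vec m} (hx : x ∈ cube m)
    (hfar : ∀ v, G.IsEndpoint v →
      2 * ρ ≤ nrm (x - blocks (toReal (Enc v)) (toReal (Enc v)) 0 0)) :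
    ε * (ρ / 64) ≤ nrm (clampMove x (ε • fieldOf ρ (segs Enc G) x)) := by
  have hρ := hS.ρ_pos
  have hl := hS.l_pos
  have hl2 := hS.two_le
  have hρ' := hS.ρ_le'
  have hε1 : ε ≤ 1 / 32 := by nlinarith
  have hroot : (∃ u, G.Edge u (root n)) → ¬ nrm (x - 0) < 2 * ρ := by
    intro hu
    have := hfar (root n) (Or.inl ⟨rfl, Or.inl hu⟩)
    rw [toReal_code_root hEnc, blocks_zero] at this
    exact not_lt.mpr this
  by_cases hcorner : ∃ s w t, IsSegment Enc G s w ∧ IsSegment Enc G w t ∧ nrm (x - w) < 2 * ρ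
  · obtain ⟨s, w, t, h, h', hw⟩ := hcorner
    have hF : fieldOf ρ (segs Enc G) x = fieldOf ρ {(s, w), (w, t)} x := by
      rw [fieldOf_segs hm hS hEnc hx]
      congr 1
      ext ⟨a, b⟩
      simp only [mem_closeSegs, Finset.mem_insert, Finset.mem_singleton, Prod.mk.injEq]
      constructor
      · rintro ⟨h1, h2⟩
        rcases close_of_consecutive hm hS hEnc h (closeTo_of_nrm_end hw.le) h'
          (closeTo_of_nrm_start hw.le) h1 h2 with h3 | h3 | ⟨rfl, h3⟩
        · exact Or.inl h3
        · exact Or.inr h3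
        · exact absurd hw (hroot h3)
      · rintro (⟨rfl, rfl⟩ | ⟨rfl, rfl⟩)
        · exact ⟨h, closeTo_of_nrm_end hw.le⟩
        · exact ⟨h', closeTo_of_nrm_start hw.le⟩
    have hw0 := ip_end_top hm hEnc h
    have hρl := hS.ρ_le
    have e₁ : ip (unit (w - s)) (top m) ≤ 0 := by
      rcases unit_segment_cases hm hEnc h with ⟨-, -, -, h1⟩ | ⟨-, h1⟩ <;> linarith
    have e₂ : ip (unit (t - w)) (top m) = 0 := by
      rcases unit_segment_cases hm hEnc h' with ⟨h1, -⟩ | ⟨-, h1⟩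
      · rw [h1, ip_top_top hm] at hw0
        exact absurd hw0 one_ne_zero
      · exact h1
    have n₁ := le_nrm_segment hm hS hEnc h
    have n₂ := le_nrm_segment hm hS hEnc h'
    have hsum := sum_at_corner (r := ρ / 8) (ω := ρ / 4) (y := theta x • x) (A := x - s)
      (B := x - w) (C := x - t) (by linarith) (by ring)
      (by rw [sub_sub_sub_cancel_left]; linarith) (by rw [sub_sub_sub_cancel_left]; linarith)
      (by rw [sub_sub_sub_cancel_left, sub_sub_sub_cancel_left]
          exact ip_consecutive hm hS hEnc h h') (by linarith)
      (by rwa [sub_sub_sub_cancel_left]) (by rwa [sub_sub_sub_cancel_left])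
    rw [hF, fieldOf_pair ρ (segment_ne hm hS hEnc h) (segment_ne hm hS hEnc h')
      (start_ne_end_of_consecutive hm hS hEnc h h')]
    rcases hsum with hsum | ⟨a, ha0, ha1, hsum⟩
    · rw [hsum, add_zero]
      refine le_nrm_clampMove_default hm hx hρ hρ' rfl hε hε1 (Or.inl ?_) rfl
      rw [theta_eq_zero_of_near hm hw0 (by linarith)]
      exact one_pos
    · rw [hsum, sub_sub_sub_cancel_left, sub_sub_sub_cancel_left]
      exact le_nrm_clampMove_at_corner hm hS hEnc hε hεl hx h h' hw ha0 ha1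
  -- Away from all corners, at most one segment is active, and its cut-off is `1`.
  push Not at hcorner
  have hcor : ∀ σ ∈ segs Enc G, ∀ τ ∈ segs Enc G, σ.2 = τ.1 →
      cornerTerm (ρ / 4) (ρ / 8) (theta x • x) (x - σ.1) (x - σ.2) (x - τ.2) = 0 := by
    rintro ⟨s, w⟩ hσ ⟨w', t⟩ hτ (rfl : w = w')
    by_contra hne
    rw [mem_segs] at hσ hτ
    exact not_lt.mpr (hcorner _ _ _ hσ hτ) (nrm_lt_of_corner hm hS hEnc hσ hτ hne)
  by_cases hact : ∃ s t, IsSegment Enc G s t ∧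
      rad2 1 (unit (t - s)) 0 (x - t) < 3 * (ρ / 8) ^ 2 ∧
      ip (x - t) (unit (t - s)) < -2 * (ρ / 4) ∧
      2 * (ρ / 4) + 3 * (ρ / 4) * ip (unit (t - s)) (top m) < ip (x - s) (unit (t - s))
  · obtain ⟨s, t, h, hR, hB, hA⟩ := hact
    have hn := le_nrm_segment hm hS hEnc h
    have i₁ := ip_unit_self (d := t - s) (by linarith)
    obtain ⟨hz, hxz⟩ := exists_proj_of_active hm hS hEnc hx h hR hB hA
    have hclose : CloseTo (2 * ρ) s t x := ⟨_, hz, by linarith⟩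
    have hst : ip (x - s) (unit (t - s)) = ip (x - t) (unit (t - s)) + nrm (t - s) := by
      rw [show x - s = x - t + nrm (t - s) • unit (t - s) by
        rw [unit_smul_nrm (by linarith)]; abel, ip_add_left, ip_smul_left, i₁, mul_one]
    have hR' := hR
    rw [rad2_one] at hR'
    have near_of : ∀ c : ℝ, |ip (x - t) (unit (t - s)) + c| ≤ 3 * (ρ / 4) →
        nrm (x - t + c • unit (t - s)) < 2 * ρ := by
      intro c hc
      apply lt_of_pow_lt_pow_left₀ 2 (by linarith)
      rw [nrm_sq, ip_add_left, ip_add_right, ip_add_right]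
      simp only [ip_smul_left, ip_smul_right, i₁, ip_comm (unit (t - s))]
      have := sq_le_sq' (abs_le.mp hc).1 (abs_le.mp hc).2
      nlinarith
    have hB3 : ip (x - t) (unit (t - s)) ≤ -3 * (ρ / 4) := by
      by_contra hB3
      have hxt : nrm (x - t) < 2 * ρ := by
        have := near_of 0 (by rw [add_zero, abs_le]; constructor <;> linarith)
        rwa [zero_smul, add_zero] at this
      rcases exists_next hEnc h with ⟨t', ht'⟩ | ⟨v, hv, rfl⟩
      · exact not_lt.mpr (hcorner s t t' h ht') hxt
      · exact not_lt.mpr (hfar v hv) hxt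
    have hA3 : 3 * (ρ / 4) + 3 * (ρ / 4) * ip (unit (t - s)) (top m)
        ≤ ip (x - s) (unit (t - s)) := by
      rcases unit_segment_cases hm hEnc h with ⟨rfl, rfl, h1, h2⟩ | ⟨hs0, h2⟩
      · rw [h2, h1, ip_neg_right, ip_sub_left, ip_top_top hm]
        linarith [ip_top_le_one hm hx]
      · rw [h2] at hA ⊢
        by_contra hA3
        have hxs : nrm (x - s) < 2 * ρ := by
          have := near_of (nrm (t - s)) (by rw [← hst, abs_le]; constructor <;> linarith)
          rwa [unit_smul_nrm (by linarith), sub_add_sub_cancel] at this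
        rcases exists_prev hEnc h with ⟨rfl, -⟩ | ⟨s', hs'⟩ | ⟨v, hv, rfl⟩
        · rw [ip_top_top hm] at hs0
          exact one_ne_zero hs0
        · exact not_lt.mpr (hcorner s' s t hs' h) hxs
        · exact not_lt.mpr (hfar v hv) hxs
    have hF : fieldOf ρ (segs Enc G) x = fieldOf ρ {(s, t)} x := by
      apply fieldOf_eq_of_subset (Finset.singleton_subset_iff.mpr (mem_segs.mpr h))
      · rintro ⟨s', t'⟩ hσ hne
        rw [mem_segs] at hσ
        obtain ⟨hR2, hB2, hA2⟩ := active_of_segTerm_ne_zero (by linarith) (by linarith) hne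
        simp only [sub_sub_sub_cancel_left] at hσ hR2 hB2 hA2
        obtain ⟨hz2, hxz2⟩ := exists_proj_of_active hm hS hEnc hx hσ hR2 hB2 hA2
        have i₂ := ip_unit_self (d := t' - s') (by linarith [le_nrm_segment hm hS hEnc hσ])
        -- An orthogonal segment with a common end lies in the cut-off region.
        have bessel : ip (t - s) (t' - s') = 0 →
            ip (x - t) (unit (t' - s')) ^ 2 < (2 * (ρ / 4)) ^ 2 ∧
            ip (x - t') (unit (t - s)) ^ 2 < (2 * (ρ / 4)) ^ 2 := by
          intro h0
          have i₁₂ : ip (unit (t - s)) (unit (t' - s')) = 0 := by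
            rw [unit, unit, ip_smul_left, ip_smul_right, h0, mul_zero, mul_zero]
          have j1 := sq_ip_add_sq_ip_le i₁ i₂ i₁₂ (x - t)
          have j2 := sq_ip_add_sq_ip_le i₁ i₂ i₁₂ (x - t')
          rw [rad2_one] at hR2
          constructor <;> nlinarith
        rw [Finset.mem_singleton]
        rcases eq_or_linked hm hS hEnc h hclose hσ ⟨_, hz2, by linarith⟩ with
          ⟨rfl, rfl⟩ | ⟨h0, rfl | rfl | ⟨rfl, rfl, -⟩⟩
        · rfl
        · exfalso
          have h1 := abs_lt_of_sq_lt_sq (bessel h0).1 (by linarith)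
          have h2 : ip (unit (t' - t)) (top m) = 0 := by
            rcases unit_segment_cases hm hEnc hσ with ⟨h3, -⟩ | ⟨-, h3⟩
            · have := ip_end_top hm hEnc h
              rw [h3, ip_top_top hm] at this
              exact absurd this one_ne_zero
            · exact h3
          rw [h2] at hA2
          linarith [(abs_lt.mp h1).2]
        · exfalso
          have h1 := abs_lt_of_sq_lt_sq (bessel h0).2 (by linarith)
          have h2 : ip (unit (t - t')) (top m) = 0 := by
            rcases unit_segment_cases hm hEnc h with ⟨h3, -⟩ | ⟨-, h3⟩
            · have := ip_end_top hm hEnc hσ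
              rw [h3, ip_top_top hm] at this
              exact absurd this one_ne_zero
            · exact h3
          rw [h2] at hA
          linarith [(abs_lt.mp h1).2]
        · exfalso
          have h1 := abs_lt_of_sq_lt_sq (bessel h0).1 (by linarith)
          linarith [(abs_lt.mp h1).1]
      · intro σ hσ τ hτ hστ hne
        exact absurd (hcor σ hσ τ hτ hστ) hne
    rw [hF, fieldOf_singleton ρ (segment_ne hm hS hEnc h), segTerm, sub_sub_sub_cancel_left,
      cl01_of_one_le, cl01_of_one_le, one_mul, one_smul]
    · exact le_nrm_clampMove_at_segment hm hS hEnc hε hεl hx h hR hB hA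
    · have : ip (x - t) (unit (t - s)) / (ρ / 4) ≤ -3 := by
        rw [div_le_iff₀ (by linarith)]
        linarith
      linarith
    · have : 3 + 3 * ip (unit (t - s)) (top m) ≤ ip (x - s) (unit (t - s)) / (ρ / 4) := by
        rw [le_div_iff₀ (by linarith)]
        linarith
      linarith
  · push Not at hact
    have hF : fieldOf ρ (segs Enc G) x = fieldOf ρ ∅ x := by
      apply fieldOf_eq_of_subset (Finset.empty_subset _)
      · rintro ⟨s, t⟩ hσ hne
        rw [mem_segs] at hσ
        obtain ⟨h1, h2, h3⟩ := active_of_segTerm_ne_zero (by linarith) (by linarith) hne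
        simp only [sub_sub_sub_cancel_left] at hσ h1 h2 h3
        exact absurd h3 (not_lt.mpr (hact s t hσ h1 h2))
      · intro σ hσ τ hτ hστ hne
        exact absurd (hcor σ hσ τ hτ hστ) hne
    rw [hF, fieldOf_empty]
    refine le_nrm_clampMove_default hm hx hρ hρ' rfl hε hε1 ?_ rfl
    rcases (theta_mem x).2.lt_or_eq with hθ | hθ
    · exact Or.inl hθ
    · right
      by_contra hR
      have hs : 1 / 4 < ip x (top m) := by
        by_contra hs
        rw [theta_eq_zero (not_lt.mp hs)] at hθ
        exact zero_ne_one hθ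
      have := hact (top m) 0 (Or.inl ⟨rfl, rfl⟩)
      rw [unit_neg_top hm, sub_zero, ip_neg_right, ip_neg_right, ip_neg_left, ip_sub_left,
        ip_top_top hm] at this
      have := this (by nlinarith) (by linarith)
      linarith [ip_top_le_one hm hx]

end FarFromEndpoints

/-! ### Uniform Lipschitz bounds -/

section UniformLipschitz

variable {ι : Type} {M : ι → ℕ} {J : ∀ j, Fin 4 × Fin (M j)}

/-- A family of functions on cubes of varying dimensions is uniformly bounded, and uniformly
Lipschitz with respect to the maximum of the normalized norm and the distance in the coordinate
`J j`. -/
def UniformLip (M : ι → ℕ) (J : ∀ j, Fin 4 × Fin (M j)) (f : ∀ j, Vec (M j) → ℝ) : Prop :=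
  ∃ K, 0 ≤ K ∧ ∀ j, ∀ x ∈ cube (M j), ∀ y ∈ cube (M j), |f j x| ≤ K ∧
    |f j x - f j y| ≤ K * max |x (J j) - y (J j)| (nrm (x - y))

lemma max_abs_nrm_nonneg {m : ℕ} (x y : Vec m) (i : Fin 4 × Fin m) :
    0 ≤ max |x i - y i| (nrm (x - y)) :=
  le_max_of_le_left (abs_nonneg _)

lemma uniformLip_const {c : ι → ℝ} {L : ℝ} (h : ∀ j, |c j| ≤ L) (hL : 0 ≤ L) :
    UniformLip M J fun j _ => c j := by
  refine ⟨L, hL, fun j x _ y _ => ⟨h j, ?_⟩⟩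
  rw [sub_self, abs_zero]
  exact mul_nonneg hL (max_abs_nrm_nonneg _ _ _)

lemma uniformLip_coord : UniformLip M J fun j x => x (J j) := by
  refine ⟨2, zero_le_two, fun j x hx y _ => ⟨?_, ?_⟩⟩
  · exact abs_le.mpr ⟨by linarith [(hx (J j)).1], (hx (J j)).2⟩
  · have := le_max_left |x (J j) - y (J j)| (nrm (x - y))
    linarith [max_abs_nrm_nonneg x y (J j)]

lemma uniformLip_ip {p : ∀ j, Vec (M j)} {L : ℝ} (hM : ∀ j, 0 < M j) (h : ∀ j, nrm (p j) ≤ L)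
    (hL : 0 ≤ L) : UniformLip M J fun j x => ip x (p j) := by
  refine ⟨2 * L, by positivity, fun j x hx y _ => ⟨?_, ?_⟩⟩
  · exact (abs_ip_le _ _).trans
      (mul_le_mul (nrm_le_two_of_cube (hM j) hx) (h j) (nrm_nonneg _) zero_le_two)
  · rw [← ip_sub_left]
    have h1 := (abs_ip_le (x - y) (p j)).trans
      (mul_le_mul (le_max_right |x (J j) - y (J j)| (nrm (x - y))) (h j) (nrm_nonneg _)
        (max_abs_nrm_nonneg _ _ _))
    have := mul_nonneg hL (max_abs_nrm_nonneg x y (J j))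
    linarith

lemma uniformLip_ip_self (hM : ∀ j, 0 < M j) : UniformLip M J fun _ x => ip x x := by
  refine ⟨4, by norm_num, fun j x hx y hy => ⟨?_, ?_⟩⟩
  · have h1 := nrm_le_two_of_cube (hM j) hx
    have h2 := nrm_nonneg x
    refine (abs_ip_le _ _).trans ?_
    nlinarith
  · have h0 : ip x x - ip y y = ip (x - y) (x + y) := by
      rw [ip_sub_left, ip_add_right, ip_add_right, ip_comm y x]
      ring
    rw [h0]
    have h1 : nrm (x + y) ≤ 4 := by
      linarith [nrm_add_le x y, nrm_le_two_of_cube (hM j) hx, nrm_le_two_of_cube (hM j) hy]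
    have h2 := (abs_ip_le (x - y) (x + y)).trans
      (mul_le_mul (le_max_right |x (J j) - y (J j)| (nrm (x - y))) h1 (nrm_nonneg _)
        (max_abs_nrm_nonneg _ _ _))
    linarith

variable {f g : ∀ j, Vec (M j) → ℝ}

lemma UniformLip.add (hf : UniformLip M J f) (hg : UniformLip M J g) :
    UniformLip M J fun j x => f j x + g j x := by
  obtain ⟨K, hK, hf⟩ := hf
  obtain ⟨L, hL, hg⟩ := hg
  refine ⟨K + L, add_nonneg hK hL, fun j x hx y hy => ⟨?_, ?_⟩⟩
  · exact (abs_add_le _ _).trans (add_le_add (hf j x hx y hy).1 (hg j x hx y hy).1)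
  · rw [add_sub_add_comm, add_mul]
    exact (abs_add_le _ _).trans (add_le_add (hf j x hx y hy).2 (hg j x hx y hy).2)

lemma UniformLip.mul (hf : UniformLip M J f) (hg : UniformLip M J g) :
    UniformLip M J fun j x => f j x * g j x := by
  obtain ⟨K, hK, hf⟩ := hf
  obtain ⟨L, hL, hg⟩ := hg
  refine ⟨2 * (K * L), by positivity, fun j x hx y hy => ⟨?_, ?_⟩⟩
  · rw [abs_mul]
    have := mul_le_mul (hf j x hx y hy).1 (hg j x hx y hy).1 (abs_nonneg _) hK
    linarith [mul_nonneg hK hL]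
  · rw [show f j x * g j x - f j y * g j y =
      f j x * (g j x - g j y) + (f j x - f j y) * g j y by ring]
    refine (abs_add_le _ _).trans ?_
    rw [abs_mul, abs_mul]
    have h1 := mul_le_mul (hf j x hx y hy).1 (hg j x hx y hy).2 (abs_nonneg _) hK
    have h2 := mul_le_mul (hf j x hx y hy).2 (hg j y hy x hx).1 (abs_nonneg _)
      (mul_nonneg hK (max_abs_nrm_nonneg _ _ _))
    linarith

lemma UniformLip.comp {φ : ℝ → ℝ} {C : ℝ} (hf : UniformLip M J f) (hC : 0 ≤ C)
    (hφ : ∀ a b, |φ a - φ b| ≤ C * |a - b|) : UniformLip M J fun j x => φ (f j x) := by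
  obtain ⟨K, hK, hf⟩ := hf
  refine ⟨|φ 0| + C * K, by positivity, fun j x hx y hy => ⟨?_, ?_⟩⟩
  · have h1 := hφ (f j x) 0
    rw [sub_zero] at h1
    have h2 := mul_le_mul_of_nonneg_left (hf j x hx y hy).1 hC
    have h3 := abs_add_le (φ (f j x) - φ 0) (φ 0)
    rw [sub_add_cancel] at h3
    linarith
  · refine (hφ _ _).trans ?_
    have h2 := mul_le_mul_of_nonneg_left (hf j x hx y hy).2 hC
    have h3 := mul_nonneg (abs_nonneg (φ 0)) (max_abs_nrm_nonneg x y (J j))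
    linarith

lemma UniformLip.neg (hf : UniformLip M J f) : UniformLip M J fun j x => -f j x :=
  hf.comp zero_le_one fun a b => by rw [one_mul, neg_sub_neg, abs_sub_comm]

lemma UniformLip.sub (hf : UniformLip M J f) (hg : UniformLip M J g) :
    UniformLip M J fun j x => f j x - g j x := by
  simpa only [sub_eq_add_neg] using hf.add hg.neg

lemma UniformLip.const_mul (hf : UniformLip M J f) (c : ℝ) :
    UniformLip M J fun j x => c * f j x :=
  (uniformLip_const (fun _ => le_rfl) (abs_nonneg c)).mul hf

lemma UniformLip.div_const (hf : UniformLip M J f) (c : ℝ) :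
    UniformLip M J fun j x => f j x / c := by
  simpa only [div_eq_inv_mul] using hf.const_mul c⁻¹

lemma uniformLip_real (c : ℝ) : UniformLip M J fun _ _ => c :=
  uniformLip_const (fun _ => le_rfl) (abs_nonneg c)

lemma UniformLip.cl01 (hf : UniformLip M J f) : UniformLip M J fun j x => cl01 (f j x) :=
  hf.comp zero_le_one fun a b => by rw [one_mul]; exact abs_cl01_sub_le a b

lemma UniformLip.sq (hf : UniformLip M J f) : UniformLip M J fun j x => f j x ^ 2 := by
  simpa only [pow_two] using hf.mul hf

/-- The data of a segment or corner, with a coordinate: `w` is the end of the segment or the corner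
point, `s` the start of the segment, and `p₁`, `p₂` are the directions. -/
structure CornerData (L : ℝ) where
  m : ℕ
  m_pos : 0 < m
  i : Fin 4 × Fin m
  s : Vec m
  w : Vec m
  p₁ : Vec m
  p₂ : Vec m
  nrm_s : nrm s ≤ 2
  nrm_w : nrm w ≤ 2
  abs_w : |w i| ≤ 2
  nrm_p₁ : nrm p₁ ≤ 1
  nrm_p₂ : nrm p₂ ≤ 1
  abs_p₁ : |p₁ i| ≤ L
  abs_p₂ : |p₂ i| ≤ L

variable {L : ℝ}

/-- Uniform Lipschitz continuity for families that are indexed by corners. -/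
abbrev CornerLip (f : ∀ d : CornerData L, Vec d.m → ℝ) : Prop :=
  UniformLip (fun d : CornerData L => d.m) (fun d => d.i) f

lemma cornerLip_ip_sub {z p : ∀ d : CornerData L, Vec d.m} (hz : ∀ d, nrm (z d) ≤ 2)
    (hp : ∀ d, nrm (p d) ≤ 1) : CornerLip fun (d : CornerData L) x => ip (x - z d) (p d) := by
  simp only [ip_sub_left]
  refine (uniformLip_ip (fun d => d.m_pos) hp zero_le_one).sub
    (uniformLip_const (L := 2) (fun d => (abs_ip_le _ _).trans ?_) zero_le_two)
  exact (mul_le_mul (hz d) (hp d) (nrm_nonneg _) zero_le_two).trans (by norm_num)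

lemma cornerLip_ip_sub_self :
    CornerLip fun (d : CornerData L) x => ip (x - d.w) (x - d.w) := by
  have h : ∀ (d : CornerData L) (x : Vec d.m),
      ip (x - d.w) (x - d.w) = ip x x - 2 * ip x d.w + ip d.w d.w := fun d x => by
    rw [ip_sub_left, ip_sub_right, ip_sub_right, ip_comm d.w x]
    ring
  simp only [h]
  refine ((uniformLip_ip_self fun d => d.m_pos).sub ((uniformLip_ip (fun d => d.m_pos)
    (fun d : CornerData L => d.nrm_w) zero_le_two).const_mul 2)).add
    (uniformLip_const (L := 4) (fun d => (abs_ip_le _ _).trans ?_) (by norm_num))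
  exact (mul_le_mul d.nrm_w d.nrm_w (nrm_nonneg _) zero_le_two).trans (by norm_num)

lemma cornerLip_top : CornerLip fun (d : CornerData L) _ => top d.m d.i :=
  uniformLip_const (L := 2) (fun d => by
    rw [abs_of_nonneg (top_mem_Icc _).1]
    exact (top_mem_Icc _).2) zero_le_two

lemma cornerLip_theta_smul : CornerLip fun (d : CornerData L) x => (theta x • x) d.i := by
  simp only [theta, Pi.smul_apply, smul_eq_mul]
  exact ((((uniformLip_ip (fun d : CornerData L => d.m_pos) (fun d => (nrm_top d.m_pos).le)
    zero_le_one).const_mul 4).sub (uniformLip_real 1)).cl01).mul uniformLip_coord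

lemma cornerLip_corr (hL : 0 ≤ L) (r : ℝ) {a : ∀ d : CornerData L, Vec d.m → ℝ}
    (ha : CornerLip a) : CornerLip fun (d : CornerData L) x =>
      corr r (a d x) d.p₁ d.p₂ (x - d.w) (theta x • x) d.i := by
  have i₁ := cornerLip_ip_sub (L := L) (fun d => d.nrm_w) (fun d => d.nrm_p₁)
  have i₂ := cornerLip_ip_sub (L := L) (fun d => d.nrm_w) (fun d => d.nrm_p₂)
  have c₁ : CornerLip fun (d : CornerData L) _ => d.p₁ d.i := uniformLip_const (fun d => d.abs_p₁) hL
  have c₂ : CornerLip fun (d : CornerData L) _ => d.p₂ d.i := uniformLip_const (fun d => d.abs_p₂) hL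
  have t₁ : CornerLip fun (d : CornerData L) _ => ip d.p₁ (top d.m) :=
    uniformLip_const (L := 1) (fun d => (abs_ip_le _ _).trans
      (by rw [nrm_top d.m_pos, mul_one]; exact d.nrm_p₁)) zero_le_one
  have t₂ : CornerLip fun (d : CornerData L) _ => ip d.p₂ (top d.m) :=
    uniformLip_const (L := 1) (fun d => (abs_ip_le _ _).trans
      (by rw [nrm_top d.m_pos, mul_one]; exact d.nrm_p₂)) zero_le_one
  have w : CornerLip fun (d : CornerData L) _ => d.w d.i :=
    uniformLip_const (fun d => d.abs_w) zero_le_two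
  have b := (uniformLip_real 1).sub ha
  have perpi := (ha.mul c₂).sub (b.mul c₁)
  have ψ := (ha.mul i₂).sub (b.mul i₁)
  have R := (((cornerLip_ip_sub_self (L := L)).sub i₁.sq).sub i₂.sq).add ψ.sq
  have u := R.div_const (r ^ 2)
  have α := u.comp (φ := alpha) zero_le_one
    (fun a b => by rw [one_mul]; exact abs_alpha_sub_le a b)
  have α' := α.neg.comp (φ := max 0) zero_le_one (fun a b => by rw [one_mul]; grind)
  have β := ((uniformLip_real 2).sub u).cl01
  have γ := (u.sub (uniformLip_real 2)).cl01
  have y := cornerLip_theta_smul (L := L)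
  have P := (ha.mul c₁).add (b.mul c₂)
  have Pt := (ha.mul t₁).add (b.mul t₂)
  have I := ((((uniformLip_coord.sub w).sub (i₁.mul c₁)).sub (i₂.mul c₂)).add (ψ.mul perpi)).neg
  have all := (((α.mul P).add (β.mul I)).sub
    (((uniformLip_real 1).sub γ).mul (cornerLip_top.sub y))).add ((α'.mul Pt).mul y)
  have h : ∀ (d : CornerData L) (x : Vec d.m),
      ip (x - d.w) (perp (a d x) d.p₁ d.p₂) =
        a d x * ip (x - d.w) d.p₂ - (1 - a d x) * ip (x - d.w) d.p₁ := fun d x => by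
    rw [perp, ip_sub_right, ip_smul_right, ip_smul_right]
  have h' : ∀ (d : CornerData L) (x : Vec d.m), ip (tang (a d x) d.p₁ d.p₂) (top d.m) =
        a d x * ip d.p₁ (top d.m) + (1 - a d x) * ip d.p₂ (top d.m) := fun d x => by
    rw [tang, ip_add_left, ip_smul_left, ip_smul_left]
  simp only [corr, rad2, inward, h, h']
  simp only [tang, perp, Pi.add_apply, Pi.sub_apply, Pi.neg_apply, Pi.smul_apply, smul_eq_mul] at all ⊢
  exact all

/-- The contributions of segments, with the direction given separately. -/
lemma cornerLip_segTerm (hL : 0 ≤ L) (ω r : ℝ) : CornerLip fun (d : CornerData L) x =>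
    ((cl01 (ip (x - d.s) d.p₁ / ω - 2 - 3 * ip d.p₁ (top d.m))
      * cl01 (-2 - ip (x - d.w) d.p₁ / ω)) •
        corr r 1 d.p₁ d.p₂ (x - d.w) (theta x • x)) d.i := by
  simp only [Pi.smul_apply, smul_eq_mul]
  have i₁ := cornerLip_ip_sub (L := L) (fun d => d.nrm_w) (fun d => d.nrm_p₁)
  have i₀ := cornerLip_ip_sub (L := L) (fun d => d.nrm_s) (fun d => d.nrm_p₁)
  have t₁ : CornerLip fun (d : CornerData L) _ => ip d.p₁ (top d.m) :=
    uniformLip_const (L := 1) (fun d => (abs_ip_le _ _).trans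
      (by rw [nrm_top d.m_pos, mul_one]; exact d.nrm_p₁)) zero_le_one
  exact ((((i₀.div_const ω).sub (uniformLip_real 2)).sub (t₁.const_mul 3)).cl01.mul
    ((uniformLip_real (-2)).sub (i₁.div_const ω)).cl01).mul
    (cornerLip_corr hL r (uniformLip_real 1))

/-- The contributions of corners, with the directions given separately. -/
lemma cornerLip_cornerTerm (hL : 0 ≤ L) (ω r : ℝ) : CornerLip fun (d : CornerData L) x =>
    ((cl01 (3 + ip (x - d.w) d.p₁ / ω) * cl01 (3 - ip (x - d.w) d.p₂ / ω)) •
      corr r (cl01 ((1 - (ip (x - d.w) d.p₁ + ip (x - d.w) d.p₂) / ω) / 2))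
        d.p₁ d.p₂ (x - d.w) (theta x • x)) d.i := by
  simp only [Pi.smul_apply, smul_eq_mul]
  have i₁ := cornerLip_ip_sub (L := L) (fun d => d.nrm_w) (fun d => d.nrm_p₁)
  have i₂ := cornerLip_ip_sub (L := L) (fun d => d.nrm_w) (fun d => d.nrm_p₂)
  exact (((uniformLip_real 3).add (i₁.div_const ω)).cl01.mul
    ((uniformLip_real 3).sub (i₂.div_const ω)).cl01).mul (cornerLip_corr hL r
      (((uniformLip_real 1).sub ((i₁.add i₂).div_const ω)).div_const 2).cl01)

end UniformLipschitz

/-! ### Bounds for the entries of the field -/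

section Bounds

variable {m : ℕ}

/-- The entries of the field around a path are bounded independently of its width. -/
lemma abs_corr_le (hm : 0 < m) {x w p₁ p₂ y : Vec m} {r a L : ℝ} {i : Fin 4 × Fin m}
    (hL : 2 ≤ L) (hx : x ∈ cube m) (hw : ∀ i, w i ∈ Set.Icc (0 : ℝ) 1) (ha0 : 0 ≤ a) (ha1 : a ≤ 1)
    (h₁ : nrm p₁ ≤ 1) (h₂ : nrm p₂ ≤ 1) (h₁' : |p₁ i| ≤ L) (h₂' : |p₂ i| ≤ L)
    (hR : 0 ≤ rad2 a p₁ p₂ (x - w)) (hy : |y i| ≤ 2) :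
    |corr r a p₁ p₂ (x - w) y i| ≤ 18 * L := by
  have conv : ∀ (b : ℝ) {c p q : ℝ}, 0 ≤ b → b ≤ 1 → |p| ≤ c → |q| ≤ c →
      |b * p + (1 - b) * q| ≤ c := fun b c p q hb0 hb1 hp hq => by
    have h1 := abs_le.mp hp
    have h2 := abs_le.mp hq
    rw [abs_le]
    constructor <;> nlinarith
  have hwc : w ∈ cube m := fun i => ⟨by linarith [(hw i).1], by linarith [(hw i).2]⟩
  have hξ : nrm (x - w) ≤ 4 := by
    linarith [nrm_sub_le x w, nrm_le_two_of_cube hm hx, nrm_le_two_of_cube hm hwc]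
  have ipb : ∀ p : Vec m, nrm p ≤ 1 → |ip (x - w) p| ≤ 4 := fun p hp =>
    (abs_ip_le _ _).trans (by nlinarith [nrm_nonneg p, nrm_nonneg (x - w)])
  have hT : |tang a p₁ p₂ i| ≤ L := conv a ha0 ha1 h₁' h₂'
  have hP : |perp a p₁ p₂ i| ≤ L := by
    have := conv a ha0 ha1 h₂' (q := -p₁ i) (by rwa [abs_neg])
    simpa [perp, sub_eq_add_neg] using this
  have hPn : |ip (x - w) (perp a p₁ p₂)| ≤ 4 := by
    rw [perp, ip_sub_right, ip_smul_right, ip_smul_right, sub_eq_add_neg, ← mul_neg]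
    exact conv a ha0 ha1 (ipb _ h₂) (by rw [abs_neg]; exact ipb _ h₁)
  have hTt : |ip (tang a p₁ p₂) (top m)| ≤ 1 := by
    rw [tang, ip_add_left, ip_smul_left, ip_smul_left]
    refine conv a ha0 ha1 ?_ ?_
    · exact (abs_ip_le _ _).trans (by rw [nrm_top hm, mul_one]; exact h₁)
    · exact (abs_ip_le _ _).trans (by rw [nrm_top hm, mul_one]; exact h₂)
  have prod : ∀ {c q d e : ℝ}, |c| ≤ d → |q| ≤ e → |c * q| ≤ d * e := fun hc hq => by
    rw [abs_mul]
    exact mul_le_mul hc hq (abs_nonneg _) ((abs_nonneg _).trans hc)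
  have hI : |inward a p₁ p₂ (x - w) i| ≤ 4 + 12 * L := by
    have k₁ := abs_le.mp (prod (ipb _ h₁) h₁')
    have k₂ := abs_le.mp (prod (ipb _ h₂) h₂')
    have k₃ := abs_le.mp (prod hPn hP)
    simp only [inward, Pi.neg_apply, Pi.add_apply, Pi.sub_apply, Pi.smul_apply, smul_eq_mul]
      at k₁ k₂ k₃ ⊢
    rw [abs_le]
    constructor <;> linarith [(hx i).1, (hx i).2, (hw i).1, (hw i).2]
  have hα := abs_alpha_le (show 0 ≤ rad2 a p₁ p₂ (x - w) / r ^ 2 by positivity)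
  have q₁ := abs_le.mp (prod hα hT)
  have q₂ := abs_le.mp (prod (show |cl01 (2 - rad2 a p₁ p₂ (x - w) / r ^ 2)| ≤ 1 by
    rw [abs_of_nonneg (cl01_nonneg _)]; exact cl01_le_one _) hI)
  have q₃ := abs_le.mp (prod (show |1 - cl01 (rad2 a p₁ p₂ (x - w) / r ^ 2 - 2)| ≤ 1 by
    rw [abs_of_nonneg (by linarith [cl01_le_one (rad2 a p₁ p₂ (x - w) / r ^ 2 - 2)])]
    linarith [cl01_nonneg (rad2 a p₁ p₂ (x - w) / r ^ 2 - 2)])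
    (show |top m i - y i| ≤ 4 by
      rw [abs_le]
      constructor <;> linarith [(abs_le.mp hy).1, (abs_le.mp hy).2, (top_mem_Icc i).1,
        (top_mem_Icc i).2]))
  have q₄ := abs_le.mp (prod (prod (show |max 0 (-alpha (rad2 a p₁ p₂ (x - w) / r ^ 2))| ≤ 1 by
    rw [abs_of_nonneg (le_max_left _ _)]
    exact max_le zero_le_one (by linarith [(abs_le.mp hα).1])) hTt) hy)
  simp only [corr, Pi.add_apply, Pi.sub_apply, Pi.smul_apply, smul_eq_mul]
  rw [abs_le]
  constructor <;> linarith

lemma abs_smul_le_of_cutoff {c d e : ℝ} {v : Vec m} {i : Fin 4 × Fin m} (hv : |v i| ≤ e) :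
    |((cl01 c * cl01 d) • v) i| ≤ e := by
  have h0 : 0 ≤ cl01 c * cl01 d := mul_nonneg (cl01_nonneg _) (cl01_nonneg _)
  have h1 : cl01 c * cl01 d ≤ 1 := mul_le_one₀ (cl01_le_one _) (cl01_nonneg _) (cl01_le_one _)
  rw [Pi.smul_apply, smul_eq_mul, abs_mul, abs_of_nonneg h0]
  nlinarith [abs_nonneg (v i)]

end Bounds

section Count

variable {n m : ℕ} {κ l ρ : ℝ} {Enc : (Fin n → Bool) → (Fin m → Bool)} {G : EOL n}

/-! ### The few segments close to a point -/

open Classical in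
/-- The word whose encoding is `b`-close to the block `k` of `x`, if there is one. -/
def nearWord (Enc : (Fin n → Bool) → (Fin m → Bool)) (b : ℝ) (k : Fin 4) (x : Vec m) :
    Fin n → Bool :=
  if h : ∃ u, NearBlock b k (toReal (Enc u)) x then h.choose else root n

/-- The word near a block is unique, by the distance of the code. -/
lemma eq_nearWord (hm : 0 < m) (hS : Scale κ l ρ) (hEnc : IsCode κ Enc) {k : Fin 4} {x : Vec m}
    {u : Fin n → Bool} (hu : NearBlock (2 * ρ) k (toReal (Enc u)) x) :
    u = nearWord Enc (2 * ρ) k x := by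
  have h : ∃ u, NearBlock (2 * ρ) k (toReal (Enc u)) x := ⟨u, hu⟩
  rw [nearWord, dif_pos h]
  exact hu.code_unique hm hEnc hS.sq_lt.1 h.choose_spec

/-- The words near the first two blocks of `x` determine which edges have segments close to `x`. -/
lemma edge_of_closeTo (hm : 0 < m) (hS : Scale κ l ρ) (hEnc : IsCode κ Enc) {x s t : Vec m}
    (h : IsSegment Enc G s t) (hc : CloseTo (2 * ρ) s t x) :
    (s = top m ∧ t = 0) ∨ ∃ u v, G.Edge u v ∧
      (u = nearWord Enc (2 * ρ) 0 x ∨ v = nearWord Enc (2 * ρ) 1 x) ∧ ∃ k : Fin 4,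
        s = brouwerVertex Enc u v k.castSucc ∧ t = brouwerVertex Enc u v k.succ := by
  rcases h with h | ⟨u, v, huv, k, hs, ht⟩
  · exact Or.inl h
  refine Or.inr ⟨u, v, huv, ?_, k, hs, ht⟩
  subst hs ht
  fin_cases k
  · exact Or.inl (eq_nearWord hm hS hEnc (nearBlock_of_closeTo hm hc (fun _ => rfl) (fun _ => rfl)))
  · exact Or.inl (eq_nearWord hm hS hEnc (nearBlock_of_closeTo hm hc (fun _ => rfl) (fun _ => rfl)))
  · exact Or.inr (eq_nearWord hm hS hEnc (nearBlock_of_closeTo hm hc (fun _ => rfl) (fun _ => rfl)))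
  · exact Or.inr (eq_nearWord hm hS hEnc (nearBlock_of_closeTo hm hc (fun _ => rfl) (fun _ => rfl)))

/-- The segment number `k` of the edge `u → v`, as the pair of its end points. -/
def edgeSegs (Enc : (Fin n → Bool) → (Fin m → Bool)) (u v : Fin n → Bool) (k : Fin 4) :
    Vec m × Vec m :=
  (brouwerVertex Enc u v k.castSucc, brouwerVertex Enc u v k.succ)

/-- The first segment, and four segments each for the edge from the word near the first block and
for the edge to the word near the second block. -/
lemma card_closeSegs_le (hm : 0 < m) (hS : Scale κ l ρ) (hEnc : IsCode κ Enc) (x : Vec m) :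
    (closeSegs Enc G (2 * ρ) x).card ≤ 9 := by
  classical
  set u := nearWord Enc (2 * ρ) 0 x with hu
  set v := nearWord Enc (2 * ρ) 1 x with hv
  have hsub : closeSegs Enc G (2 * ρ) x ⊆
      insert (top m, 0) (Finset.univ.image (edgeSegs Enc u (G.succ u)) ∪
        Finset.univ.image (edgeSegs Enc (G.pred v) v)) := by
    rintro ⟨s, t⟩ hσ
    obtain ⟨h, hc⟩ := mem_closeSegs.mp hσ
    rcases edge_of_closeTo hm hS hEnc h hc with ⟨h1, h2⟩ | ⟨a, b, hab, h1, k, h2, h3⟩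
    · exact Finset.mem_insert.mpr (Or.inl (Prod.ext h1 h2))
    · refine Finset.mem_insert.mpr (Or.inr (Finset.mem_union.mpr ?_))
      rcases h1 with rfl | rfl
      · refine Or.inl (Finset.mem_image.mpr ⟨k, Finset.mem_univ _, ?_⟩)
        rw [hab.2.1]
        exact (Prod.ext h2 h3).symm
      · refine Or.inr (Finset.mem_image.mpr ⟨k, Finset.mem_univ _, ?_⟩)
        rw [hab.2.2]
        exact (Prod.ext h2 h3).symm
  have c : ∀ f : Fin 4 → Vec m × Vec m, (Finset.univ.image f).card ≤ 4 := fun f =>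
    Finset.card_image_le.trans (by simp)
  calc _ ≤ _ := Finset.card_le_card hsub
    _ ≤ _ := Finset.card_insert_le _ _
    _ ≤ (4 + 4) + 1 :=
      Nat.add_le_add_right ((Finset.card_union_le _ _).trans (Nat.add_le_add (c _) (c _))) 1

open Classical in
lemma fieldOf_apply (ρ : ℝ) (T : Finset (Vec m × Vec m)) (x : Vec m) (i : Fin 4 × Fin m) :
    fieldOf ρ T x i = top m i - (theta x • x) i
      + ∑ σ ∈ T, segTerm (ρ / 4) (ρ / 8) (theta x • x) (x - σ.1) (x - σ.2) i
      + ∑ σ ∈ T, ∑ τ ∈ T, if σ.2 = τ.1 then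
        cornerTerm (ρ / 4) (ρ / 8) (theta x • x) (x - σ.1) (x - σ.2) (x - τ.2) i else 0 := by
  simp only [fieldOf, Pi.add_apply, Pi.sub_apply, Finset.sum_apply]
  congr 1
  refine Finset.sum_congr rfl fun σ _ => Finset.sum_congr rfl fun τ _ => ?_
  split_ifs <;> rfl

lemma sum_add_sum_sum_le {T : Finset (Vec m × Vec m)} {N : ℕ} (hN : T.card ≤ N)
    {f : Vec m × Vec m → ℝ} {g : Vec m × Vec m → Vec m × Vec m → ℝ} {B B' : ℝ}
    (hB : 0 ≤ B) (hB' : 0 ≤ B') (hf : ∀ σ ∈ T, f σ ≤ B) (hg : ∀ σ ∈ T, ∀ τ ∈ T, g σ τ ≤ B') :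
    ∑ σ ∈ T, f σ + ∑ σ ∈ T, ∑ τ ∈ T, g σ τ ≤ N * B + N * (N * B') := by
  have hc : (T.card : ℝ) ≤ N := by exact_mod_cast hN
  have one : ∀ (f : Vec m × Vec m → ℝ) (B : ℝ), 0 ≤ B → (∀ σ ∈ T, f σ ≤ B) →
      ∑ σ ∈ T, f σ ≤ N * B := fun f B hB hf => by
    refine (Finset.sum_le_card_nsmul T f B hf).trans ?_
    rw [nsmul_eq_mul]
    exact mul_le_mul_of_nonneg_right hc hB
  exact add_le_add (one f B hB hf)
    (one _ _ (by positivity) fun σ hσ => one _ _ hB' (hg σ hσ))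

lemma nrm_start_le (hm : 0 < m) (hEnc : IsCode κ Enc) {s t : Vec m} (h : IsSegment Enc G s t) :
    nrm s ≤ 2 := by
  rcases isSegment_cases hm hEnc h with ⟨rfl, -⟩ | ⟨h1, -⟩
  · rw [nrm_top hm]
    exact one_le_two
  · exact nrm_le_two_of_cube hm fun i => ⟨by linarith [(h1 i).1], by linarith [(h1 i).2]⟩

lemma nrm_end_le (hm : 0 < m) (hEnc : IsCode κ Enc) {s t : Vec m} (h : IsSegment Enc G s t) :
    nrm t ≤ 2 :=
  nrm_le_two_of_cube hm fun i => ⟨by linarith [(end_mem_Icc hm hEnc h i).1],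
    by linarith [(end_mem_Icc hm hEnc h i).2]⟩

/-- The data of a corner at the end `w` of a segment from `s`; a segment alone is encoded with
`p₂ = 0`. -/
def cornerData (hm : 0 < m) (hS : Scale κ l ρ) (hEnc : IsCode κ Enc) (i : Fin 4 × Fin m)
    {s w : Vec m} (h : IsSegment Enc G s w) {p₂ : Vec m} (h₂ : nrm p₂ ≤ 1)
    (h₂' : |p₂ i| ≤ 1 / l) : CornerData (1 / l) where
  m := m
  m_pos := hm
  i := i
  s := s
  w := w
  p₁ := unit (w - s)
  p₂ := p₂
  nrm_s := nrm_start_le hm hEnc h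
  nrm_w := nrm_end_le hm hEnc h
  abs_w := abs_le.mpr ⟨by linarith [(end_mem_Icc hm hEnc h i).1],
    by linarith [(end_mem_Icc hm hEnc h i).2]⟩
  nrm_p₁ := nrm_unit_le _
  nrm_p₂ := h₂
  abs_p₁ := abs_unit_segment_le hm hS hEnc h i
  abs_p₂ := h₂'

/-- The field is Lipschitz, with a constant that depends on the scales only. -/
theorem exists_fieldOf_lipschitz (hS : Scale κ l ρ) :
    ∃ K, 0 ≤ K ∧ ∀ {n m : ℕ}, 0 < m → ∀ {Enc : (Fin n → Bool) → (Fin m → Bool)},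
      IsCode κ Enc → ∀ (G : EOL n) (i : Fin 4 × Fin m), ∀ x ∈ cube m, ∀ y ∈ cube m,
        |fieldOf ρ (segs Enc G) x i - fieldOf ρ (segs Enc G) y i|
          ≤ K * max |x i - y i| (nrm (x - y)) := by
  have hl := hS.l_pos
  have hL : (0 : ℝ) ≤ 1 / l := by positivity
  obtain ⟨K₁, hK₁, h₁⟩ := cornerLip_segTerm hL (ρ / 4) (ρ / 8)
  obtain ⟨K₂, hK₂, h₂⟩ := cornerLip_cornerTerm hL (ρ / 4) (ρ / 8)
  obtain ⟨K₃, hK₃, h₃⟩ := cornerLip_theta_smul (L := 1 / l)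
  refine ⟨K₃ + ((18 : ℕ) * K₁ + (18 : ℕ) * ((18 : ℕ) * K₂)), by positivity, ?_⟩
  intro n m hm Enc hEnc G i x hx y hy
  classical
  set d := max |x i - y i| (nrm (x - y)) with hd
  have hd0 : 0 ≤ d := max_abs_nrm_nonneg x y i
  -- At both points only the segments in `T` contribute.
  set T := closeSegs Enc G (2 * ρ) x ∪ closeSegs Enc G (2 * ρ) y with hT
  have hTs : T ⊆ segs Enc G := Finset.union_subset (Finset.filter_subset _ _)
    (Finset.filter_subset _ _)
  have hN : T.card ≤ 18 := (Finset.card_union_le _ _).trans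
    (Nat.add_le_add (card_closeSegs_le hm hS hEnc x) (card_closeSegs_le hm hS hEnc y))
  rw [fieldOf_segs_eq hm hS hEnc hx hTs Finset.subset_union_left,
    fieldOf_segs_eq hm hS hEnc hy hTs Finset.subset_union_right, fieldOf_apply, fieldOf_apply]
  have hθ : |(theta x • x) i - (theta y • y) i| ≤ K₃ * d :=
    (h₃ ⟨m, hm, i, 0, 0, 0, 0, by simp [nrm_zero], by simp [nrm_zero], by simp, by simp [nrm_zero],
      by simp [nrm_zero], by simpa using hl.le, by simpa using hl.le⟩ x hx y hy).2
  have hseg : ∀ σ ∈ T, |segTerm (ρ / 4) (ρ / 8) (theta x • x) (x - σ.1) (x - σ.2) i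
      - segTerm (ρ / 4) (ρ / 8) (theta y • y) (y - σ.1) (y - σ.2) i| ≤ K₁ * d := by
    intro σ hσ
    have := (h₁ (cornerData hm hS hEnc i (mem_segs.mp (hTs hσ)) (p₂ := 0) (by simp [nrm_zero])
      (by simpa using hl.le)) x hx y hy).2
    simp only [segTerm, sub_sub_sub_cancel_left]
    exact this
  have hcor : ∀ σ ∈ T, ∀ τ ∈ T, |(if σ.2 = τ.1 then
      cornerTerm (ρ / 4) (ρ / 8) (theta x • x) (x - σ.1) (x - σ.2) (x - τ.2) i else 0)
      - (if σ.2 = τ.1 then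
        cornerTerm (ρ / 4) (ρ / 8) (theta y • y) (y - σ.1) (y - σ.2) (y - τ.2) i else 0)|
      ≤ K₂ * d := by
    intro σ hσ τ hτ
    split_ifs with h
    · have hτ' := mem_segs.mp (hTs hτ)
      rw [← h] at hτ'
      have := (h₂ (cornerData hm hS hEnc i (mem_segs.mp (hTs hσ)) (p₂ := unit (τ.2 - σ.2))
        (nrm_unit_le _) (abs_unit_segment_le hm hS hEnc hτ' i)) x hx y hy).2
      simp only [cornerTerm, sub_sub_sub_cancel_left]
      exact this
    · rw [sub_zero, abs_zero]
      positivity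
  have hsum := sum_add_sum_sum_le hN (mul_nonneg hK₁ hd0) (mul_nonneg hK₂ hd0) hseg hcor
  have a₁ := Finset.abs_sum_le_sum_abs (fun σ : Vec m × Vec m =>
    segTerm (ρ / 4) (ρ / 8) (theta x • x) (x - σ.1) (x - σ.2) i
      - segTerm (ρ / 4) (ρ / 8) (theta y • y) (y - σ.1) (y - σ.2) i) T
  have a₂ := (Finset.abs_sum_le_sum_abs (fun σ : Vec m × Vec m => ∑ τ ∈ T, ((if σ.2 = τ.1 then
      cornerTerm (ρ / 4) (ρ / 8) (theta x • x) (x - σ.1) (x - σ.2) (x - τ.2) i else 0)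
      - (if σ.2 = τ.1 then
        cornerTerm (ρ / 4) (ρ / 8) (theta y • y) (y - σ.1) (y - σ.2) (y - τ.2) i else 0))) T).trans
    (Finset.sum_le_sum fun σ _ => Finset.abs_sum_le_sum_abs _ _)
  simp only [Finset.sum_sub_distrib] at a₁ a₂
  rw [abs_le] at *
  constructor <;> linarith

/-- The entries of the field are bounded in terms of the code only. -/
lemma abs_fieldOf_le (hm : 0 < m) (hS : Scale κ l ρ) (hEnc : IsCode κ Enc) {x : Vec m}
    (hx : x ∈ cube m) (i : Fin 4 × Fin m) :
    |fieldOf ρ (segs Enc G) x i| ≤ 2000 * (1 / l) := by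
  classical
  have hl2 := hS.two_le
  have hρ := hS.ρ_pos
  rw [fieldOf_segs hm hS hEnc hx, fieldOf_apply]
  have hN := card_closeSegs_le (G := G) hm hS hEnc x
  have hy : |(theta x • x) i| ≤ 2 := by
    obtain ⟨h0, h1⟩ := theta_mem x
    rw [Pi.smul_apply, smul_eq_mul, abs_mul, abs_of_nonneg h0]
    have : |x i| ≤ 2 := abs_le.mpr ⟨by linarith [(hx i).1], (hx i).2⟩
    nlinarith [abs_nonneg (x i)]
  have n₀ : ∀ {s t : Vec m}, IsSegment Enc G s t → nrm (t - s) ≠ 0 := fun h =>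
    (hS.l_pos.trans_le (le_nrm_segment hm hS hEnc h)).ne'
  have hseg : ∀ σ ∈ closeSegs Enc G (2 * ρ) x,
      |segTerm (ρ / 4) (ρ / 8) (theta x • x) (x - σ.1) (x - σ.2) i| ≤ 18 * (1 / l) := by
    intro σ hσ
    have h := (mem_closeSegs.mp hσ).1
    rw [segTerm, sub_sub_sub_cancel_left]
    exact abs_smul_le_of_cutoff (abs_corr_le hm hl2 hx (end_mem_Icc hm hEnc h) zero_le_one le_rfl
      (nrm_unit_le _) (by simp [nrm_zero]) (abs_unit_segment_le hm hS hEnc h i)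
      (by rw [Pi.zero_apply, abs_zero]; linarith) (rad2_one_nonneg (ip_unit_self (n₀ h)) _ _) hy)
  have hcor : ∀ σ ∈ closeSegs Enc G (2 * ρ) x, ∀ τ ∈ closeSegs Enc G (2 * ρ) x,
      |if σ.2 = τ.1 then
        cornerTerm (ρ / 4) (ρ / 8) (theta x • x) (x - σ.1) (x - σ.2) (x - τ.2) i else 0|
      ≤ 18 * (1 / l) := by
    intro σ hσ τ hτ
    have h := (mem_closeSegs.mp hσ).1
    have h' := (mem_closeSegs.mp hτ).1
    split_ifs with hστ
    · rw [← hστ] at h'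
      have i₁₂ : ip (unit (σ.2 - σ.1)) (unit (τ.2 - σ.2)) = 0 := by
        rw [unit, unit, ip_smul_left, ip_smul_right, ip_consecutive hm hS hEnc h h', mul_zero,
          mul_zero]
      rw [cornerTerm, sub_sub_sub_cancel_left, sub_sub_sub_cancel_left]
      exact abs_smul_le_of_cutoff (abs_corr_le hm hl2 hx (end_mem_Icc hm hEnc h) (cl01_nonneg _)
        (cl01_le_one _) (nrm_unit_le _) (nrm_unit_le _) (abs_unit_segment_le hm hS hEnc h i)
        (abs_unit_segment_le hm hS hEnc h' i)
        (rad2_nonneg (ip_unit_self (n₀ h)) (ip_unit_self (n₀ h')) i₁₂ _) hy)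
    · rw [abs_zero]
      linarith
  have hsum := sum_add_sum_sum_le hN (by linarith) (by linarith) hseg hcor
  have a₁ := Finset.abs_sum_le_sum_abs (fun σ : Vec m × Vec m =>
    segTerm (ρ / 4) (ρ / 8) (theta x • x) (x - σ.1) (x - σ.2) i) (closeSegs Enc G (2 * ρ) x)
  have a₂ := (Finset.abs_sum_le_sum_abs (fun σ : Vec m × Vec m =>
    ∑ τ ∈ closeSegs Enc G (2 * ρ) x, (if σ.2 = τ.1 then
      cornerTerm (ρ / 4) (ρ / 8) (theta x • x) (x - σ.1) (x - σ.2) (x - τ.2) i else 0))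
      (closeSegs Enc G (2 * ρ) x)).trans
    (Finset.sum_le_sum fun σ _ => Finset.abs_sum_le_sum_abs _ _)
  have t0 := (top_mem_Icc i).1
  have t2 := (top_mem_Icc i).2
  push_cast at hsum
  rw [abs_le] at *
  constructor <;> linarith

end Count

section Locality

variable {n m : ℕ} {κ l ρ : ℝ} {Enc : (Fin n → Bool) → (Fin m → Bool)} {G : EOL n}

/-! ### Dependence on the location relative to the segments -/

lemma isSegment_binary {s t : Vec m} (h : IsSegment Enc G s t) :
    (s = top m ∧ t = 0) ∨ ∀ i, (s i = 0 ∨ s i = 1) ∧ (t i = 0 ∨ t i = 1) := by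
  rcases h with h | ⟨u, v, -, k, rfl, rfl⟩
  · exact Or.inl h
  right
  have bin : ∀ (w : Fin n → Bool) (j : Fin m), toReal (Enc w) j = 0 ∨ toReal (Enc w) j = 1 :=
    fun w j => by
      rw [toReal]
      split_ifs <;> simp
  have bl : ∀ (a b : Fin n → Bool) (c : Fin m → ℝ), (∀ j, c j = 0 ∨ c j = 1) → ∀ i,
      blocks (toReal (Enc a)) (toReal (Enc b)) c 0 i = 0 ∨
        blocks (toReal (Enc a)) (toReal (Enc b)) c 0 i = 1 := by
    rintro a b c hc ⟨k, j⟩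
    fin_cases k
    · exact bin a j
    · exact bin b j
    · exact hc j
    · exact Or.inl rfl
  have b0 : ∀ j : Fin m, (0 : Fin m → ℝ) j = 0 ∨ (0 : Fin m → ℝ) j = 1 := fun j => Or.inl rfl
  have b1 : ∀ j : Fin m, (1 : Fin m → ℝ) j = 0 ∨ (1 : Fin m → ℝ) j = 1 := fun j => Or.inr rfl
  fin_cases k
  · exact fun i => ⟨bl _ _ _ b0 i, bl _ _ _ b0 i⟩
  · exact fun i => ⟨bl _ _ _ b0 i, bl _ _ _ b1 i⟩
  · exact fun i => ⟨bl _ _ _ b1 i, bl _ _ _ b1 i⟩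
  · exact fun i => ⟨bl _ _ _ b1 i, bl _ _ _ b0 i⟩

open Classical in
lemma coe_image_closeSegs (b : ℝ) (x : Vec m) :
    (((closeSegs Enc G b x).image fun σ => (x - σ.1, x - σ.2) : Finset (Vec m × Vec m)) :
      Set (Vec m × Vec m)) = relativeLocation Enc b G x := by
  ext p
  simp only [Finset.coe_image, Set.mem_image, Finset.mem_coe, mem_closeSegs, relativeLocation]
  constructor
  · rintro ⟨⟨s, t⟩, ⟨h1, h2⟩, rfl⟩
    exact ⟨s, t, h1, h2, rfl⟩
  · rintro ⟨s, t, h1, h2, rfl⟩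
    exact ⟨(s, t), ⟨h1, h2⟩, rfl⟩

lemma corr_apply_of_eq_zero {p₁ p₂ ξ : Vec m} {r a : ℝ} {i : Fin 4 × Fin m} (h₁ : p₁ i = 0)
    (h₂ : p₂ i = 0) (ht : top m i = 0) :
    corr r a p₁ p₂ ξ 0 i = cl01 (2 - rad2 a p₁ p₂ ξ / r ^ 2) * -ξ i := by
  simp only [corr, inward, tang, perp, Pi.add_apply, Pi.sub_apply, Pi.smul_apply, Pi.neg_apply,
    Pi.zero_apply, smul_eq_mul, h₁, h₂, ht]
  ring

lemma unit_apply_of_eq {s t : Vec m} {i : Fin 4 × Fin m} (h : s i = t i) : unit (t - s) i = 0 := by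
  rw [unit, Pi.smul_apply, Pi.sub_apply, h, sub_self, smul_zero]

lemma weight_mul_mem {c x w : ℝ} (hc0 : 0 ≤ c) (hc1 : c ≤ 1) (hx : x ∈ Set.Icc (-1 : ℝ) 2)
    (hw : w ∈ Set.Icc (0 : ℝ) 1) : c * -(x - w) ≤ 2 - x ∧ -(c * -(x - w)) ≤ 1 + x := by
  obtain ⟨hx1, hx2⟩ := hx
  obtain ⟨hw1, hw2⟩ := hw
  constructor <;> nlinarith

/-- At a coordinate in which no segment close to `x` moves, the displacement points towards the
segments, so that the truncation is not active. -/
lemma clampMove_apply_of_const (hm : 0 < m) (hS : Scale κ l ρ) (hEnc : IsCode κ Enc) {ε : ℝ}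
    (hε : 0 ≤ ε) (hε1 : ε ≤ 1 / 90) {x : Vec m} (hx : x ∈ cube m) (hθ : theta x = 0)
    {i : Fin 4 × Fin m} (hi : top m i = 0)
    (hconst : ∀ σ ∈ closeSegs Enc G (2 * ρ) x, σ.1 i = σ.2 i) :
    clampMove x (ε • fieldOf ρ (segs Enc G) x) i = ε * fieldOf ρ (segs Enc G) x i := by
  classical
  apply clampMove_of_mem
  rw [fieldOf_segs hm hS hEnc hx, Pi.smul_apply, smul_eq_mul]
  have hN := card_closeSegs_le (G := G) hm hS hEnc x
  have hF := fieldOf_apply ρ (closeSegs Enc G (2 * ρ) x) x i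
  rw [hθ, zero_smul, hi] at hF
  have hseg : ∀ σ ∈ closeSegs Enc G (2 * ρ) x,
      segTerm (ρ / 4) (ρ / 8) 0 (x - σ.1) (x - σ.2) i ≤ 2 - x i ∧
        -segTerm (ρ / 4) (ρ / 8) 0 (x - σ.1) (x - σ.2) i ≤ 1 + x i := by
    intro σ hσ
    rw [segTerm, sub_sub_sub_cancel_left, Pi.smul_apply, smul_eq_mul, corr_apply_of_eq_zero
      (unit_apply_of_eq (hconst σ hσ)) rfl hi, ← mul_assoc]
    exact weight_mul_mem (mul_nonneg (mul_nonneg (cl01_nonneg _) (cl01_nonneg _)) (cl01_nonneg _))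
      (mul_le_one₀ (mul_le_one₀ (cl01_le_one _) (cl01_nonneg _) (cl01_le_one _)) (cl01_nonneg _)
        (cl01_le_one _)) (hx i) (end_mem_Icc hm hEnc (mem_closeSegs.mp hσ).1 i)
  have hcor : ∀ σ ∈ closeSegs Enc G (2 * ρ) x, ∀ τ ∈ closeSegs Enc G (2 * ρ) x,
      (if σ.2 = τ.1 then cornerTerm (ρ / 4) (ρ / 8) 0 (x - σ.1) (x - σ.2) (x - τ.2) i else 0)
        ≤ 2 - x i ∧
      -(if σ.2 = τ.1 then cornerTerm (ρ / 4) (ρ / 8) 0 (x - σ.1) (x - σ.2) (x - τ.2) i else 0)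
        ≤ 1 + x i := by
    intro σ hσ τ hτ
    split_ifs with h
    · rw [cornerTerm, sub_sub_sub_cancel_left, sub_sub_sub_cancel_left, Pi.smul_apply, smul_eq_mul,
        corr_apply_of_eq_zero (unit_apply_of_eq (hconst σ hσ))
          (unit_apply_of_eq (by rw [h]; exact hconst τ hτ)) hi, ← mul_assoc]
      exact weight_mul_mem
        (mul_nonneg (mul_nonneg (cl01_nonneg _) (cl01_nonneg _)) (cl01_nonneg _))
        (mul_le_one₀ (mul_le_one₀ (cl01_le_one _) (cl01_nonneg _) (cl01_le_one _)) (cl01_nonneg _)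
          (cl01_le_one _)) (hx i) (end_mem_Icc hm hEnc (mem_closeSegs.mp hσ).1 i)
    · constructor <;> linarith [(hx i).1, (hx i).2]
  have hx1 : 0 ≤ 1 + x i := by linarith [(hx i).1]
  have hx2 : 0 ≤ 2 - x i := by linarith [(hx i).2]
  have up := sum_add_sum_sum_le hN hx2 hx2 (fun σ hσ => (hseg σ hσ).1)
    (fun σ hσ τ hτ => (hcor σ hσ τ hτ).1)
  have lo := sum_add_sum_sum_le hN hx1 hx1 (fun σ hσ => (hseg σ hσ).2)
    (fun σ hσ τ hτ => (hcor σ hσ τ hτ).2)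
  simp only [Finset.sum_neg_distrib] at lo
  push_cast at up lo
  have hF1 : fieldOf ρ (closeSegs Enc G (2 * ρ) x) x i ≤ 90 * (2 - x i) := by
    rw [hF, Pi.zero_apply]
    linarith
  have hF2 : -fieldOf ρ (closeSegs Enc G (2 * ρ) x) x i ≤ 90 * (1 + x i) := by
    rw [hF, Pi.zero_apply]
    linarith
  have m1 := mul_le_mul_of_nonneg_left hF1 hε
  have m2 := mul_le_mul_of_nonneg_left hF2 hε
  have m3 := mul_le_mul_of_nonneg_right hε1 hx1
  have m4 := mul_le_mul_of_nonneg_right hε1 hx2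
  constructor <;> linarith

/-- A segment other than the first one is close to `x` only where the default field is `top`. -/
lemma theta_eq_zero_of_closeTo (hm : 0 < m) (hS : Scale κ l ρ) (hEnc : IsCode κ Enc) {x s t : Vec m}
    (h : IsSegment Enc G s t) (hc : CloseTo (2 * ρ) s t x) (hne : ¬ (s = top m ∧ t = 0)) :
    theta x = 0 := by
  rcases isSegment_cases hm hEnc h with h1 | ⟨-, -, hs, ht, -⟩
  · exact absurd h1 hne
  · obtain ⟨z, ⟨a, b, -, -, -, rfl⟩, hz⟩ := hc
    refine theta_eq_zero_of_near hm ?_ (hz.trans (by linarith [hS.ρ_le']))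
    rw [ip_add_left, ip_smul_left, ip_smul_left, hs, ht, mul_zero, mul_zero, add_zero]

lemma eq_first_of_sub_eq (hm : 0 < m) {n' : ℕ} {Enc' : (Fin n' → Bool) → (Fin m → Bool)}
    (hEnc' : IsCode κ Enc') {G' : EOL n'} {s' t' : Vec m} (h' : IsSegment Enc' G' s' t')
    (hd : t' - s' = 0 - top m) : s' = top m ∧ t' = 0 := by
  rcases isSegment_cases hm hEnc' h' with h1 | ⟨-, -, -, -, hs, ht, -⟩
  · exact h1
  · have := congrFun hd (3, ⟨0, hm⟩)
    rw [Pi.sub_apply, hs, ht] at this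
    simp [top, blocks] at this

/-- The displacement at a point close to a segment depends only on the relative location. The field
is a function of the relative location by definition. The truncation depends on the coordinates of
`x` as well, but these are determined by the relative location where a segment moves, and elsewhere
the truncation is not active. -/
theorem clampMove_eq_of_relativeLocation_eq (hm : 0 < m) (hS : Scale κ l ρ) (hEnc : IsCode κ Enc)
    {n' : ℕ} {Enc' : (Fin n' → Bool) → (Fin m → Bool)} (hEnc' : IsCode κ Enc') {G' : EOL n'} {ε : ℝ}
    (hε : 0 ≤ ε) (hε1 : ε ≤ 1 / 90) {x x' : Vec m} (hx : x ∈ cube m) (hx' : x' ∈ cube m)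
    (hne : (relativeLocation Enc (2 * ρ) G x).Nonempty)
    (heq : relativeLocation Enc (2 * ρ) G x = relativeLocation Enc' (2 * ρ) G' x') :
    clampMove x (ε • fieldOf ρ (segs Enc G) x) = clampMove x' (ε • fieldOf ρ (segs Enc' G') x') := by
  classical
  have himg : (closeSegs Enc G (2 * ρ) x).image (fun σ => (x - σ.1, x - σ.2)) =
      (closeSegs Enc' G' (2 * ρ) x').image (fun σ => (x' - σ.1, x' - σ.2)) := by
    rw [← Finset.coe_inj, coe_image_closeSegs, coe_image_closeSegs, heq]
  have hfield : theta x • x = theta x' • x' →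
      fieldOf ρ (segs Enc G) x = fieldOf ρ (segs Enc' G') x' := by
    intro h
    rw [fieldOf_segs hm hS hEnc hx, fieldOf_segs hm hS hEnc' hx', fieldOf_eq_relField,
      fieldOf_eq_relField, himg, h]
  by_cases hxx : x = x'
  · subst hxx
    rw [hfield rfl]
  -- Corresponding segments are translates of each other, and neither is the first one.
  have corresp : ∀ s t s' t' : Vec m, IsSegment Enc G s t → IsSegment Enc' G' s' t' →
      x - s = x' - s' → x - t = x' - t' → ¬ (s = top m ∧ t = 0) ∧ ¬ (s' = top m ∧ t' = 0) := by
    intro s t s' t' h h' h1 h2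
    have hd : t' - s' = t - s := by
      rw [← sub_sub_sub_cancel_left s t x, h1, h2, sub_sub_sub_cancel_left]
    constructor
    · rintro ⟨rfl, rfl⟩
      obtain ⟨-, rfl⟩ := eq_first_of_sub_eq hm hEnc' h' hd
      exact hxx (by simpa using h2)
    · rintro ⟨rfl, rfl⟩
      obtain ⟨-, rfl⟩ := eq_first_of_sub_eq hm hEnc h hd.symm
      exact hxx (by simpa using h2)
  have coord : ∀ (s t s' t' : Vec m) (i : Fin 4 × Fin m), IsSegment Enc G s t →
      IsSegment Enc' G' s' t' → x - s = x' - s' → x - t = x' - t' → x i ≠ x' i →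
      s i = t i ∧ s' i = t' i ∧ i.1 ≠ 3 := by
    intro s t s' t' i h h' h1 h2 hi
    obtain ⟨n1, n2⟩ := corresp s t s' t' h h' h1 h2
    have e1 := congrFun h1 i
    have e2 := congrFun h2 i
    simp only [Pi.sub_apply] at e1 e2
    obtain ⟨a1, a2⟩ := (isSegment_binary h).resolve_left n1 i
    obtain ⟨a3, a4⟩ := (isSegment_binary h').resolve_left n2 i
    have hi' : x i - x' i ≠ 0 := sub_ne_zero.mpr hi
    refine ⟨?_, ?_, ?_⟩
    · grind
    · grind
    · intro h3
      obtain ⟨-, -, -, -, -, z1, -⟩ := (isSegment_cases hm hEnc h).resolve_left n1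
      obtain ⟨-, -, -, -, -, z2, -⟩ := (isSegment_cases hm hEnc' h').resolve_left n2
      obtain ⟨k, j⟩ := i
      simp only at h3
      subst h3
      rw [z1, z2] at e2
      exact hi (by linarith)
  have fwd : ∀ σ ∈ closeSegs Enc G (2 * ρ) x, ∃ σ' ∈ closeSegs Enc' G' (2 * ρ) x',
      x - σ.1 = x' - σ'.1 ∧ x - σ.2 = x' - σ'.2 := by
    intro σ hσ
    have := Finset.mem_image_of_mem (fun σ : Vec m × Vec m => (x - σ.1, x - σ.2)) hσ
    rw [himg] at this
    obtain ⟨σ', h1, h2⟩ := Finset.mem_image.mp this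
    rw [Prod.mk.injEq] at h2
    exact ⟨σ', h1, h2.1.symm, h2.2.symm⟩
  have bwd : ∀ σ' ∈ closeSegs Enc' G' (2 * ρ) x', ∃ σ ∈ closeSegs Enc G (2 * ρ) x,
      x - σ.1 = x' - σ'.1 ∧ x - σ.2 = x' - σ'.2 := by
    intro σ' hσ'
    have := Finset.mem_image_of_mem (fun σ : Vec m × Vec m => (x' - σ.1, x' - σ.2)) hσ'
    rw [← himg] at this
    obtain ⟨σ, h1, h2⟩ := Finset.mem_image.mp this
    rw [Prod.mk.injEq] at h2
    exact ⟨σ, h1, h2.1, h2.2⟩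
  obtain ⟨p, s₀, t₀, h₀, hc₀, rfl⟩ := hne
  obtain ⟨σ', hσ', e1, e2⟩ := fwd (s₀, t₀) (mem_closeSegs.mpr ⟨h₀, hc₀⟩)
  obtain ⟨h₀', hc₀'⟩ := mem_closeSegs.mp hσ'
  obtain ⟨n1, n2⟩ := corresp _ _ _ _ h₀ h₀' e1 e2
  have hθ := theta_eq_zero_of_closeTo hm hS hEnc h₀ hc₀ n1
  have hθ' := theta_eq_zero_of_closeTo hm hS hEnc' h₀' hc₀' n2
  have hf := hfield (by rw [hθ, hθ', zero_smul, zero_smul])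
  ext i
  by_cases hi : x i = x' i
  · rw [clampMove, clampMove, hi, hf]
  · have hi3 := (coord _ _ _ _ i h₀ h₀' e1 e2 hi).2.2
    have ht : top m i = 0 := by
      obtain ⟨k, j⟩ := i
      fin_cases k <;> simp_all [top, blocks]
    rw [clampMove_apply_of_const hm hS hEnc hε hε1 hx hθ ht,
      clampMove_apply_of_const hm hS hEnc' hε hε1 hx' hθ' ht, hf]
    · intro τ' hτ'
      obtain ⟨τ, hτ, f1, f2⟩ := bwd τ' hτ'
      exact (coord _ _ _ _ i (mem_closeSegs.mp hτ).1 (mem_closeSegs.mp hτ').1 f1 f2 hi).2.1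
    · intro τ hτ
      obtain ⟨τ', hτ', f1, f2⟩ := fwd τ hτ
      exact (coord _ _ _ _ i (mem_closeSegs.mp hτ).1 (mem_closeSegs.mp hτ').1 f1 f2 hi).1

/-! ### Queries -/

/-- The answers to the four queries that determine the segments close to a point with the nearby
words `u` and `v`. -/
def SameAnswers (u v : Fin n → Bool) (G G' : EOL n) : Prop :=
  G'.succ u = G.succ u ∧ G'.pred (G.succ u) = G.pred (G.succ u) ∧
    G'.pred v = G.pred v ∧ G'.succ (G.pred v) = G.succ (G.pred v)

lemma closeSegs_subset_of_sameAnswers (hm : 0 < m) (hS : Scale κ l ρ) (hEnc : IsCode κ Enc)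
    {x : Vec m} {G' : EOL n}
    (h : SameAnswers (nearWord Enc (2 * ρ) 0 x) (nearWord Enc (2 * ρ) 1 x) G G') :
    closeSegs Enc G (2 * ρ) x ⊆ closeSegs Enc G' (2 * ρ) x := by
  rintro ⟨s, t⟩ hσ
  obtain ⟨hst, hc⟩ := mem_closeSegs.mp hσ
  refine mem_closeSegs.mpr ⟨?_, hc⟩
  rcases edge_of_closeTo hm hS hEnc hst hc with h1 | ⟨u, v, huv, huv', k, hs, ht⟩
  · exact Or.inl h1
  · refine Or.inr ⟨u, v, ⟨huv.1, ?_⟩, k, hs, ht⟩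
    obtain ⟨h1, h2, h3, h4⟩ := h
    rcases huv' with h5 | h5
    · rw [← h5, huv.2.1] at h1 h2
      exact ⟨h1, h2.trans huv.2.2⟩
    · rw [← h5, huv.2.2] at h3 h4
      exact ⟨h4.trans huv.2.1, h3⟩

lemma SameAnswers.symm {u v : Fin n → Bool} {G G' : EOL n} (h : SameAnswers u v G G') :
    SameAnswers u v G' G := by
  obtain ⟨h1, h2, h3, h4⟩ := h
  refine ⟨h1.symm, ?_, h3.symm, ?_⟩
  · rw [h1, h2]
  · rw [h3, h4]

lemma fieldOf_eq_of_sameAnswers (hm : 0 < m) (hS : Scale κ l ρ) (hEnc : IsCode κ Enc)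
    {x : Vec m} (hx : x ∈ cube m) {G' : EOL n}
    (h : SameAnswers (nearWord Enc (2 * ρ) 0 x) (nearWord Enc (2 * ρ) 1 x) G G') :
    fieldOf ρ (segs Enc G) x = fieldOf ρ (segs Enc G') x := by
  rw [fieldOf_segs hm hS hEnc hx, fieldOf_segs hm hS hEnc hx]
  congr 1
  exact subset_antisymm (closeSegs_subset_of_sameAnswers hm hS hEnc h)
    (closeSegs_subset_of_sameAnswers hm hS hEnc h.symm)

open Classical in
/-- A function of the instance that depends only on the answers to four queries is computed by a
query algorithm: it outputs the value at an arbitrary instance with the same answers. -/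
lemma exists_queryAlg {α : Type} (F : EOL n → α) (u v : Fin n → Bool)
    (hF : ∀ G G', SameAnswers u v G G' → F G = F G') :
    ∃ A : QueryAlg n α, ∀ G, A.run G = F G ∧ A.cost G ≤ 4 := by
  let dflt : EOL n := ⟨id, id⟩
  let out : (Fin n → Bool) → (Fin n → Bool) → (Fin n → Bool) → (Fin n → Bool) → α :=
    fun a b c d =>
      if h : ∃ G' : EOL n, G'.succ u = a ∧ G'.pred a = b ∧ G'.pred v = c ∧ G'.succ c = d then
        F h.choose
      else F dflt
  refine ⟨.query u fun a _ => .query a fun _ b => .query v fun _ c => .query c fun d _ =>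
    .output (out a b c d), fun G => ⟨?_, le_rfl⟩⟩
  have h : ∃ G' : EOL n, G'.succ u = G.succ u ∧ G'.pred (G.succ u) = G.pred (G.succ u) ∧
      G'.pred v = G.pred v ∧ G'.succ (G.pred v) = G.succ (G.pred v) := ⟨G, rfl, rfl, rfl, rfl⟩
  simp only [QueryAlg.run, out]
  rw [dif_pos h]
  exact (hF G h.choose h.choose_spec).symm

/-! ### Bounds for truncated displacements -/

lemma abs_clampMove_le {x : Vec m} (hx : x ∈ cube m) (v : Vec m) (i : Fin 4 × Fin m) :
    |clampMove x v i| ≤ |v i| := by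
  have h1 := (hx i).1
  have h2 := (hx i).2
  have h := abs_max_min_sub_le (-1) 2 (x i + v i) (x i)
  rwa [min_eq_right h2, max_eq_right h1, add_sub_cancel_left] at h

lemma add_clampMove_apply (x v : Vec m) (i : Fin 4 × Fin m) :
    x i + clampMove x v i = max (-1) (min 2 (x i + v i)) := by
  rw [clampMove, add_sub_cancel]

lemma add_clampMove_mem (x v : Vec m) : x + clampMove x v ∈ cube m := by
  intro i
  rw [Pi.add_apply, add_clampMove_apply]
  exact ⟨le_max_left _ _, max_le (by norm_num) (min_le_left _ _)⟩

/-- A coordinatewise Lipschitz bound with the maximum of both distances yields one in the norm; the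
loss is a factor `√2`, and `3 * √2 ≤ 5`. -/
lemma nrm_le_of_abs_le_max (hm : 0 < m) {w z : Vec m}
    (h : ∀ i, |w i| ≤ 3 * max |z i| (nrm z)) : nrm w ≤ 5 * nrm z := by
  have hm' : (0 : ℝ) < m := by positivity
  apply nrm_le_of_ip_le (mul_nonneg (by norm_num) (nrm_nonneg z))
  have h1 : ∀ i, w i * w i ≤ 9 * (z i * z i) + 9 * nrm z ^ 2 := by
    intro i
    have h2 : |w i| ^ 2 ≤ (3 * max |z i| (nrm z)) ^ 2 := pow_le_pow_left₀ (abs_nonneg _) (h i) 2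
    have h3 : max |z i| (nrm z) ^ 2 ≤ |z i| ^ 2 + nrm z ^ 2 := by
      rcases max_choice |z i| (nrm z) with h4 | h4 <;> rw [h4] <;> nlinarith [sq_nonneg |z i|,
        sq_nonneg (nrm z)]
    rw [sq_abs] at h2 h3
    nlinarith
  have h2 : ip w w ≤ 9 * ip z z + 9 * nrm z ^ 2 := by
    have h3 := Finset.sum_le_sum fun i (_ : i ∈ Finset.univ) => h1 i
    rw [Finset.sum_add_distrib, ← Finset.mul_sum, Finset.sum_const, Finset.card_univ,
      Fintype.card_prod, Fintype.card_fin, Fintype.card_fin, nsmul_eq_mul] at h3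
    push_cast at h3
    rw [ip, ip, div_le_iff₀ (by positivity), add_mul, mul_assoc 9, div_mul_cancel₀ _ (by positivity)]
    linarith
  rw [← nrm_sq z] at h2
  nlinarith [sq_nonneg (nrm z)]

/-- The default field does not depend on the instance. -/
lemma fieldOf_eq_default_of_far (hm : 0 < m) (hS : Scale κ l ρ) (hEnc : IsCode κ Enc)
    {x : Vec m} (hx : x ∈ cube m)
    (hfar : ∀ s t, IsSegment Enc G s t → FarFrom (2 * ρ) s t x) :
    fieldOf ρ (segs Enc G) x = top m - theta x • x := by
  rw [← fieldOf_empty ρ x]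
  apply fieldOf_eq_of_subset (Finset.empty_subset _)
  · intro σ hσ hne
    rw [mem_segs] at hσ
    obtain ⟨z, hz, hz'⟩ := exists_near_of_segTerm_ne_zero hm hS hEnc hx hσ hne
    exact absurd hz' (not_lt.mpr (hfar _ _ hσ z hz))
  · rintro ⟨s, w⟩ hσ ⟨w', t⟩ hτ (rfl : w = w') hne
    rw [mem_segs] at hσ hτ
    exact absurd (nrm_lt_of_corner hm hS hEnc hσ hτ hne)
      (not_lt.mpr (hfar _ _ hσ w (right_mem_segment ℝ s w)))

end Locality

section Displacement

variable {n m : ℕ} {κ l ρ : ℝ} {Enc : (Fin n → Bool) → (Fin m → Bool)} {G : EOL n}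

/-! ### The displacement -/

/-- The displacement of the instance `G`: the field of its Brouwer line segments, scaled by `ε` and
truncated at the boundary of the cube. -/
def displacement (ε ρ : ℝ) (Enc : (Fin n → Bool) → (Fin m → Bool)) (G : EOL n) (x : Vec m) :
    Vec m :=
  clampMove x (ε • fieldOf ρ (segs Enc G) x)

lemma displacement_mem_Icc (hm : 0 < m) (hS : Scale κ l ρ) (hEnc : IsCode κ Enc) {δ : ℝ}
    (hδ : 0 ≤ δ) {x : Vec m} (hx : x ∈ cube m) (i : Fin 4 × Fin m) :
    displacement (δ * l / 2000) ρ Enc G x i ∈ Set.Icc (-δ) δ := by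
  have hl := hS.l_pos
  have hε : 0 ≤ δ * l / 2000 := by positivity
  refine abs_le.mp ((abs_clampMove_le hx _ i).trans ?_)
  rw [Pi.smul_apply, smul_eq_mul, abs_mul, abs_of_nonneg hε]
  refine (mul_le_mul_of_nonneg_left (abs_fieldOf_le hm hS hEnc hx i) hε).trans ?_
  exact le_of_eq (by field_simp)

/-- If the scaled field is coordinatewise `1`-Lipschitz, then the displaced point is coordinatewise
`2`-Lipschitz. -/
lemma abs_add_displacement_sub_le {ε : ℝ} {x y : Vec m} {i : Fin 4 × Fin m}
    (h : |ε * fieldOf ρ (segs Enc G) x i - ε * fieldOf ρ (segs Enc G) y i|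
      ≤ max |x i - y i| (nrm (x - y))) :
    |(x i + displacement ε ρ Enc G x i) - (y i + displacement ε ρ Enc G y i)|
      ≤ 2 * max |x i - y i| (nrm (x - y)) := by
  rw [displacement, displacement, add_clampMove_apply, add_clampMove_apply]
  refine (abs_max_min_sub_le _ _ _ _).trans ?_
  rw [Pi.smul_apply, Pi.smul_apply, smul_eq_mul, smul_eq_mul, add_sub_add_comm]
  have := abs_add_le (x i - y i) (ε * fieldOf ρ (segs Enc G) x i - ε * fieldOf ρ (segs Enc G) y i)
  linarith [le_max_left |x i - y i| (nrm (x - y))]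

end Displacement

section Locality

variable {m : ℕ} {κ l ρ : ℝ}

open Classical in
/-- The displacement near the segments as a function of the relative location. -/
lemma exists_displacement_eq_relativeLocation (hm : 0 < m) (hS : Scale κ l ρ) {ε : ℝ} (hε : 0 ≤ ε)
    (hε1 : ε ≤ 1 / 90) :
    ∃ Φ : Set (Vec m × Vec m) → Vec m, ∀ (n : ℕ) (Enc : (Fin n → Bool) → (Fin m → Bool)),
      IsCode κ Enc → ∀ G : EOL n, ∀ x ∈ cube m, (relativeLocation Enc (2 * ρ) G x).Nonempty →
        displacement ε ρ Enc G x = Φ (relativeLocation Enc (2 * ρ) G x) := by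
  let P : Set (Vec m × Vec m) → Vec m → Prop := fun R y =>
    ∃ (n : ℕ) (Enc : (Fin n → Bool) → (Fin m → Bool)) (G : EOL n) (x : Vec m),
      IsCode κ Enc ∧ x ∈ cube m ∧ relativeLocation Enc (2 * ρ) G x = R ∧
        displacement ε ρ Enc G x = y
  refine ⟨fun R => if h : ∃ y, P R y then h.choose else 0, fun n Enc hEnc G x hx hne => ?_⟩
  have h : ∃ y, P (relativeLocation Enc (2 * ρ) G x) y := ⟨_, n, Enc, G, x, hEnc, hx, rfl, rfl⟩
  dsimp only
  rw [dif_pos h]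
  obtain ⟨n', Enc', G', x', hEnc', hx', hR, hy⟩ := h.choose_spec
  rw [← hy]
  exact clampMove_eq_of_relativeLocation_eq hm hS hEnc hEnc' hε hε1 hx hx' hne hR.symm

end Locality

end BrouwerEOL

end

theorem mainTheorem6 (κ : ℝ) (hκ : 0 < κ) :
    ∃ C > (0 : ℝ), ∃ c > (0 : ℝ), ∃ q : ℕ,
    ∃ h₀ > (0 : ℝ), ∀ h : ℝ, 0 < h → h ≤ h₀ →
    ∃ δ₀ > (0 : ℝ), ∀ δ : ℝ, 0 < δ → δ ≤ δ₀ →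
    ∀ m : ℕ, 0 < m →
    ∃ Φ : Set (BrouwerEOL.Vec m × BrouwerEOL.Vec m) → BrouwerEOL.Vec m,
    ∀ (n : ℕ) (Enc : (Fin n → Bool) → (Fin m → Bool)), BrouwerEOL.IsCode κ Enc →
    ∃ g : BrouwerEOL.EOL n → BrouwerEOL.Vec m → BrouwerEOL.Vec m,
      -- the displacement has entries in `[-δ, δ]` and keeps points in the cube
      (∀ G, ∀ x ∈ BrouwerEOL.cube m,
        (∀ i, g G x i ∈ Set.Icc (-δ) δ) ∧ x + g G x ∈ BrouwerEOL.cube m) ∧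
      -- `g` and `x ↦ x + g x` are Lipschitz
      (∀ G, ∀ x ∈ BrouwerEOL.cube m, ∀ y ∈ BrouwerEOL.cube m,
        BrouwerEOL.nrm (g G x - g G y) ≤ C * BrouwerEOL.nrm (x - y) ∧
        BrouwerEOL.nrm ((x + g G x) - (y + g G y)) ≤ C * BrouwerEOL.nrm (x - y)) ∧
      -- the stronger, coordinatewise Lipschitz condition
      (∀ G, ∀ x ∈ BrouwerEOL.cube m, ∀ y ∈ BrouwerEOL.cube m, ∀ i,
        |g G x i - g G y i| ≤ C * max |x i - y i| (BrouwerEOL.nrm (x - y)) ∧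
        |(x i + g G x i) - (y i + g G y i)| ≤ C * max |x i - y i| (BrouwerEOL.nrm (x - y))) ∧
      -- the displacement is large away from the endpoints of paths
      (∀ G, ∀ x ∈ BrouwerEOL.cube m,
        (∀ v, G.IsEndpoint v → 2 * Real.sqrt h ≤ BrouwerEOL.nrm (x - BrouwerEOL.blocks
          (BrouwerEOL.toReal (Enc v)) (BrouwerEOL.toReal (Enc v)) 0 0)) →
        c * h * δ ≤ BrouwerEOL.nrm (g G x)) ∧
      -- close to Brouwer line segments, only the location relative to their endpoints matters
      (∀ G, ∀ x ∈ BrouwerEOL.cube m,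
        (BrouwerEOL.relativeLocation Enc (2 * Real.sqrt h) G x).Nonempty →
        g G x = Φ (BrouwerEOL.relativeLocation Enc (2 * Real.sqrt h) G x)) ∧
      -- far from all Brouwer line segments, the graph does not matter
      (∀ G G', ∀ x ∈ BrouwerEOL.cube m,
        (∀ s t, BrouwerEOL.IsSegment Enc G s t → BrouwerEOL.FarFrom (2 * Real.sqrt h) s t x) →
        (∀ s t, BrouwerEOL.IsSegment Enc G' s t → BrouwerEOL.FarFrom (2 * Real.sqrt h) s t x) →
        g G x = g G' x) ∧
      -- each value is computed with a constant number of successor/predecessor queries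
      (∀ x ∈ BrouwerEOL.cube m, ∃ A : BrouwerEOL.QueryAlg n (BrouwerEOL.Vec m),
        ∀ G, A.run G = g G x ∧ A.cost G ≤ q) := by
  have hμ : 0 < min κ 1 := lt_min hκ one_pos
  -- `l` is a lower bound for the normalized lengths of the segments: a step between codewords has
  -- squared length at least `κ / 4`, and a step that switches a whole block has `1 / 4`.
  obtain ⟨l, hl, hl1, hl2⟩ : ∃ l : ℝ, 0 < l ∧ l ≤ 1 / 2 ∧ 4 * l ^ 2 = min κ 1 := by
    refine ⟨Real.sqrt (min κ 1) / 2, by positivity, ?_, ?_⟩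
    · have := Real.sqrt_le_one.mpr (min_le_right κ 1)
      linarith
    · rw [div_pow, Real.sq_sqrt hμ.le]
      ring
  refine ⟨5, by norm_num, l / 128000, by positivity, 4, (l / 100) ^ 2, by positivity,
    fun h hh hh₀ => ?_⟩
  have hρ : 0 < Real.sqrt h := Real.sqrt_pos.mpr hh
  have hρl : Real.sqrt h ≤ l / 100 := Real.sqrt_le_iff.mpr ⟨by positivity, hh₀⟩
  have hhρ : h ≤ Real.sqrt h := by nlinarith [Real.sq_sqrt hh.le]
  set ρ := Real.sqrt h
  have hS : BrouwerEOL.Scale κ l ρ := ⟨hl, hl1, hl2.le, hρ, hρl⟩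
  obtain ⟨K, hK, hLip⟩ := BrouwerEOL.exists_fieldOf_lipschitz hS
  -- The field is bounded by `2000 / l` and `K`-Lipschitz, so that after scaling by `δ * l / 2000`
  -- it is bounded by `δ` and `1`-Lipschitz.
  refine ⟨min 1 (2000 / (l * (K + 1))), by positivity, fun δ hδ hδ₀ m hm => ?_⟩
  have hδ1 : δ ≤ 1 := hδ₀.trans (min_le_left _ _)
  have hε : 0 ≤ δ * l / 2000 := by positivity
  have hε1 : δ * l / 2000 ≤ 1 / 90 := by nlinarith
  have hεK : δ * l / 2000 * K ≤ 1 := by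
    have h1 := hδ₀.trans (min_le_right _ _)
    rw [le_div_iff₀ (by positivity)] at h1
    nlinarith [mul_pos hδ hl]
  have hεl : δ * l / 2000 * (1 / l) ≤ 1 / 16 := by
    rw [show δ * l / 2000 * (1 / l) = δ / 2000 by field_simp]
    linarith
  obtain ⟨Φ, hΦ⟩ := BrouwerEOL.exists_displacement_eq_relativeLocation (κ := κ) hm hS hε hε1
  refine ⟨Φ, fun n Enc hEnc => ⟨BrouwerEOL.displacement (δ * l / 2000) ρ Enc, ?_⟩⟩
  have hf : ∀ G, ∀ x ∈ BrouwerEOL.cube m, ∀ y ∈ BrouwerEOL.cube m, ∀ i,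
      |(x i + BrouwerEOL.displacement (δ * l / 2000) ρ Enc G x i)
        - (y i + BrouwerEOL.displacement (δ * l / 2000) ρ Enc G y i)|
        ≤ 2 * max |x i - y i| (BrouwerEOL.nrm (x - y)) := by
    intro G x hx y hy i
    apply BrouwerEOL.abs_add_displacement_sub_le
    rw [← mul_sub, abs_mul, abs_of_nonneg hε]
    have h0 : 0 ≤ max |x i - y i| (BrouwerEOL.nrm (x - y)) :=
      (abs_nonneg _).trans (le_max_left _ _)
    calc _ ≤ δ * l / 2000 * (K * max |x i - y i| (BrouwerEOL.nrm (x - y))) :=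
          mul_le_mul_of_nonneg_left (hLip hm hEnc G i x hx y hy) hε
      _ = δ * l / 2000 * K * max |x i - y i| (BrouwerEOL.nrm (x - y)) := by ring
      _ ≤ _ := mul_le_of_le_one_left h0 hεK
  have hg : ∀ G, ∀ x ∈ BrouwerEOL.cube m, ∀ y ∈ BrouwerEOL.cube m, ∀ i,
      |BrouwerEOL.displacement (δ * l / 2000) ρ Enc G x i
        - BrouwerEOL.displacement (δ * l / 2000) ρ Enc G y i|
        ≤ 3 * max |x i - y i| (BrouwerEOL.nrm (x - y)) := by
    intro G x hx y hy i
    have h1 := abs_le.mp (hf G x hx y hy i)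
    have h2 := abs_le.mp (le_max_left |x i - y i| (BrouwerEOL.nrm (x - y)))
    exact abs_le.mpr ⟨by linarith [h1.1, h2.2], by linarith [h1.2, h2.1]⟩
  have hmax : ∀ x y : BrouwerEOL.Vec m, ∀ i, 0 ≤ max |x i - y i| (BrouwerEOL.nrm (x - y)) :=
    fun x y i => (abs_nonneg _).trans (le_max_left _ _)
  refine ⟨fun G x hx => ⟨fun i => BrouwerEOL.displacement_mem_Icc hm hS hEnc hδ.le hx i,
      BrouwerEOL.add_clampMove_mem _ _⟩, fun G x hx y hy => ⟨?_, ?_⟩,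
    fun G x hx y hy i => ⟨?_, ?_⟩, fun G x hx hfar => ?_,
    fun G x hx hne => hΦ n Enc hEnc G x hx hne, fun G G' x hx h1 h2 => ?_, fun x hx => ?_⟩
  · exact BrouwerEOL.nrm_le_of_abs_le_max hm (hg G x hx y hy)
  · refine BrouwerEOL.nrm_le_of_abs_le_max hm fun i => (hf G x hx y hy i).trans ?_
    exact mul_le_mul_of_nonneg_right (by norm_num) (hmax x y i)
  · exact (hg G x hx y hy i).trans (mul_le_mul_of_nonneg_right (by norm_num) (hmax x y i))
  · exact (hf G x hx y hy i).trans (mul_le_mul_of_nonneg_right (by norm_num) (hmax x y i))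
  · refine le_trans ?_ (BrouwerEOL.le_nrm_clampMove_fieldOf hm hS hEnc hε hεl hx hfar)
    have := mul_le_mul_of_nonneg_left hhρ (by positivity : 0 ≤ l * δ)
    linarith
  · rw [BrouwerEOL.displacement, BrouwerEOL.displacement,
      BrouwerEOL.fieldOf_eq_default_of_far hm hS hEnc hx h1,
      BrouwerEOL.fieldOf_eq_default_of_far hm hS hEnc hx h2]
  · apply BrouwerEOL.exists_queryAlg _ (BrouwerEOL.nearWord Enc (2 * ρ) 0 x)
      (BrouwerEOL.nearWord Enc (2 * ρ) 1 x)
    intro G G' hGG'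
    rw [BrouwerEOL.displacement, BrouwerEOL.displacement,
      BrouwerEOL.fieldOf_eq_of_sameAnswers hm hS hEnc hx hGG']
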